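/- **Model.** A system has $n\ge 0$ processes $p_1,\dots,p_n$, of which up to $t$ may crash. A deterministic algorithm $A$ gives each process (depending on its identity) an initial state, determined by its private input in $\mathbb I\cup\{\bot\}$ and its private local seed in an infinite set $S$ (the seed of its pseudo-random generator), and a transition function: in a step a process observes a set of communicated pieces of information, changes its state, possibly outputs a value in $\{0,1\}$, and possibly communicates information. A failure pattern gives the instant at which each faulty process stops; processes that never stop are correct. In $\mathrm{Sync}$, processes proceed in lock-step rounds, each made of a communication step followed by a computation step, and a process may crash before either of them; all information communicated in the communication step of a round is observed, in that step, by all processes that reach the computation step of the round; outputs are made in computation steps. In $\mathrm{Async}$, each process takes its steps at arbitrary instants of a global time that it cannot read, infinitely often if it is correct; communication delays are positive and arbitrary, possibly different for each receiver, and only communicated information can be observed; every piece of information communicated by a correct process is observed by some correct process (C-Local-Termination), and every piece of information observed by some process is observed by all correct processes (C-Global-Termination). The output set of an execution is the set of the values output by its processes, crashed or not. An algorithm $A$ *implements* a non-empty $O\subseteq\{\varnothing,\{0\},\{1\},\{0,1\}\}$ under $(n,t,\sigma)$, $\sigma\in\{\mathrm{Async},\mathrm{Sync}\}$, if for every $0\le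 f\le t$: (Safety) in all executions with exactly $f$ crashes, for all input vectors, seeds, failure patterns and timing patterns allowed by $\sigma$, every process outputs at most one value and the output set belongs to $O$; (Completeness) every $o\in O$ is the output set of some execution with exactly $f$ crashes. $O$ is *implementable* under $(n,t,\sigma)$ if some algorithm implements it. **Theorem.** Let $\mathbb I$ be any input alphabet, $S$ any infinite set of local seeds, and $n,t$ natural numbers. Each of the 15 non-empty sets $O\subseteq\{\varnothing,\{0\},\{1\},\{0,1\}\}$ is implementable under $(n,t,\sigma)$ if and only if the following condition holds (for both values of $\sigma$, unless one is named). 1. $\{\varnothing,\{0\},\{1\},\{0,1\}\}$: $n\ge t$ and $n\ge 2$. 2. $\{\{0\},\{1\},\{0,1\}\}$: $n>t$ and $n\ge 2$. 3. $\{\varnothing,\{1\},\{0,1\}\}$: $n\ge t$ and $n\ge 2$. 4. $\{\{1\},\{0,1\}\}$: $n>t$ and $n\ge 2$. 5. $\{\varnothing,\{0\},\{0,1\}\}$: $n\ge t$ and $n\ge 2$. 6. $\{\{0\},\{0,1\}\}$: $n>t$ and $n\ge 2$. 7. $\{\varnothing,\{0,1\}\}$: $n>\frac32t+1$ and $n\ge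 2$ in $\mathrm{Async}$; $n\ge t+2$ and $n\ge 2$ in $\mathrm{Sync}$. 8. $\{\{0,1\}\}$: $n>\frac32t+1$ and $n\ge 2$ in $\mathrm{Async}$; $n\ge t+2$ and $n\ge 2$ in $\mathrm{Sync}$. 9. $\{\varnothing,\{0\},\{1\}\}$: $n\ge t$ and $n\ge 1$. 10. $\{\{0\},\{1\}\}$: $t=0$ and $n\ge 1$ in $\mathrm{Async}$; $n>t$ and $n\ge 1$ in $\mathrm{Sync}$. 11. $\{\varnothing,\{1\}\}$: $n\ge t$ and $n\ge 1$. 12. $\{\{1\}\}$: $n>t$ and $n\ge 1$. 13. $\{\varnothing,\{0\}\}$: $n\ge t$ and $n\ge 1$. 14. $\{\{0\}\}$: $n>t$ and $n\ge 1$. 15. $\{\varnothing\}$: $n\ge t$. (The sixteenth set, $O=\varnothing$, is excluded by the definition.) -/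

import Mathlib

namespace BinaryOutput

/-- The two timing models. -/
inductive Timing where
  | async
  | sync

/-- A deterministic algorithm for the processes `Fin n`, with input alphabet `I`
(an input is an element of `Option I`, where `none` stands for `⊥`) and local seeds in `S`.
Process `p` starts in the state given by its identity, its input and its local seed.
`message p s` is the information (if any) that `p` communicates when its state is `s`;
`compute p s M` is the effect of a local computation of `p` in state `s` when it observes the set
`M` of information: the new state, and the value (if any) that `p` outputs. -/
structure Algorithm (n : ℕ) (I S : Type) where
  State : Type
  Msg : Type
  init : Fin n → Option I → S → State
  message : Fin n → State → Option Msg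
  compute : Fin n → State → Set Msg → State × Option (Fin 2)

/-- A failure pattern gives the instant at which each process crashes, `⊤` if it never does.
A process `p` acts exactly at (some of) the instants `τ` with `τ < fp p`. -/
abbrev FailurePattern (n : ℕ) : Type := Fin n → ℕ∞

/-- A correct process never crashes. -/
def Correct {n : ℕ} (fp : FailurePattern n) (p : Fin n) : Prop := fp p = ⊤

/-- The failure patterns for `n` processes with exactly `f` crashes. -/
def FP (n f : ℕ) : Set (FailurePattern n) := {fp | {p | ¬ Correct fp p}.ncard = f}

section Sync

variable {n : ℕ} {I S : Type} (A : Algorithm n I S)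

/-! Synchronous executions. Round `R` (numbered from `0`) has a communication step, at instant
`2 * R`, and a computation step, at instant `2 * R + 1`. All the information communicated in the
communication step is observed in it by all the processes that reach the computation step. -/

/-- The set of information communicated (hence observed) in round `R`, if the processes are in the
states `st` at the start of the round. -/
def syncObserved (fp : FailurePattern n) (R : ℕ) (st : Fin n → A.State) : Set A.Msg :=
  {m | ∃ p, ((2 * R : ℕ) : ℕ∞) < fp p ∧ A.message p (st p) = some m}

open Classical in
/-- The states of the processes at the start of round `R`. -/
noncomputable def syncState (Vin : Fin n → Option I) (sd : Fin n → S) (fp : FailurePattern n) :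
    ℕ → Fin n → A.State
  | 0 => fun p => A.init p (Vin p) (sd p)
  | R + 1 => fun p =>
      if ((2 * R + 1 : ℕ) : ℕ∞) < fp p then
        (A.compute p (syncState Vin sd fp R p)
          (syncObserved A fp R (syncState Vin sd fp R))).1
      else syncState Vin sd fp R p

/-- Process `p` outputs the value `v` in the synchronous execution. -/
def SyncOutputs (Vin : Fin n → Option I) (sd : Fin n → S) (fp : FailurePattern n)
    (p : Fin n) (v : Fin 2) : Prop :=
  ∃ R : ℕ, ((2 * R + 1 : ℕ) : ℕ∞) < fp p ∧
    (A.compute p (syncState A Vin sd fp R p)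
      (syncObserved A fp R (syncState A Vin sd fp R))).2 = some v

end Sync

/-- The timing of an asynchronous execution. `steps p` is the set of the (global) instants at which
the local time of `p` advances and `p` takes a step, unless it has crashed; processes cannot read
global time. `arrival p s q` is the instant at which `q` observes the information communicated by
`p` at instant `s` (if any), `⊤` if `q` never does. Delays are positive. -/
structure AsyncPattern (n : ℕ) where
  steps : Fin n → Set ℕ
  arrival : Fin n → ℕ → Fin n → ℕ∞
  lt_arrival : ∀ (p : Fin n) (s : ℕ) (q : Fin n), ((s : ℕ) : ℕ∞) < arrival p s q

section Async

variable {n : ℕ} {I S : Type} (A : Algorithm n I S)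

/-- A configuration: the local states, and for each process `p` and each past instant `s`, the
information communicated by `p` at instant `s` (`none` if there is none). -/
structure AsyncConfig where
  state : Fin n → A.State
  log : Fin n → ℕ → Option A.Msg

/-- `p` takes a step at instant `τ`. -/
def TakesStep (fp : FailurePattern n) (c : AsyncPattern n) (p : Fin n) (τ : ℕ) : Prop :=
  τ ∈ c.steps p ∧ (τ : ℕ∞) < fp p

/-- The information that arrives at `q` at instant `τ`. -/
def asyncObserved (c : AsyncPattern n) (τ : ℕ) (C : AsyncConfig A) (q : Fin n) : Set A.Msg :=
  {m | ∃ p s, C.log p s = some m ∧ c.arrival p s q = (τ : ℕ∞)}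

open Classical in
/-- The configuration just before instant `τ`. In a step, a process observes the information that
arrives, computes, possibly outputs a value, and then communicates the message of its new state. -/
noncomputable def asyncRun (Vin : Fin n → Option I) (sd : Fin n → S) (fp : FailurePattern n)
    (c : AsyncPattern n) : ℕ → AsyncConfig A
  | 0 => { state := fun p => A.init p (Vin p) (sd p), log := fun _ _ => none }
  | τ + 1 =>
      let C := asyncRun Vin sd fp c τ
      let new : Fin n → A.State := fun p => (A.compute p (C.state p) (asyncObserved A c τ C p)).1
      { state := fun p => if TakesStep fp c p τ then new p else C.state p
        log := fun p s =>
          if s = τ then (if TakesStep fp c p τ then A.message p (new p) else none)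
          else C.log p s }

/-- `p` communicates the information `m` at instant `s`. -/
def Communicates (Vin : Fin n → Option I) (sd : Fin n → S) (fp : FailurePattern n)
    (c : AsyncPattern n) (p : Fin n) (s : ℕ) (m : A.Msg) : Prop :=
  (asyncRun A Vin sd fp c (s + 1)).log p s = some m

/-- `q` observes the information communicated by `p` at instant `s`. -/
def Observes (Vin : Fin n → Option I) (sd : Fin n → S) (fp : FailurePattern n)
    (c : AsyncPattern n) (q p : Fin n) (s : ℕ) : Prop :=
  (∃ m, Communicates A Vin sd fp c p s m) ∧
    ∃ τ : ℕ, c.arrival p s q = (τ : ℕ∞) ∧ TakesStep fp c q τ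

/-- The timing patterns that the asynchronous model allows. (That information is observed only
if it was communicated before is built into the run.) -/
structure AsyncAdmissible (Vin : Fin n → Option I) (sd : Fin n → S) (fp : FailurePattern n)
    (c : AsyncPattern n) : Prop where
  /-- Correct processes take infinitely many steps. -/
  fair : ∀ p, Correct fp p → (c.steps p).Infinite
  /-- C-Local-Termination. -/
  localTermination : ∀ p s m, Correct fp p → Communicates A Vin sd fp c p s m →
    ∃ q, Correct fp q ∧ Observes A Vin sd fp c q p s
  /-- C-Global-Termination. -/
  globalTermination : ∀ p s q, Observes A Vin sd fp c q p s →
    ∀ q', Correct fp q' → Observes A Vin sd fp c q' p s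

/-- Process `p` outputs the value `v` in the asynchronous execution. -/
def AsyncOutputs (Vin : Fin n → Option I) (sd : Fin n → S) (fp : FailurePattern n)
    (c : AsyncPattern n) (p : Fin n) (v : Fin 2) : Prop :=
  ∃ τ : ℕ, TakesStep fp c p τ ∧
    (A.compute p ((asyncRun A Vin sd fp c τ).state p)
      (asyncObserved A c τ (asyncRun A Vin sd fp c τ) p)).2 = some v

end Async

/-- Communication-delay patterns. In the synchronous model there is nothing to choose: all the
information of a round is observed in the communication step of that round. -/
def DelayPattern (n : ℕ) : Timing → Type
  | .async => AsyncPattern n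
  | .sync => Unit

section

variable {n : ℕ} {I S : Type} (A : Algorithm n I S)

/-- The communication-delay patterns that the timing model allows. -/
def CDP (Vin : Fin n → Option I) (sd : Fin n → S) (fp : FailurePattern n) :
    (σ : Timing) → Set (DelayPattern n σ)
  | .async => {c : AsyncPattern n | AsyncAdmissible A Vin sd fp c}
  | .sync => Set.univ

/-- `p` outputs the value `v` in the execution `(A, Vin, sd, fp, cdp)`. -/
def Outputs (Vin : Fin n → Option I) (sd : Fin n → S) (fp : FailurePattern n) :
    (σ : Timing) → DelayPattern n σ → Fin n → Fin 2 → Prop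
  | .async, cdp => AsyncOutputs A Vin sd fp cdp
  | .sync, _ => SyncOutputs A Vin sd fp

/-- `Vout` is the output vector of the execution `(A, Vin, sd, fp, cdp)`. There is one if and only
if no process outputs two different values in the execution. -/
def IsOutputVector (Vin : Fin n → Option I) (sd : Fin n → S) (fp : FailurePattern n)
    (σ : Timing) (cdp : DelayPattern n σ) (Vout : Fin n → Option (Fin 2)) : Prop :=
  ∀ p v, Vout p = some v ↔ Outputs A Vin sd fp σ cdp p v

end

/-- The output set of an output vector. -/
def OS {n : ℕ} (Vout : Fin n → Option (Fin 2)) : Set (Fin 2) := {v | ∃ p, Vout p = some v}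

/-- `A` implements the set of output sets `O` with at most `t` crashes in timing model `σ`. -/
structure Implements {n : ℕ} {I S : Type} (A : Algorithm n I S) (t : ℕ) (σ : Timing)
    (O : Set (Set (Fin 2))) : Prop where
  nonempty : O.Nonempty
  safety : ∀ f ≤ t, ∀ (Vin : Fin n → Option I) (sd : Fin n → S), ∀ fp ∈ FP n f,
    ∀ cdp ∈ CDP A Vin sd fp σ,
      ∃ Vout, IsOutputVector A Vin sd fp σ cdp Vout ∧ OS Vout ∈ O
  completeness : ∀ f ≤ t, ∀ o ∈ O, ∃ (Vin : Fin n → Option I) (sd : Fin n → S),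
    ∃ fp ∈ FP n f, ∃ cdp ∈ CDP A Vin sd fp σ,
      ∃ Vout, IsOutputVector A Vin sd fp σ cdp Vout ∧ OS Vout = o

/-- Some algorithm implements `O` under the system configuration `(n, t, σ)`, for the input
alphabet `I` and local seeds in `S`. -/
def Implementable (I S : Type) (n t : ℕ) (σ : Timing) (O : Set (Set (Fin 2))) : Prop :=
  ∃ A : Algorithm n I S, Implements A t σ O

end BinaryOutput

/-!
Which sets of binary output sets can be implemented in spite of `t` crashes.

*Impossibility.* If all processes may crash, they may do so before any output; and two outputs need
two processes. Three arguments go further.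

In the synchronous model, let both values be output (or none), and consider the first output of a
crash-free execution, by `p`. If all processes but `p` crash immediately before the computation step
of this output, only one value is output; hence at least two processes have to be correct
(`add_two_le_of_implements_sync_both`).

In the asynchronous model, let both values be output (or none). A process is poised if it crashes
immediately before it makes an output. As long as one to `t` processes are poised, the others have
to output something, since they cannot tell whether a poised process made its output (in which case
both values are required); the first one to do so is made poised in turn (`Poised.extend`). Among
`t + 1` poised processes, those poised to output the more frequent value are then allowed to take
their step and to survive, while all the others crash. This is a single value, output with at most
`t` crashes unless `3 * t + 2 < 2 * n` (`false_of_poised`).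

Agreement on one value is impossible in the asynchronous model with one crash by the theorem of
Fischer, Lynch and Paterson (`not_implements_agreement`). Executions here are prefixes `(c, T)` of
timing patterns. The central fact `exists_common_reach` is that two prefixes that differ only in the
behaviour of one process `q`, whose recent messages are still in transit, have a common reachable
value, obtained by letting `q` crash. Exchanging the behaviour of one process after the other, one
concludes that a bivalent initial configuration exists (`exists_bivalent_init`) and that any pending
step or observation can take place so that the prefix remains bivalent (`exists_bivalent_done`). In
the limit this gives an admissible execution without output.

*Algorithms.* Most sets are implemented by `twoPhase`, where outputs are chosen by the seeds and the
second value is output only by a process that has observed an output of the first one. In the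
synchronous model a round of communication is observed by all in the same way, which yields
agreement (`leastValue`) and lets the processes take turns to output both values (`takeTurns`). In
the asynchronous model both values are output by three groups of processes such that any two of them
contain more than `t` processes: the first group outputs 0, the second one 1, and the third one the
opposite of what it hears of first (`threeGroups`).
-/

namespace BinaryOutput

/-! ### Asynchronous executions: comparison and continuation -/

section AsyncTools

variable {n : ℕ} {I S : Type} (A : Algorithm n I S)

/-- The result of the computation that `p` would make (and makes, if it takes a step) at instant
`τ`: the value that it outputs, if any. -/
noncomputable def stepOut (Vin : Fin n → Option I) (sd : Fin n → S) (fp : FailurePattern n)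
    (c : AsyncPattern n) (p : Fin n) (τ : ℕ) : Option (Fin 2) :=
  (A.compute p ((asyncRun A Vin sd fp c τ).state p)
    (asyncObserved A c τ (asyncRun A Vin sd fp c τ) p)).2

/-- `p` takes a step at instant `τ` and outputs `v` in it. -/
def OutputsAt (Vin : Fin n → Option I) (sd : Fin n → S) (fp : FailurePattern n)
    (c : AsyncPattern n) (p : Fin n) (τ : ℕ) (v : Fin 2) : Prop :=
  TakesStep fp c p τ ∧ stepOut A Vin sd fp c p τ = some v

variable {A}

theorem state_succ (Vin : Fin n → Option I) (sd : Fin n → S) (fp : FailurePattern n)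
    (c : AsyncPattern n) (τ : ℕ) (p : Fin n) :
    ((TakesStep fp c p τ) → (asyncRun A Vin sd fp c (τ + 1)).state p =
      (A.compute p ((asyncRun A Vin sd fp c τ).state p)
        (asyncObserved A c τ (asyncRun A Vin sd fp c τ) p)).1) ∧
    (¬ (TakesStep fp c p τ) → (asyncRun A Vin sd fp c (τ + 1)).state p =
      (asyncRun A Vin sd fp c τ).state p) := by
  constructor <;> intro h <;> simp [asyncRun, h]

theorem log_succ (Vin : Fin n → Option I) (sd : Fin n → S) (fp : FailurePattern n)
    (c : AsyncPattern n) (τ : ℕ) (p : Fin n) (s : ℕ) :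
    ((s ≠ τ) → (asyncRun A Vin sd fp c (τ + 1)).log p s = (asyncRun A Vin sd fp c τ).log p s) ∧
    (s = τ → TakesStep fp c p τ → (asyncRun A Vin sd fp c (τ + 1)).log p s =
      A.message p ((asyncRun A Vin sd fp c (τ + 1)).state p)) ∧
    (s = τ → ¬ TakesStep fp c p τ → (asyncRun A Vin sd fp c (τ + 1)).log p s = none) := by
  refine ⟨fun h => ?_, fun h h' => ?_, fun h h' => ?_⟩ <;> simp [asyncRun, *]

/-- The log at a later time, read at an instant `s`, is what was communicated at instant `s`. -/
theorem log_eq_ite (Vin : Fin n → Option I) (sd : Fin n → S) (fp : FailurePattern n)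
    (c : AsyncPattern n) (τ : ℕ) (p : Fin n) (s : ℕ) :
    (s < τ → (asyncRun A Vin sd fp c τ).log p s = (asyncRun A Vin sd fp c (s + 1)).log p s) ∧
    (τ ≤ s → (asyncRun A Vin sd fp c τ).log p s = none) := by
  induction τ with
  | zero => exact ⟨fun h => absurd h (by omega), fun _ => rfl⟩
  | succ τ ih =>
    constructor
    · intro h
      rcases Nat.lt_or_ge s τ with h1 | h1
      · rw [(log_succ Vin sd fp c τ p s).1 (by omega), ih.1 h1]
      · obtain rfl : s = τ := by omega
        rfl
    · intro h
      rw [(log_succ Vin sd fp c τ p s).1 (by omega), ih.2 (by omega)]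

theorem log_eq_some {Vin : Fin n → Option I} {sd : Fin n → S} {fp : FailurePattern n}
    {c : AsyncPattern n} {τ : ℕ} {p : Fin n} {s : ℕ} {m : A.Msg}
    (h : (asyncRun A Vin sd fp c τ).log p s = some m) :
    s < τ ∧ Communicates A Vin sd fp c p s m := by
  have h1 : s < τ := by
    by_contra h1
    rw [(log_eq_ite Vin sd fp c τ p s).2 (by omega)] at h
    cases h
  refine ⟨h1, ?_⟩
  rw [(log_eq_ite Vin sd fp c τ p s).1 h1] at h
  exact h

theorem communicates_iff {Vin : Fin n → Option I} {sd : Fin n → S} {fp : FailurePattern n}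
    {c : AsyncPattern n} {p : Fin n} {s : ℕ} {m : A.Msg} :
    Communicates A Vin sd fp c p s m ↔
      TakesStep fp c p s ∧ A.message p ((asyncRun A Vin sd fp c (s + 1)).state p) = some m := by
  unfold Communicates
  by_cases h : TakesStep fp c p s
  · rw [(log_succ Vin sd fp c s p s).2.1 rfl h]; simp [h]
  · rw [(log_succ Vin sd fp c s p s).2.2 rfl h]; simp [h]

theorem mem_asyncObserved {Vin : Fin n → Option I} {sd : Fin n → S} {fp : FailurePattern n}
    {c : AsyncPattern n} {τ : ℕ} {q : Fin n} {m : A.Msg} :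
    m ∈ asyncObserved A c τ (asyncRun A Vin sd fp c τ) q ↔
      ∃ p s, Communicates A Vin sd fp c p s m ∧ c.arrival p s q = (τ : ℕ∞) := by
  constructor
  · rintro ⟨p, s, h, h'⟩
    exact ⟨p, s, (log_eq_some h).2, h'⟩
  · rintro ⟨p, s, h, h'⟩
    refine ⟨p, s, ?_, h'⟩
    have : s < τ := by
      have := c.lt_arrival p s q
      rw [h'] at this
      exact_mod_cast this
    rw [(log_eq_ite Vin sd fp c τ p s).1 this]
    exact h

/-- If two configurations agree on the messages that are sent before the instants `θ p`, and the
messages arriving at `q` at instant `τ` are the same ones among these while no later ones arrive,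
then `q` observes the same set of information. -/
theorem asyncObserved_congr {c c' : AsyncPattern n} {C C' : AsyncConfig A} {θ : Fin n → ℕ∞}
    {τ : ℕ} {q : Fin n} (hlog : ∀ p (s : ℕ), (s : ℕ∞) < θ p → C.log p s = C'.log p s)
    (harr : ∀ p (s : ℕ), (s : ℕ∞) < θ p →
      (c.arrival p s q = (τ : ℕ∞) ↔ c'.arrival p s q = (τ : ℕ∞)))
    (hlate : ∀ p (s : ℕ), θ p ≤ s → c.arrival p s q = (τ : ℕ∞) → C.log p s = none)
    (hlate' : ∀ p (s : ℕ), θ p ≤ s → c'.arrival p s q = (τ : ℕ∞) → C'.log p s = none) :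
    asyncObserved A c τ C q = asyncObserved A c' τ C' q := by
  ext m
  constructor
  · rintro ⟨p, s, h, h'⟩
    rcases lt_or_ge (s : ℕ∞) (θ p) with h1 | h1
    · exact ⟨p, s, by rw [← hlog p s h1, h], (harr p s h1).1 h'⟩
    · rw [hlate p s h1 h'] at h; cases h
  · rintro ⟨p, s, h, h'⟩
    rcases lt_or_ge (s : ℕ∞) (θ p) with h1 | h1
    · exact ⟨p, s, by rw [hlog p s h1, h], (harr p s h1).2 h'⟩
    · rw [hlate' p s h1 h'] at h; cases h

theorem log_eq_none_of_not_takesStep {Vin : Fin n → Option I} {sd : Fin n → S}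
    {fp : FailurePattern n} {c : AsyncPattern n} {τ : ℕ} {p : Fin n} {s : ℕ}
    (h : ¬ TakesStep fp c p s) : (asyncRun A Vin sd fp c τ).log p s = none := by
  rcases hm : (asyncRun A Vin sd fp c τ).log p s with _ | m
  · rfl
  · exact absurd (communicates_iff.1 (log_eq_some hm).2).1 h

/-- Two executions that each process `p` cannot distinguish before the instant `θ p`: if the
inputs, the steps and the arrivals agree up to these instants, and nothing that is sent by a
process `p` from `θ p` on is observed, then the runs agree. -/
theorem asyncRun_agree {Vin Vin' : Fin n → Option I} {sd sd' : Fin n → S}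
    {fp fp' : FailurePattern n} {c c' : AsyncPattern n} (θ : Fin n → ℕ∞) (N : ℕ)
    (hinit : ∀ q, 0 < θ q → A.init q (Vin q) (sd q) = A.init q (Vin' q) (sd' q))
    (hstep : ∀ q (τ : ℕ), τ < N → (τ : ℕ∞) < θ q → (TakesStep fp c q τ ↔ TakesStep fp' c' q τ))
    (harr : ∀ q (τ : ℕ), τ < N → (τ : ℕ∞) < θ q → TakesStep fp c q τ → ∀ p (s : ℕ),
      (s : ℕ∞) < θ p → (c.arrival p s q = (τ : ℕ∞) ↔ c'.arrival p s q = (τ : ℕ∞)))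
    (hlate : ∀ q (τ : ℕ), τ < N → (τ : ℕ∞) < θ q → TakesStep fp c q τ → ∀ p (s : ℕ),
      θ p ≤ s → c.arrival p s q = (τ : ℕ∞) → ¬ TakesStep fp c p s)
    (hlate' : ∀ q (τ : ℕ), τ < N → (τ : ℕ∞) < θ q → TakesStep fp c q τ → ∀ p (s : ℕ),
      θ p ≤ s → c'.arrival p s q = (τ : ℕ∞) → ¬ TakesStep fp' c' p s)
    (τ : ℕ) (hτ : τ ≤ N) :
    (∀ q, A.init q (Vin q) (sd q) = A.init q (Vin' q) (sd' q) → (τ : ℕ∞) ≤ θ q →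
      (asyncRun A Vin sd fp c τ).state q = (asyncRun A Vin' sd' fp' c' τ).state q) ∧
    ∀ p (s : ℕ), (s : ℕ∞) < θ p →
      (asyncRun A Vin sd fp c τ).log p s = (asyncRun A Vin' sd' fp' c' τ).log p s := by
  induction τ with
  | zero => exact ⟨fun q h _ => h, fun _ _ _ => rfl⟩
  | succ τ ih =>
    obtain ⟨ih1, ih2⟩ := ih (by omega)
    have key : ∀ q, (τ : ℕ∞) < θ q →
        (asyncRun A Vin sd fp c (τ + 1)).state q = (asyncRun A Vin' sd' fp' c' (τ + 1)).state q := by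
      intro q hq
      have h0 : A.init q (Vin q) (sd q) = A.init q (Vin' q) (sd' q) :=
        hinit q (lt_of_le_of_lt (by simp) hq)
      by_cases hs : TakesStep fp c q τ
      · rw [(state_succ Vin sd fp c τ q).1 hs,
          (state_succ Vin' sd' fp' c' τ q).1 ((hstep q τ (by omega) hq).1 hs), ih1 q h0 hq.le,
          asyncObserved_congr ih2 (harr q τ (by omega) hq hs)
            (fun p s h h' => log_eq_none_of_not_takesStep (hlate q τ (by omega) hq hs p s h h'))
            (fun p s h h' => log_eq_none_of_not_takesStep (hlate' q τ (by omega) hq hs p s h h'))]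
      · rw [(state_succ Vin sd fp c τ q).2 hs,
          (state_succ Vin' sd' fp' c' τ q).2 (fun h => hs ((hstep q τ (by omega) hq).2 h)),
          ih1 q h0 hq.le]
    constructor
    · intro q _ hq
      apply key
      refine lt_of_lt_of_le ?_ hq
      exact_mod_cast Nat.lt_succ_self τ
    · intro p s hs
      by_cases h : s = τ
      · subst h
        by_cases h' : TakesStep fp c p s
        · rw [(log_succ Vin sd fp c s p s).2.1 rfl h', (log_succ Vin' sd' fp' c' s p s).2.1 rfl
            ((hstep p s (by omega) hs).1 h'), key p hs]
        · rw [(log_succ Vin sd fp c s p s).2.2 rfl h', (log_succ Vin' sd' fp' c' s p s).2.2 rfl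
            (fun h => h' ((hstep p s (by omega) hs).2 h))]
      · rw [(log_succ Vin sd fp c τ p s).1 h, (log_succ Vin' sd' fp' c' τ p s).1 h, ih2 p s hs]

/-- Executions with the same steps and the same observed arrivals before instant `N` have the same
configurations up to instant `N`. -/
theorem asyncRun_congr {Vin : Fin n → Option I} {sd : Fin n → S}
    {fp fp' : FailurePattern n} {c c' : AsyncPattern n} (N : ℕ)
    (hstep : ∀ q (τ : ℕ), τ < N → (TakesStep fp c q τ ↔ TakesStep fp' c' q τ))
    (harr : ∀ q (τ : ℕ), τ < N → TakesStep fp c q τ → ∀ p (s : ℕ),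
      (c.arrival p s q = (τ : ℕ∞) ↔ c'.arrival p s q = (τ : ℕ∞)))
    (τ : ℕ) (hτ : τ ≤ N) : asyncRun A Vin sd fp c τ = asyncRun A Vin sd fp' c' τ := by
  obtain ⟨h1, h2⟩ := asyncRun_agree (A := A) (Vin := Vin) (Vin' := Vin) (sd := sd) (sd' := sd)
    (fun _ => ⊤) N (fun _ _ => rfl) (fun q τ h _ => hstep q τ h)
    (fun q τ h _ h' p s _ => harr q τ h h' p s) (fun _ _ _ _ _ _ _ h => absurd h (by simp))
    (fun _ _ _ _ _ _ _ h => absurd h (by simp)) τ hτ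
  rcases hC : asyncRun A Vin sd fp c τ with ⟨st, lg⟩
  rcases hC' : asyncRun A Vin sd fp' c' τ with ⟨st', lg'⟩
  rw [hC, hC'] at h1 h2
  congr
  · funext q; exact h1 q rfl le_top
  · funext p s; exact h2 p s (by simp)

theorem outputsAt_congr {Vin : Fin n → Option I} {sd : Fin n → S}
    {fp fp' : FailurePattern n} {c c' : AsyncPattern n} {N : ℕ}
    (hstep : ∀ q (τ : ℕ), τ < N → (TakesStep fp c q τ ↔ TakesStep fp' c' q τ))
    (harr : ∀ q (τ : ℕ), τ < N → TakesStep fp c q τ → ∀ p (s : ℕ),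
      (c.arrival p s q = (τ : ℕ∞) ↔ c'.arrival p s q = (τ : ℕ∞)))
    {τ : ℕ} (hτ : τ < N) {q : Fin n} {v : Fin 2} :
    OutputsAt A Vin sd fp c q τ v ↔ OutputsAt A Vin sd fp' c' q τ v := by
  unfold OutputsAt
  rw [← hstep q τ hτ]
  refine and_congr_right fun h => ?_
  unfold stepOut
  rw [← asyncRun_congr N hstep harr τ hτ.le]
  rw [show asyncObserved A c τ (asyncRun A Vin sd fp c τ) q =
    asyncObserved A c' τ (asyncRun A Vin sd fp c τ) q from
    asyncObserved_congr (θ := fun _ => ⊤) (fun _ _ _ => rfl) (fun p s _ => harr q τ hτ h p s)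
      (fun _ _ h => absurd h (by simp)) (fun _ _ h => absurd h (by simp))]

/-- Each process takes infinitely many steps, and everything arrives at a step of the receiver. -/
def Steady (c : AsyncPattern n) : Prop :=
  (∀ p, (c.steps p).Infinite) ∧ ∀ p s q, ∃ τ ∈ c.steps q, c.arrival p s q = ((τ : ℕ) : ℕ∞)

/-- A timing pattern is allowed, whatever the algorithm does, if the correct processes take
infinitely many steps and each piece of information either arrives at a step of each correct
process, or is sent by a faulty process and never arrives. -/
theorem admissible_of_arrival {c : AsyncPattern n} {fp : FailurePattern n}
    (hfair : ∀ p, Correct fp p → (c.steps p).Infinite)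
    (h : ∀ p s, (¬ Correct fp p ∧ ∀ q, c.arrival p s q = ⊤) ∨
      ∀ q, Correct fp q → ∃ τ ∈ c.steps q, c.arrival p s q = ((τ : ℕ) : ℕ∞))
    (Vin : Fin n → Option I) (sd : Fin n → S) : AsyncAdmissible A Vin sd fp c := by
  have step : ∀ q τ, Correct fp q → τ ∈ c.steps q → TakesStep fp c q τ := by
    intro q τ hq hτ
    refine ⟨hτ, ?_⟩
    rw [hq]
    exact ENat.natCast_lt_top τ
  refine ⟨hfair, ?_, ?_⟩
  · intro p s m hp hm
    rcases h p s with h | h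
    · exact absurd hp h.1
    · obtain ⟨τ, h1, h2⟩ := h p hp
      exact ⟨p, hp, ⟨m, hm⟩, τ, h2, step p τ hp h1⟩
  · rintro p s q ⟨hm, τ, h1, h2⟩ q' hq'
    rcases h p s with h | h
    · rw [h.2 q] at h1
      exact absurd h1 (by simp)
    · obtain ⟨τ', h1, h2⟩ := h q' hq'
      exact ⟨hm, τ', h2, step q' τ' hq' h1⟩

theorem Steady.admissible {c : AsyncPattern n} (h : Steady c) (fp : FailurePattern n)
    (Vin : Fin n → Option I) (sd : Fin n → S) : AsyncAdmissible A Vin sd fp c :=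
  admissible_of_arrival (fun p _ => h.1 p) (fun p s => Or.inr fun q _ => h.2 p s q) Vin sd

/-- All steps are taken, and everything is observed one instant after it is communicated. -/
def lockStep (n : ℕ) : AsyncPattern n where
  steps _ := Set.univ
  arrival _ s _ := ((s + 1 : ℕ) : ℕ∞)
  lt_arrival _ s _ := by exact_mod_cast Nat.lt_succ_self s

theorem lockStep_steady (n : ℕ) : Steady (lockStep n) :=
  ⟨fun _ => Set.infinite_univ, fun _ s _ => ⟨s + 1, Set.mem_univ _, rfl⟩⟩

open Classical in
/-- The fair continuation from instant `T` on of the execution prefix given by `fp` and `c`: every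
process takes a step at every instant from `T` on, and everything that was not observed before
arrives as soon as possible. -/
noncomputable def continuation (fp : FailurePattern n) (c : AsyncPattern n) (T : ℕ) :
    AsyncPattern n where
  steps q := {τ | T ≤ τ ∨ TakesStep fp c q τ}
  arrival p s q :=
    if ∃ τ : ℕ, τ < T ∧ TakesStep fp c q τ ∧ c.arrival p s q = (τ : ℕ∞) then c.arrival p s q
    else ((max (s + 1) T : ℕ) : ℕ∞)
  lt_arrival p s q := by
    split_ifs
    · exact c.lt_arrival p s q
    · exact_mod_cast lt_of_lt_of_le (Nat.lt_succ_self s) (le_max_left _ _)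

theorem continuation_steady (fp : FailurePattern n) (c : AsyncPattern n) (T : ℕ) :
    Steady (continuation fp c T) := by
  constructor
  · intro p
    refine (Set.Ici_infinite T).mono fun τ hτ => Or.inl hτ
  · intro p s q
    by_cases h : ∃ τ : ℕ, τ < T ∧ TakesStep fp c q τ ∧ c.arrival p s q = (τ : ℕ∞)
    · obtain ⟨τ, h1, h2, h3⟩ := h
      refine ⟨τ, Or.inr h2, ?_⟩
      simp only [continuation]
      rw [if_pos ⟨τ, h1, h2, h3⟩, h3]
    · refine ⟨max (s + 1) T, Or.inl (le_max_right _ _), ?_⟩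
      simp only [continuation]
      rw [if_neg h]

theorem continuation_takesStep {fp fp' : FailurePattern n} {c : AsyncPattern n} {T : ℕ}
    (hfp : ∀ q (τ : ℕ), τ < T → TakesStep fp c q τ → (τ : ℕ∞) < fp' q) (q : Fin n) (τ : ℕ)
    (hτ : τ < T) : TakesStep fp c q τ ↔ TakesStep fp' (continuation fp c T) q τ := by
  constructor
  · intro h
    exact ⟨Or.inr h, hfp q τ hτ h⟩
  · rintro ⟨h | h, h'⟩
    · exact absurd h (by omega)
    · exact h

theorem continuation_arrival {fp : FailurePattern n} {c : AsyncPattern n} {T : ℕ} {q : Fin n}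
    {τ : ℕ} (hτ : τ < T) (h : TakesStep fp c q τ) (p : Fin n) (s : ℕ) :
    c.arrival p s q = (τ : ℕ∞) ↔ (continuation fp c T).arrival p s q = (τ : ℕ∞) := by
  simp only [continuation]
  constructor
  · intro h'
    rw [if_pos ⟨τ, hτ, h, h'⟩, h']
  · intro h'
    split_ifs at h' with h1
    · exact h'
    · have : max (s + 1) T = τ := by exact_mod_cast h'
      have := le_max_right (s + 1) T
      omega

end AsyncTools

/-! ### Impossibility of asynchronous agreement with one crash -/

section Agreement

variable {n : ℕ} {I S : Type} (A : Algorithm n I S)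

/-- The failure pattern without crashes. -/
abbrev noCrash (n : ℕ) : FailurePattern n := fun _ => ⊤

/-- Two timing patterns coincide before instant `T`. -/
def AgreeBefore (T : ℕ) (c c' : AsyncPattern n) : Prop :=
  ∀ q (τ : ℕ), τ < T → (τ ∈ c.steps q ↔ τ ∈ c'.steps q) ∧
    ∀ p s, (c.arrival p s q = (τ : ℕ∞) ↔ c'.arrival p s q = (τ : ℕ∞))

/-- Information arrives at steps of the receiver only. -/
def Clean (c : AsyncPattern n) : Prop :=
  ∀ p s q (τ : ℕ), c.arrival p s q = (τ : ℕ∞) → τ ∈ c.steps q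

/-- The value `v` is output in some crash-free continuation of the prefix of `c` before `T`. -/
def Reach (Vin : Fin n → Option I) (sd : Fin n → S) (c : AsyncPattern n) (T : ℕ)
    (v : Fin 2) : Prop :=
  ∃ c', Clean c' ∧ AgreeBefore T c c' ∧ ∃ p τ, OutputsAt A Vin sd (noCrash n) c' p τ v

/-- Both values can still be output after the prefix of `c` before `T`. -/
def Bivalent (Vin : Fin n → Option I) (sd : Fin n → S) (c : AsyncPattern n) (T : ℕ) : Prop :=
  ∀ v, Reach A Vin sd c T v

variable {A}

theorem AgreeBefore.refl (T : ℕ) (c : AsyncPattern n) : AgreeBefore T c c :=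
  fun _ _ _ => ⟨Iff.rfl, fun _ _ => Iff.rfl⟩

theorem AgreeBefore.symm {T : ℕ} {c c' : AsyncPattern n} (h : AgreeBefore T c c') :
    AgreeBefore T c' c :=
  fun q τ hτ => ⟨(h q τ hτ).1.symm, fun p s => ((h q τ hτ).2 p s).symm⟩

theorem AgreeBefore.trans {T : ℕ} {c c' c'' : AsyncPattern n} (h : AgreeBefore T c c')
    (h' : AgreeBefore T c' c'') : AgreeBefore T c c'' :=
  fun q τ hτ => ⟨(h q τ hτ).1.trans (h' q τ hτ).1,
    fun p s => ((h q τ hτ).2 p s).trans ((h' q τ hτ).2 p s)⟩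

theorem AgreeBefore.mono {T T' : ℕ} {c c' : AsyncPattern n} (h : AgreeBefore T c c')
    (hT : T' ≤ T) : AgreeBefore T' c c' := fun q τ hτ => h q τ (by omega)

theorem takesStep_noCrash {c : AsyncPattern n} {p : Fin n} {τ : ℕ} :
    TakesStep (noCrash n) c p τ ↔ τ ∈ c.steps p := by
  simp [TakesStep]

theorem AgreeBefore.outputsAt {T : ℕ} {c c' : AsyncPattern n} (h : AgreeBefore T c c')
    {Vin : Fin n → Option I} {sd : Fin n → S} {p : Fin n} {τ : ℕ} {v : Fin 2} (hτ : τ < T) :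
    OutputsAt A Vin sd (noCrash n) c p τ v ↔ OutputsAt A Vin sd (noCrash n) c' p τ v :=
  outputsAt_congr (N := T)
    (fun q τ hτ => by rw [takesStep_noCrash, takesStep_noCrash]; exact (h q τ hτ).1)
    (fun q τ hτ _ => (h q τ hτ).2) hτ

theorem Reach.anti {Vin : Fin n → Option I} {sd : Fin n → S} {c c' : AsyncPattern n} {T T' : ℕ}
    {v : Fin 2} (h : Reach A Vin sd c T v) (hT : T' ≤ T) (hc : AgreeBefore T' c' c) :
    Reach A Vin sd c' T' v := by
  obtain ⟨c'', h1, h2, h3⟩ := h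
  exact ⟨c'', h1, hc.trans (h2.mono hT), h3⟩

theorem Steady.clean {c : AsyncPattern n} (h : Steady c) : Clean c := by
  intro p s q τ hτ
  obtain ⟨τ', h1, h2⟩ := h.2 p s q
  rw [hτ] at h2
  obtain rfl : τ = τ' := by exact_mod_cast h2
  exact h1

theorem Clean.agreeBefore_continuation {c : AsyncPattern n} (h : Clean c) (T : ℕ) :
    AgreeBefore T c (continuation (noCrash n) c T) := by
  intro q τ hτ
  constructor
  · rw [← takesStep_noCrash (c := c), ← takesStep_noCrash (c := continuation _ c T)]
    exact continuation_takesStep (fun _ τ _ _ => ENat.natCast_lt_top τ) q τ hτ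
  · intro p s
    constructor
    · intro h'
      exact (continuation_arrival hτ (takesStep_noCrash.2 (h p s q τ h')) p s).1 h'
    · intro h'
      simp only [continuation] at h'
      split_ifs at h' with h1
      · exact h'
      · have : max (s + 1) T = τ := by exact_mod_cast h'
        have := le_max_right (s + 1) T
        omega

theorem correct_of_mem_FP_zero {fp : FailurePattern n} (h : fp ∈ FP n 0) (p : Fin n) :
    Correct fp p := by
  have h0 : {p | ¬ Correct fp p} = ∅ := (Set.ncard_eq_zero).1 h
  by_contra hp
  have : p ∈ {p | ¬ Correct fp p} := hp
  rw [h0] at this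
  exact this

theorem noCrash_mem_FP : noCrash n ∈ FP n 0 := by
  simp [FP, Correct]

theorem crash_mem_FP (q : Fin n) (T : ℕ) : Function.update (noCrash n) q (T : ℕ∞) ∈ FP n 1 := by
  have : {p | ¬ Correct (Function.update (noCrash n) q (T : ℕ∞)) p} = {q} := by
    ext p
    by_cases h : p = q
    · subst h; simp [Correct]
    · simp [Correct, h]
  simp only [FP, Set.mem_ofPred_eq]
  rw [this, Set.ncard_singleton]

theorem reach_unique {t : ℕ} (hA : Implements A t .async {{0}, {1}})
    {Vin : Fin n → Option I} {sd : Fin n → S} {c : AsyncPattern n} {T : ℕ}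
    {v v' : Fin 2} {p : Fin n} {τ : ℕ} (hτ : τ < T)
    (h : OutputsAt A Vin sd (noCrash n) c p τ v) (h' : Reach A Vin sd c T v') : v = v' := by
  obtain ⟨c', hc', hagree, p', τ', hp'⟩ := h'
  rw [hagree.outputsAt hτ] at h
  have h1 := hc'.agreeBefore_continuation (max τ τ' + 1)
  rw [h1.outputsAt (by omega)] at h hp'
  obtain ⟨Vout, hV, hO⟩ := hA.safety 0 (Nat.zero_le t) Vin sd (noCrash n) noCrash_mem_FP
    (continuation (noCrash n) c' (max τ τ' + 1)) ((continuation_steady _ _ _).admissible _ _ _)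
  have h2 : v ∈ OS Vout := ⟨p, (hV p v).2 ⟨τ, h⟩⟩
  have h3 : v' ∈ OS Vout := ⟨p', (hV p' v').2 ⟨τ', hp'⟩⟩
  rcases hO with hO | hO
  · rw [hO] at h2 h3; rw [h2, h3]
  · rw [Set.mem_singleton_iff.1 hO] at h2 h3; rw [h2, h3]

open Classical in
/-- The continuation from instant `T₁` on of the prefix of `c` before `T₁` in which all processes
but `q` take all the steps that they can, while `q` takes no step and nothing that it sends from
instant `T` on ever arrives. -/
noncomputable def silentContinuation (q : Fin n) (T T₁ : ℕ) (c : AsyncPattern n) :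
    AsyncPattern n where
  steps r := {τ | if τ < T₁ then τ ∈ c.steps r else r ≠ q}
  arrival p s r :=
    if ∃ τ : ℕ, τ < T₁ ∧ c.arrival p s r = (τ : ℕ∞) then c.arrival p s r
    else if r = q ∨ (p = q ∧ T ≤ s) then ⊤
    else ((max (s + 1) T₁ : ℕ) : ℕ∞)
  lt_arrival p s r := by
    split_ifs
    · exact c.lt_arrival p s r
    · exact ENat.natCast_lt_top s
    · exact_mod_cast lt_of_lt_of_le (Nat.lt_succ_self s) (le_max_left _ _)

theorem silentContinuation_arrival {q : Fin n} {T T₁ : ℕ} {c : AsyncPattern n} {τ : ℕ}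
    (hτ : τ < T₁) (p : Fin n) (s : ℕ) (r : Fin n) :
    c.arrival p s r = (τ : ℕ∞) ↔ (silentContinuation q T T₁ c).arrival p s r = (τ : ℕ∞) := by
  simp only [silentContinuation]
  constructor
  · intro h'
    rw [if_pos ⟨τ, hτ, h'⟩, h']
  · intro h'
    split_ifs at h' with h1 h2
    · exact h'
    · exact absurd h'.symm (ENat.natCast_ne_top τ)
    · have : max (s + 1) T₁ = τ := by exact_mod_cast h'
      have := le_max_right (s + 1) T₁
      omega

theorem agreeBefore_silentContinuation (q : Fin n) (T T₁ : ℕ) (c : AsyncPattern n) :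
    AgreeBefore T₁ c (silentContinuation q T T₁ c) := by
  intro r τ hτ
  refine ⟨?_, fun p s => silentContinuation_arrival hτ p s r⟩
  simp [silentContinuation, hτ]

theorem Clean.silentContinuation {c : AsyncPattern n} (h : Clean c) (q : Fin n) (T T₁ : ℕ) :
    Clean (silentContinuation q T T₁ c) := by
  intro p s r τ hτ
  rcases Nat.lt_or_ge τ T₁ with h1 | h1
  · exact ((agreeBefore_silentContinuation q T T₁ c r τ h1).1).1
      (h p s r τ ((silentContinuation_arrival h1 p s r).2 hτ))
  · simp only [BinaryOutput.silentContinuation] at hτ ⊢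
    split_ifs at hτ with h2 h3
    · obtain ⟨τ', h2, h2'⟩ := h2
      rw [h2'] at hτ
      have : τ' = τ := by exact_mod_cast hτ
      omega
    · exact absurd hτ.symm (ENat.natCast_ne_top τ)
    · push Not at h3
      simp [Nat.not_lt.2 h1, h3.1]

/-- Two prefixes that differ only in what `q` does from instant `T` on (and in the initial state of
`q`, if `T = 0`), such that nothing sent from instant `T` on has arrived, have a common reachable
value: the one that the other processes output if `q` crashes at instant `T`. -/
theorem exists_common_reach {t : ℕ} (ht : 1 ≤ t) (hA : Implements A t .async {{0}, {1}})
    {Vin Vin' : Fin n → Option I} {sd sd' : Fin n → S} {c c' : AsyncPattern n} (q : Fin n)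
    {T T₁ : ℕ} (hT : T ≤ T₁) (hc : Clean c) (hc' : Clean c')
    (hinit : ∀ r, r ≠ q ∨ 0 < T → A.init r (Vin r) (sd r) = A.init r (Vin' r) (sd' r))
    (hagree : AgreeBefore T c c')
    (hoff : ∀ r, r ≠ q → ∀ τ : ℕ, τ < T₁ → (τ ∈ c.steps r ↔ τ ∈ c'.steps r) ∧
      ∀ p s, (c.arrival p s r = (τ : ℕ∞) ↔ c'.arrival p s r = (τ : ℕ∞)))
    (hold : ∀ p s r, ∀ τ : ℕ, τ < T₁ → c.arrival p s r = (τ : ℕ∞) → s < T ∨ p ≠ q)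
    (hold' : ∀ p s r, ∀ τ : ℕ, τ < T₁ → c'.arrival p s r = (τ : ℕ∞) → s < T ∨ p ≠ q) :
    ∃ v, Reach A Vin sd c T₁ v ∧ Reach A Vin' sd' c' T₁ v := by
  set fp : FailurePattern n := Function.update (noCrash n) q (T : ℕ∞) with hfp
  have hfpq : fp q = T := by simp [hfp]
  have hfpr : ∀ r, r ≠ q → fp r = ⊤ := fun r hr => by simp [hfp, hr]
  set d := continuation fp c T₁ with hd
  obtain ⟨Vout, hV, hO⟩ := hA.safety 1 ht Vin sd fp (crash_mem_FP q T) d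
    ((continuation_steady _ _ _).admissible _ _ _)
  have hne : (OS Vout).Nonempty := by
    rcases hO with hO | hO
    · rw [hO]; exact Set.singleton_nonempty _
    · rw [Set.mem_singleton_iff.1 hO]; exact Set.singleton_nonempty _
  obtain ⟨v, r, hr⟩ := hne
  obtain ⟨τ, hτ⟩ := (hV r v).1 hr
  -- The execution in which `q` crashes cannot be told from the crash-free ones where `q` is silent.
  have key : ∀ (Vin₂ : Fin n → Option I) (sd₂ : Fin n → S) (c₂ : AsyncPattern n), Clean c₂ →
      (∀ r, r ≠ q ∨ 0 < T → A.init r (Vin r) (sd r) = A.init r (Vin₂ r) (sd₂ r)) →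
      AgreeBefore T c c₂ →
      (∀ r, r ≠ q → ∀ τ : ℕ, τ < T₁ → (τ ∈ c.steps r ↔ τ ∈ c₂.steps r) ∧
        ∀ p s, (c.arrival p s r = (τ : ℕ∞) ↔ c₂.arrival p s r = (τ : ℕ∞))) →
      (∀ p s r, ∀ τ : ℕ, τ < T₁ → c₂.arrival p s r = (τ : ℕ∞) → s < T ∨ p ≠ q) →
      Reach A Vin₂ sd₂ c₂ T₁ v := by
    intro Vin₂ sd₂ c₂ hc₂ hinit hagree hoff hold
    refine ⟨silentContinuation q T T₁ c₂, hc₂.silentContinuation q T T₁,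
      agreeBefore_silentContinuation q T T₁ c₂, r, τ, ?_⟩
    set e := silentContinuation q T T₁ c₂ with he
    -- Steps and arrivals of the two executions, compared.
    have hstepc : ∀ r (τ : ℕ), τ < T₁ → (τ : ℕ∞) < fp r → (τ ∈ c.steps r ↔ τ ∈ c₂.steps r) ∧
        ∀ p s, (c.arrival p s r = (τ : ℕ∞) ↔ c₂.arrival p s r = (τ : ℕ∞)) := by
      intro r τ h1 h2
      by_cases hrq : r = q
      · subst hrq
        rw [hfpq] at h2
        exact hagree r τ (by exact_mod_cast h2)
      · exact hoff r hrq τ h1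
    have hstep : ∀ r (τ : ℕ), (τ : ℕ∞) < fp r →
        (TakesStep fp d r τ ↔ TakesStep (noCrash n) e r τ) := by
      intro r τ h2
      rw [takesStep_noCrash]
      rcases Nat.lt_or_ge τ T₁ with h1 | h1
      · rw [hd, ← continuation_takesStep (fun _ _ _ h => h.2) r τ h1,
          ← (agreeBefore_silentContinuation q T T₁ c₂ r τ h1).1, ← (hstepc r τ h1 h2).1]
        exact ⟨fun h => h.1, fun h => ⟨h, h2⟩⟩
      · have hrq : r ≠ q := by
          rintro rfl
          rw [hfpq] at h2
          have : τ < T := by exact_mod_cast h2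
          omega
        constructor
        · intro _
          simp [he, silentContinuation, Nat.not_lt.2 h1, hrq]
        · intro _
          exact ⟨Or.inl h1, h2⟩
    have harr : ∀ r (τ : ℕ), (τ : ℕ∞) < fp r → TakesStep fp d r τ → ∀ p (s : ℕ),
        (s : ℕ∞) < fp p → (d.arrival p s r = (τ : ℕ∞) ↔ e.arrival p s r = (τ : ℕ∞)) := by
      intro r τ h2 h3 p s hs
      rcases Nat.lt_or_ge τ T₁ with h1 | h1
      · rw [hd, ← continuation_takesStep (fun _ _ _ h => h.2) r τ h1] at h3
        rw [hd, ← continuation_arrival h1 h3, (hstepc r τ h1 h2).2, he,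
          silentContinuation_arrival h1]
      · have hrq : r ≠ q := by
          rintro rfl
          rw [hfpq] at h2
          have : τ < T := by exact_mod_cast h2
          omega
        have hpq : ¬ (r = q ∨ (p = q ∧ T ≤ s)) := by
          rintro (h | ⟨rfl, h⟩)
          · exact hrq h
          · rw [hfpq] at hs
            have : s < T := by exact_mod_cast hs
            omega
        have h5 : (∃ τ : ℕ, τ < T₁ ∧ TakesStep fp c r τ ∧ c.arrival p s r = (τ : ℕ∞)) ↔
            ∃ τ : ℕ, τ < T₁ ∧ c₂.arrival p s r = (τ : ℕ∞) := by
          constructor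
          · rintro ⟨τ', h6, h7, h8⟩
            exact ⟨τ', h6, ((hoff r hrq τ' h6).2 p s).1 h8⟩
          · rintro ⟨τ', h6, h8⟩
            refine ⟨τ', h6, ⟨((hoff r hrq τ' h6).1).2 (hc₂ p s r τ' h8), ?_⟩,
              ((hoff r hrq τ' h6).2 p s).2 h8⟩
            rw [hfpr r hrq]; exact ENat.natCast_lt_top τ'
        simp only [hd, he, continuation, silentContinuation, if_neg hpq, h5]
        split_ifs with h6
        · obtain ⟨τ', h6, h8⟩ := h6
          have h9 := ((hoff r hrq τ' h6).2 p s).2 h8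
          rw [h8, h9]
        · rfl
    have hlate : ∀ p (s : ℕ), fp p ≤ s → p = q ∧ T ≤ s := by
      intro p s hs
      by_cases hpq : p = q
      · subst hpq
        rw [hfpq] at hs
        exact ⟨rfl, by exact_mod_cast hs⟩
      · rw [hfpr p hpq] at hs
        exact absurd hs (by simp)
    have hlate1 : ∀ p (s : ℕ), fp p ≤ s → ¬ TakesStep fp d p s :=
      fun p s hs h => absurd h.2 (not_lt.2 hs)
    have hlate2 : ∀ r (τ : ℕ), ∀ p (s : ℕ), fp p ≤ s → e.arrival p s r ≠ (τ : ℕ∞) := by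
      intro r τ p s hs h
      obtain ⟨rfl, hsT⟩ := hlate p s hs
      rcases Nat.lt_or_ge τ T₁ with h1 | h1
      · rw [he, ← silentContinuation_arrival h1] at h
        rcases hold p s r τ h1 h with h | h
        · omega
        · exact h rfl
      · simp only [he, silentContinuation, hsT, and_self, or_true, if_true] at h
        split_ifs at h with h2
        · obtain ⟨τ', h2, h2'⟩ := h2
          rw [h2'] at h
          have : τ' = τ := by exact_mod_cast h
          omega
        · exact absurd h.symm (ENat.natCast_ne_top τ)
    obtain ⟨h1, h2⟩ := asyncRun_agree (A := A) (Vin := Vin) (Vin' := Vin₂) (sd := sd) (sd' := sd₂)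
      (fp := fp) (fp' := noCrash n) (c := d) (c' := e) fp τ
      (fun r hr => hinit r (by
        by_cases hrq : r = q
        · subst hrq
          rw [hfpq] at hr
          exact Or.inr (by exact_mod_cast hr)
        · exact Or.inl hrq))
      (fun r τ _ h => hstep r τ h) (fun r τ _ h h' p s hs => harr r τ h h' p s hs)
      (fun _ _ _ _ _ p s hs _ => hlate1 p s hs)
      (fun r τ _ _ _ p s hs h => absurd h (hlate2 r τ p s hs)) τ le_rfl
    obtain ⟨hτ1, hτ2⟩ := hτ
    have hlt : (τ : ℕ∞) < fp r := hτ1.2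
    refine ⟨(hstep r τ hlt).1 hτ1, ?_⟩
    have h0 : A.init r (Vin r) (sd r) = A.init r (Vin₂ r) (sd₂ r) := by
      apply hinit
      by_cases hrq : r = q
      · subst hrq
        rw [hfpq] at hlt
        have : τ < T := by exact_mod_cast hlt
        exact Or.inr (by omega)
      · exact Or.inl hrq
    unfold stepOut
    rw [← h1 r h0 hlt.le, ← asyncObserved_congr h2 (fun p s hs => harr r τ hlt hτ1 p s hs)
      (fun p s hs _ => log_eq_none_of_not_takesStep (hlate1 p s hs))
      (fun p s hs h => absurd h (hlate2 r τ p s hs))]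
    exact hτ2
  exact ⟨v, key Vin sd c hc (fun _ _ => rfl) (AgreeBefore.refl T c)
    (fun _ _ _ _ => ⟨Iff.rfl, fun _ _ => Iff.rfl⟩) hold, key Vin' sd' c' hc' hinit hagree hoff hold'⟩

/-- Exchanging the behaviour of the processes of `B` between two timing patterns. -/
def hybrid (B : Finset (Fin n)) (c c' : AsyncPattern n) : AsyncPattern n where
  steps r := if r ∈ B then c'.steps r else c.steps r
  arrival p s r := if r ∈ B then c'.arrival p s r else c.arrival p s r
  lt_arrival p s r := by
    split_ifs
    · exact c'.lt_arrival p s r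
    · exact c.lt_arrival p s r

theorem Clean.hybrid {c c' : AsyncPattern n} (h : Clean c) (h' : Clean c') (B : Finset (Fin n)) :
    Clean (hybrid B c c') := by
  intro p s r τ hτ
  simp only [BinaryOutput.hybrid] at hτ ⊢
  split_ifs at hτ ⊢
  · exact h' p s r τ hτ
  · exact h p s r τ hτ

theorem AgreeBefore.hybrid {T : ℕ} {c c' : AsyncPattern n} (h : AgreeBefore T c c')
    (B : Finset (Fin n)) : AgreeBefore T c (hybrid B c c') := by
  intro r τ hτ
  simp only [BinaryOutput.hybrid]
  split_ifs
  · exact h r τ hτ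
  · exact ⟨Iff.rfl, fun _ _ => Iff.rfl⟩

/-- If all hybrids of two prefixes that agree before `T`, and in which nothing sent from `T` on has
arrived, are not bivalent, then the reachable values of the two prefixes are the same. -/
theorem reach_of_hybrid_not_bivalent {t : ℕ} (ht : 1 ≤ t) (hA : Implements A t .async {{0}, {1}})
    {Vin : Fin n → Option I} {sd : Fin n → S} {c c' : AsyncPattern n} {T T₁ : ℕ} (hT : T ≤ T₁)
    (hc : Clean c) (hc' : Clean c') (hagree : AgreeBefore T c c')
    (hold : ∀ p s r, ∀ τ : ℕ, τ < T₁ → c.arrival p s r = (τ : ℕ∞) → s < T)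
    (hold' : ∀ p s r, ∀ τ : ℕ, τ < T₁ → c'.arrival p s r = (τ : ℕ∞) → s < T)
    (hbiv : ∀ B, ¬ Bivalent A Vin sd (hybrid B c c') T₁) {v : Fin 2}
    (hv : Reach A Vin sd c T₁ v) : Reach A Vin sd c' T₁ v := by
  have hholdB : ∀ B, ∀ p s r, ∀ τ : ℕ, τ < T₁ → (hybrid B c c').arrival p s r = (τ : ℕ∞) →
      s < T := by
    intro B p s r τ hτ h
    simp only [hybrid] at h
    split_ifs at h
    · exact hold' p s r τ hτ h
    · exact hold p s r τ hτ h
  have key : ∀ B : Finset (Fin n), Reach A Vin sd (hybrid B c c') T₁ v := by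
    intro B
    induction B using Finset.induction_on with
    | empty => simpa [hybrid] using hv
    | insert q B hq ih =>
      obtain ⟨w, h1, h2⟩ := exists_common_reach ht hA (Vin := Vin) (Vin' := Vin) (sd := sd)
        (sd' := sd) q hT (hc.hybrid hc' B) (hc.hybrid hc' (insert q B)) (fun _ _ => rfl)
        ((hagree.hybrid B).symm.trans (hagree.hybrid (insert q B)))
        (fun r hr τ _ => by simp [hybrid, hr])
        (fun p s r τ hτ h => Or.inl (hholdB _ p s r τ hτ h))
        (fun p s r τ hτ h => Or.inl (hholdB _ p s r τ hτ h))
      have hwv : w = v := by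
        by_contra hne
        apply hbiv B
        intro x
        rcases (show x = w ∨ x = v by omega) with rfl | rfl
        · exact h1
        · exact ih
      rw [← hwv]
      exact h2
  have h := key Finset.univ
  simpa [hybrid] using h

/-- A process has a duty: to take a step, and to observe in it a given piece of information (the
one communicated by `x.1` at instant `x.2`), if one is given. The duty is done in `[T, T₁)`. -/
def Done (p : Fin n) (m : Option (Fin n × ℕ)) (c : AsyncPattern n) (T T₁ : ℕ) : Prop :=
  ∃ τ : ℕ, T ≤ τ ∧ τ < T₁ ∧ τ ∈ c.steps p ∧ ∀ x ∈ m, c.arrival x.1 x.2 p = (τ : ℕ∞)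

open Classical in
/-- After the prefix of `c` before `T`, process `p` does its duty at instant `T`, observing nothing
else, and nothing happens afterwards. -/
noncomputable def doDuty (p : Fin n) (m : Option (Fin n × ℕ)) (c : AsyncPattern n) (T : ℕ) :
    AsyncPattern n where
  steps r := {τ | τ < T ∧ τ ∈ c.steps r ∨ τ = T ∧ r = p}
  arrival a s r :=
    if ∃ τ : ℕ, τ < T ∧ c.arrival a s r = (τ : ℕ∞) then c.arrival a s r
    else if r = p ∧ m = some (a, s) ∧ s < T then (T : ℕ∞) else ⊤
  lt_arrival a s r := by
    split_ifs with h1 h2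
    · exact c.lt_arrival a s r
    · exact_mod_cast h2.2.2
    · exact ENat.natCast_lt_top s

theorem doDuty_arrival {p : Fin n} {m : Option (Fin n × ℕ)} {c : AsyncPattern n} {T : ℕ}
    {a : Fin n} {s : ℕ} {r : Fin n} {τ : ℕ} :
    (doDuty p m c T).arrival a s r = (τ : ℕ∞) ↔
      (τ < T ∧ c.arrival a s r = (τ : ℕ∞)) ∨
      (τ = T ∧ r = p ∧ m = some (a, s) ∧ s < T ∧ ∀ τ' : ℕ, τ' < T → c.arrival a s r ≠ τ') := by
  simp only [doDuty]
  split_ifs with h1 h2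
  · obtain ⟨τ', h1, h2⟩ := h1
    constructor
    · intro h
      rw [h] at h2
      have : τ = τ' := by exact_mod_cast h2
      exact Or.inl ⟨by omega, h⟩
    · rintro (h | h)
      · exact h.2
      · exact absurd h2 (h.2.2.2.2 τ' h1)
  · push Not at h1
    constructor
    · intro h
      have : T = τ := by exact_mod_cast h
      exact Or.inr ⟨this.symm, h2.1, h2.2.1, h2.2.2, h1⟩
    · rintro (h | h)
      · exact absurd h.2 (h1 τ h.1)
      · rw [h.1]
  · push Not at h1
    constructor
    · intro h
      exact absurd h.symm (ENat.natCast_ne_top τ)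
    · rintro (h | h)
      · exact absurd h.2 (h1 τ h.1)
      · exact absurd ⟨h.2.1, h.2.2.1, h.2.2.2.1⟩ h2

theorem agreeBefore_doDuty (p : Fin n) (m : Option (Fin n × ℕ)) (c : AsyncPattern n) (T : ℕ) :
    AgreeBefore T c (doDuty p m c T) := by
  intro r τ hτ
  refine ⟨?_, fun a s => ?_⟩
  · simp only [doDuty, Set.mem_ofPred_eq]
    constructor
    · intro h; exact Or.inl ⟨hτ, h⟩
    · rintro (h | h)
      · exact h.2
      · omega
  · rw [doDuty_arrival]
    constructor
    · intro h; exact Or.inl ⟨hτ, h⟩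
    · rintro (h | h)
      · exact h.2
      · omega

theorem Clean.doDuty {c : AsyncPattern n} (h : Clean c) (p : Fin n) (m : Option (Fin n × ℕ))
    (T : ℕ) : Clean (doDuty p m c T) := by
  intro a s r τ hτ
  rw [doDuty_arrival] at hτ
  rcases hτ with hτ | hτ
  · exact Or.inl ⟨hτ.1, h a s r τ hτ.2⟩
  · exact Or.inr ⟨hτ.1, hτ.2.1⟩

theorem doDuty_agreeBefore {p : Fin n} {m : Option (Fin n × ℕ)} {c c' : AsyncPattern n} {T : ℕ}
    (h : AgreeBefore T c c') : AgreeBefore (T + 1) (doDuty p m c T) (doDuty p m c' T) := by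
  have harr : ∀ a s r (τ : ℕ), (BinaryOutput.doDuty p m c T).arrival a s r = (τ : ℕ∞) ↔
      (BinaryOutput.doDuty p m c' T).arrival a s r = (τ : ℕ∞) := by
    intro a s r τ
    rw [doDuty_arrival, doDuty_arrival]
    refine or_congr (and_congr_right fun hτ => (h r τ hτ).2 a s) ?_
    refine and_congr_right fun _ => and_congr_right fun _ => and_congr_right fun _ =>
      and_congr_right fun _ => forall_congr' fun τ' => forall_congr' fun hτ' => ?_
    exact not_congr ((h r τ' hτ').2 a s)
  refine fun r τ _ => ⟨?_, fun a s => harr a s r τ⟩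
  simp only [doDuty, Set.mem_ofPred_eq]
  refine or_congr_left (and_congr_right fun hτ => (h r τ hτ).1)

/-- If the duty is pending, it is done by `doDuty`. -/
theorem done_doDuty {p : Fin n} {m : Option (Fin n × ℕ)} {c : AsyncPattern n} {T₀ T : ℕ}
    (hT : T₀ ≤ T)
    (hm : ∀ x ∈ m, x.2 < T ∧ ∀ τ : ℕ, τ < T → c.arrival x.1 x.2 p ≠ (τ : ℕ∞)) :
    Done p m (doDuty p m c T) T₀ (T + 1) := by
  refine ⟨T, hT, by omega, Or.inr ⟨rfl, rfl⟩, fun x hx => ?_⟩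
  rw [doDuty_arrival]
  exact Or.inr ⟨rfl, rfl, hx, (hm x hx).1, (hm x hx).2⟩

theorem Done.hybrid {p : Fin n} {m : Option (Fin n × ℕ)} {c c' : AsyncPattern n} {T T₁ : ℕ}
    (h : Done p m c T T₁) (h' : Done p m c' T T₁) (B : Finset (Fin n)) :
    Done p m (hybrid B c c') T T₁ := by
  obtain ⟨τ, h⟩ := h
  obtain ⟨τ', h'⟩ := h'
  by_cases hp : p ∈ B
  · exact ⟨τ', by simpa [BinaryOutput.hybrid, hp] using h'⟩
  · exact ⟨τ, by simpa [BinaryOutput.hybrid, hp] using h⟩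

/-- From a bivalent prefix, any pending duty can be done in such a way that the prefix is bivalent
afterwards. -/
theorem exists_bivalent_done {t : ℕ} (ht : 1 ≤ t) (hA : Implements A t .async {{0}, {1}})
    {Vin : Fin n → Option I} {sd : Fin n → S} {c : AsyncPattern n} {T₀ : ℕ}
    (hbiv : Bivalent A Vin sd c T₀) (p : Fin n) (m : Option (Fin n × ℕ))
    (hm : ∀ x ∈ m, x.2 < T₀ ∧ ∀ τ : ℕ, τ < T₀ → c.arrival x.1 x.2 p ≠ (τ : ℕ∞)) (hc : Clean c) :
    ∃ c' T', Clean c' ∧ AgreeBefore T₀ c c' ∧ Done p m c' T₀ T' ∧ Bivalent A Vin sd c' T' := by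
  by_contra hcon
  push Not at hcon
  -- As long as the duty is not done, the value reachable once it is done does not depend on when
  -- and after what it is done.
  have key : ∀ c', Clean c' → AgreeBefore T₀ c c' → ∀ r τ v,
      OutputsAt A Vin sd (noCrash n) c' r τ v → ∀ k T', T' + k = max (τ + 1) T₀ → T₀ ≤ T' →
      ¬ Done p m c' T₀ T' → Reach A Vin sd (doDuty p m c' T') (T' + 1) v := by
    intro c' hc' hagree r τ v hv k
    induction k with
    | zero =>
      intro T' hT' _ _
      have hτ : τ < T' := by have := le_max_left (τ + 1) T₀; omega
      refine ⟨doDuty p m c' T', hc'.doDuty p m T', AgreeBefore.refl _ _, r, τ, ?_⟩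
      rwa [← (agreeBefore_doDuty p m c' T').outputsAt hτ]
    | succ k ih =>
      intro T' hT' hle hnd
      have hpend : ∀ x ∈ m, x.2 < T' ∧ ∀ τ : ℕ, τ < T' → c'.arrival x.1 x.2 p ≠ (τ : ℕ∞) := by
        intro x hx
        refine ⟨by have := (hm x hx).1; omega, fun τ hτ h => ?_⟩
        rcases Nat.lt_or_ge τ T₀ with h1 | h1
        · exact (hm x hx).2 τ h1 (((hagree p τ h1).2 x.1 x.2).2 h)
        · refine hnd ⟨τ, h1, hτ, hc' _ _ _ _ h, fun y hy => ?_⟩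
          rw [Option.mem_unique hy hx]
          exact h
      have hsent : ∀ (d : AsyncPattern n) p s r (τ : ℕ), τ < T' + 1 →
          d.arrival p s r = (τ : ℕ∞) → s < T' := by
        intro d p s r τ hτ h
        have := d.lt_arrival p s r
        rw [h] at this
        have : s < τ := by exact_mod_cast this
        omega
      by_cases hd : Done p m c' T₀ (T' + 1)
      · refine reach_of_hybrid_not_bivalent ht hA (T := T') (by omega) hc' (hc'.doDuty p m T')
          (agreeBefore_doDuty p m c' T') (hsent _) (hsent _) (fun B => ?_)
          ⟨c', hc', AgreeBefore.refl _ _, r, τ, hv⟩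
        exact hcon _ _ (hc'.hybrid (hc'.doDuty p m T') B)
          (hagree.trans (((agreeBefore_doDuty p m c' T').hybrid B).mono hle))
          (hd.hybrid (done_doDuty hle hpend) B)
      · have h1 := ih (T' + 1) (by omega) (by omega) hd
        have hpend' : ∀ x ∈ m, x.2 < T' + 1 ∧
            ∀ τ : ℕ, τ < T' + 1 → c'.arrival x.1 x.2 p ≠ (τ : ℕ∞) := by
          intro x hx
          refine ⟨by have := (hm x hx).1; omega, fun τ hτ h => ?_⟩
          rcases Nat.lt_or_ge τ T₀ with h1 | h1
          · exact (hm x hx).2 τ h1 (((hagree p τ h1).2 x.1 x.2).2 h)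
          · refine hd ⟨τ, h1, hτ, hc' _ _ _ _ h, fun y hy => ?_⟩
            rw [Option.mem_unique hy hx]
            exact h
        have hag : AgreeBefore T' (doDuty p m c' (T' + 1)) (doDuty p m c' T') :=
          ((agreeBefore_doDuty p m c' (T' + 1)).mono (by omega)).symm.trans
            (agreeBefore_doDuty p m c' T')
        have hdone : Done p m (doDuty p m c' T') T₀ (T' + 1 + 1) := by
          obtain ⟨τ, h2, h3, h4⟩ := done_doDuty hle hpend
          exact ⟨τ, h2, by omega, h4⟩
        refine Reach.anti (T := T' + 1 + 1) (reach_of_hybrid_not_bivalent ht hA (T := T') (by omega)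
          (hc'.doDuty p m (T' + 1)) (hc'.doDuty p m T') hag ?_ ?_ (fun B => ?_) h1) (by omega)
          (AgreeBefore.refl _ _)
        · intro a s r τ hτ h
          rcases Nat.lt_or_ge τ (T' + 1) with h2 | h2
          · exact hsent _ a s r τ h2 h
          · rw [doDuty_arrival] at h
            rcases h with h | h
            · omega
            · have := (hm _ h.2.2.1).1
              simp only at this
              omega
        · intro a s r τ hτ h
          rw [doDuty_arrival] at h
          rcases h with h | h
          · exact hsent _ a s r τ (by omega) h.2
          · exact h.2.2.2.1
        · refine hcon _ _ ((hc'.doDuty p m (T' + 1)).hybrid (hc'.doDuty p m T') B)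
            ((hagree.trans ((agreeBefore_doDuty p m c' (T' + 1)).mono (by omega))).trans
              ((hag.hybrid B).mono hle)) ((done_doDuty (by omega) hpend').hybrid hdone B)
  refine hcon (doDuty p m c T₀) (T₀ + 1) (hc.doDuty p m T₀) (agreeBefore_doDuty p m c T₀)
    (done_doDuty le_rfl hm) fun v => ?_
  obtain ⟨c', hc', hagree, r, τ, hv⟩ := hbiv v
  have h := key c' hc' hagree r τ v hv (max (τ + 1) T₀ - T₀) T₀
    (by have := le_max_right (τ + 1) T₀; omega) le_rfl (by rintro ⟨τ, h1, h2, _⟩; omega)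
  exact h.anti le_rfl (doDuty_agreeBefore hagree)

/-- Some inputs and seeds make the empty prefix bivalent. -/
theorem exists_bivalent_init {t : ℕ} (ht : 1 ≤ t) (hA : Implements A t .async {{0}, {1}}) :
    ∃ Vin sd, ∀ c, Bivalent A Vin sd c 0 := by
  have hex : ∀ v : Fin 2, ∃ Vin sd, ∀ c, Reach A Vin sd c 0 v := by
    intro v
    obtain ⟨Vin, sd, fp, hfp, c, hc, Vout, hV, hO⟩ := hA.completeness 0 (Nat.zero_le t) {v}
      (by rcases (show v = 0 ∨ v = 1 by omega) with rfl | rfl <;> simp)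
    obtain ⟨p, hp⟩ : v ∈ OS Vout := by rw [hO]; rfl
    obtain ⟨τ, hτ⟩ := (hV p v).1 hp
    obtain rfl : fp = noCrash n := funext fun q => correct_of_mem_FP_zero hfp q
    refine ⟨Vin, sd, fun c' => ⟨continuation (noCrash n) c (τ + 1),
      (continuation_steady _ _ _).clean, fun _ _ h => absurd h (by omega), p, τ, ?_⟩⟩
    exact (outputsAt_congr (N := τ + 1)
      (fun q τ hτ => continuation_takesStep (fun _ _ _ h => h.2) q τ hτ)
      (fun q τ hτ h p s => continuation_arrival hτ h p s) (by omega)).1 hτ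
  obtain ⟨Vin₀, sd₀, h₀⟩ := hex 0
  obtain ⟨Vin₁, sd₁, h₁⟩ := hex 1
  have anyc : ∀ {Vin sd c c' v}, Reach A Vin sd c 0 v → Reach A Vin sd c' 0 v :=
    fun h => h.anti le_rfl (fun _ _ h => absurd h (by omega))
  have hd : Clean (lockStep n) := (lockStep_steady n).clean
  by_contra hcon
  push Not at hcon
  -- Inputs and seeds are exchanged process by process; if no initial configuration is bivalent,
  -- the value 0 remains the only reachable one.
  have key : ∀ B : Finset (Fin n), Reach A (fun p => if p ∈ B then Vin₁ p else Vin₀ p)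
      (fun p => if p ∈ B then sd₁ p else sd₀ p) (lockStep n) 0 0 := by
    intro B
    induction B using Finset.induction_on with
    | empty => simpa using h₀ (lockStep n)
    | insert q B hq ih =>
      obtain ⟨w, h1, h2⟩ := exists_common_reach ht hA
        (Vin := fun p => if p ∈ B then Vin₁ p else Vin₀ p)
        (Vin' := fun p => if p ∈ insert q B then Vin₁ p else Vin₀ p)
        (sd := fun p => if p ∈ B then sd₁ p else sd₀ p)
        (sd' := fun p => if p ∈ insert q B then sd₁ p else sd₀ p) q (le_refl 0) hd hd
        (fun r hr => by
          rcases hr with hr | hr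
          · simp [hr]
          · omega)
        (AgreeBefore.refl _ _) (fun _ _ _ h => absurd h (by omega))
        (fun _ _ _ _ h => absurd h (by omega)) (fun _ _ _ _ h => absurd h (by omega))
      have hwv : w = 0 := by
        by_contra hne
        obtain ⟨c, hc⟩ := hcon (fun p => if p ∈ B then Vin₁ p else Vin₀ p)
          (fun p => if p ∈ B then sd₁ p else sd₀ p)
        apply hc
        intro x
        rcases (show x = w ∨ x = 0 by omega) with rfl | rfl
        · exact anyc h1
        · exact anyc ih
      rw [← hwv]
      exact h2
  have h := key Finset.univ
  simp only [Finset.mem_univ, if_true] at h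
  obtain ⟨c, hc⟩ := hcon Vin₁ sd₁
  apply hc
  intro x
  rcases (show x = 1 ∨ x = 0 by omega) with rfl | rfl
  · exact h₁ c
  · exact anyc h

open Classical in
/-- The limit of a sequence of timing patterns, the `k`-th of which is final before instant `k`. -/
noncomputable def limitPattern (c : ℕ → AsyncPattern n) : AsyncPattern n where
  steps r := {τ | τ ∈ (c (τ + 1)).steps r}
  arrival p s r :=
    if h : ∃ τ : ℕ, (c (τ + 1)).arrival p s r = (τ : ℕ∞) then ((Nat.find h : ℕ) : ℕ∞) else ⊤
  lt_arrival p s r := by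
    split_ifs with h
    · have h1 := Nat.find_spec h
      rw [← h1]
      exact (c _).lt_arrival p s r
    · exact ENat.natCast_lt_top s

theorem agreeBefore_limitPattern {c : ℕ → AsyncPattern n}
    (hc : ∀ k l, k ≤ l → AgreeBefore k (c k) (c l)) (k : ℕ) :
    AgreeBefore k (c k) (limitPattern c) := by
  classical
  intro r τ hτ
  have h1 := hc (τ + 1) k (by omega) r τ (by omega)
  refine ⟨h1.1.symm, fun p s => ?_⟩
  rw [← h1.2]
  simp only [limitPattern]
  constructor
  · intro h
    have hex : ∃ τ : ℕ, (c (τ + 1)).arrival p s r = (τ : ℕ∞) := ⟨τ, h⟩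
    rw [dif_pos hex]
    have h2 := Nat.find_spec hex
    have h3 : Nat.find hex ≤ τ := Nat.find_min' hex h
    rw [(hc (Nat.find hex + 1) (τ + 1) (by omega) r (Nat.find hex) (by omega)).2, h] at h2
    exact h2.symm
  · intro h
    split_ifs at h with hex
    · have h2 := Nat.find_spec hex
      have : Nat.find hex = τ := by exact_mod_cast h
      rwa [this] at h2
    · exact absurd h.symm (ENat.natCast_ne_top τ)

/-- Fischer, Lynch and Paterson: if a crash is possible, processes cannot agree on a value. -/
theorem not_implements_agreement {t : ℕ} (ht : 1 ≤ t) :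
    ¬ Implements A t .async {{0}, {1}} := by
  classical
  intro hA
  obtain ⟨Vin, sd, hbiv⟩ := exists_bivalent_init ht hA
  have hn : 0 < n := by
    rcases Nat.eq_zero_or_pos n with rfl | h
    · obtain ⟨c', _, _, p, _⟩ := hbiv (lockStep 0) 0
      exact p.elim0
    · exact h
  have : Nonempty (Fin n × Option (Fin n × ℕ)) := ⟨(⟨0, hn⟩, none)⟩
  -- An enumeration of all duties in which each one occurs infinitely often.
  obtain ⟨f, hf⟩ := exists_surjective_nat (Fin n × Option (Fin n × ℕ))
  let Good : Type := {x : AsyncPattern n × ℕ // Clean x.1 ∧ Bivalent A Vin sd x.1 x.2}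
  let x₀ : Good := ⟨(lockStep n, 0), (lockStep_steady n).clean, hbiv _⟩
  -- One more duty `d` is done: an observation if it is pending, and a step in any case.
  have hnext : ∀ (x : Good) (d : Fin n × Option (Fin n × ℕ)), ∃ y : Good,
      AgreeBefore x.1.2 x.1.1 y.1.1 ∧ Done d.1 none y.1.1 x.1.2 y.1.2 ∧
      ∀ a ∈ d.2, a.2 < x.1.2 → ∃ τ : ℕ, τ < y.1.2 ∧ y.1.1.arrival a.1 a.2 d.1 = (τ : ℕ∞) := by
    rintro ⟨⟨c, T⟩, hc, hb⟩ ⟨p, m⟩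
    by_cases hm : ∀ x ∈ m, x.2 < T ∧ ∀ τ : ℕ, τ < T → c.arrival x.1 x.2 p ≠ (τ : ℕ∞)
    · obtain ⟨c', T', h1, h2, ⟨τ, h3, h4, h5, h6⟩, h7⟩ := exists_bivalent_done ht hA hb p m hm hc
      exact ⟨⟨(c', T'), h1, h7⟩, h2, ⟨τ, h3, h4, h5, by simp⟩, fun a ha _ => ⟨τ, h4, h6 a ha⟩⟩
    · obtain ⟨c', T', h1, h2, ⟨τ, h3, h4, h5, h6⟩, h7⟩ :=
        exists_bivalent_done ht hA hb p none (by simp) hc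
      refine ⟨⟨(c', T'), h1, h7⟩, h2, ⟨τ, h3, h4, h5, h6⟩, fun a ha haT => ?_⟩
      push Not at hm
      obtain ⟨x, hx, hx'⟩ := hm
      obtain rfl := Option.mem_unique hx ha
      obtain ⟨τ', h8, h9⟩ := hx' haT
      refine ⟨τ', ?_, ((h2 p τ' h8).2 _ _).1 h9⟩
      simp only at h3 h4 h8 ⊢
      omega
  choose next hnext1 hnext2 hnext3 using hnext
  let X : ℕ → Good := fun k => Nat.rec x₀ (fun k x => next x (f k.unpair.1)) k
  have hX : ∀ k, X (k + 1) = next (X k) (f k.unpair.1) := fun k => rfl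
  have hlt : ∀ k, (X k).1.2 < (X (k + 1)).1.2 := by
    intro k
    obtain ⟨τ, h1, h2, _⟩ := hnext2 (X k) (f k.unpair.1)
    rw [hX]
    omega
  have hmono : ∀ k l, k ≤ l → (X k).1.2 ≤ (X l).1.2 := fun k l h =>
    monotone_nat_of_le_succ (fun k => (hlt k).le) h
  have hge : ∀ k, k ≤ (X k).1.2 := by
    intro k
    induction k with
    | zero => exact Nat.zero_le _
    | succ k ih => have := hlt k; omega
  have hagree : ∀ k l, k ≤ l → AgreeBefore (X k).1.2 (X k).1.1 (X l).1.1 := by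
    intro k l h
    induction l, h using Nat.le_induction with
    | base => exact AgreeBefore.refl _ _
    | succ l h ih =>
      refine ih.trans (AgreeBefore.mono ?_ (hmono k l h))
      rw [hX]
      exact hnext1 _ _
  let L := limitPattern fun k => (X k).1.1
  have hL' : ∀ k, AgreeBefore k (X k).1.1 L := agreeBefore_limitPattern
    (c := fun k => (X k).1.1) fun k l h => (hagree k l h).mono (hge k)
  have hL : ∀ k, AgreeBefore (X k).1.2 (X k).1.1 L := fun k =>
    (hagree k _ (hge k)).trans (hL' _)
  have hdone : ∀ p m N, ∃ k : ℕ, N ≤ k ∧ f k.unpair.1 = (p, m) := by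
    intro p m N
    obtain ⟨i, hi⟩ := hf (p, m)
    exact ⟨Nat.pair i N, Nat.right_le_pair i N, by simp [hi]⟩
  have hsteady : Steady L := by
    constructor
    · intro p
      rw [Set.infinite_iff_exists_gt]
      intro N
      obtain ⟨k, hk, hk'⟩ := hdone p none (N + 1)
      obtain ⟨τ, h1, h2, h3, _⟩ := hnext2 (X k) (f k.unpair.1)
      rw [← hX, hk'] at h3
      rw [← hX] at h2
      refine ⟨τ, ((hL (k + 1) p τ h2).1).1 h3, ?_⟩
      have := hge k
      omega
    · intro p s q
      obtain ⟨k, hk, hk'⟩ := hdone q (some (p, s)) (s + 1)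
      obtain ⟨τ, h1, h2⟩ := hnext3 (X k) (f k.unpair.1) (p, s) (by rw [hk']; rfl)
        (by have := hge k; simp only; omega)
      rw [← hX] at h1 h2
      rw [hk'] at h2
      exact ⟨τ, ((hL (k + 1) q τ h1).1).1 ((X (k + 1)).2.1 _ _ _ _ h2),
        ((hL (k + 1) q τ h1).2 p s).1 h2⟩
  obtain ⟨Vout, hV, hO⟩ := hA.safety 0 (Nat.zero_le t) Vin sd (noCrash n) noCrash_mem_FP L
    (hsteady.admissible _ _ _)
  have hne : (OS Vout).Nonempty := by
    rcases hO with hO | hO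
    · rw [hO]; exact Set.singleton_nonempty _
    · rw [Set.mem_singleton_iff.1 hO]; exact Set.singleton_nonempty _
  obtain ⟨v, r, hr⟩ := hne
  obtain ⟨τ, hτ⟩ := (hV r v).1 hr
  -- The first output determines the value, but the prefix that contains it is bivalent.
  have h1 : τ < (X (τ + 1)).1.2 := by have := hge (τ + 1); omega
  have h2 := ((hL (τ + 1)).outputsAt h1).2 hτ
  have h3 := reach_unique hA h1 h2 ((X (τ + 1)).2.2 0)
  have h4 := reach_unique hA h1 h2 ((X (τ + 1)).2.2 1)
  rw [h3] at h4
  exact absurd h4 (by decide)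

end Agreement

/-! ### Impossibility of asynchronous output of both values -/

section BothValues

variable {n : ℕ} {I S : Type} {A : Algorithm n I S}

open Classical in
/-- The timing pattern in which the information that a process `p ∈ Z` communicates at instant
`fp p` never arrives. -/
noncomputable def dropLast (fp : FailurePattern n) (Z : Set (Fin n)) (c : AsyncPattern n) :
    AsyncPattern n where
  steps := c.steps
  arrival p s q := if p ∈ Z ∧ fp p = (s : ℕ∞) then ⊤ else c.arrival p s q
  lt_arrival p s q := by
    split_ifs
    · exact ENat.natCast_lt_top s
    · exact c.lt_arrival p s q

open Classical in
/-- The failure pattern in which the processes of `Z` crash one instant later. -/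
noncomputable def oneMore (fp : FailurePattern n) (Z : Set (Fin n)) : FailurePattern n :=
  fun p => if p ∈ Z then fp p + 1 else fp p

/-- A step that a process takes immediately before its crash, and whose message is lost, is not
noticed by the other processes. -/
theorem run_dropLast (Vin : Fin n → Option I) (sd : Fin n → S) (fp : FailurePattern n)
    (Z : Set (Fin n)) (c : AsyncPattern n) (q : Fin n) (τ : ℕ) (hτ : (τ : ℕ∞) ≤ fp q ∨ q ∉ Z) :
    stepOut A Vin sd fp c q τ = stepOut A Vin sd (oneMore fp Z) (dropLast fp Z c) q τ := by
  classical
  set θ : Fin n → ℕ∞ := fun p => if p ∈ Z then fp p else ⊤ with hθ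
  have hstep : ∀ q (τ : ℕ), (τ : ℕ∞) < θ q →
      (TakesStep fp c q τ ↔ TakesStep (oneMore fp Z) (dropLast fp Z c) q τ) := by
    intro q τ h
    refine and_congr_right fun _ => ?_
    by_cases hq : q ∈ Z
    · simp only [hθ, hq, if_true, oneMore] at h ⊢
      exact ⟨fun _ => h.trans_le le_self_add, fun _ => h⟩
    · simp [oneMore, hq]
  have harr : ∀ q (τ : ℕ) p (s : ℕ), (s : ℕ∞) < θ p →
      (c.arrival p s q = (τ : ℕ∞) ↔ (dropLast fp Z c).arrival p s q = (τ : ℕ∞)) := by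
    intro q τ p s hs
    have : ¬ (p ∈ Z ∧ fp p = (s : ℕ∞)) := by
      rintro ⟨h1, h2⟩
      simp only [hθ, h1, if_true, h2] at hs
      exact lt_irrefl _ hs
    simp [dropLast, this]
  have hlate : ∀ p (s : ℕ), θ p ≤ s → ¬ TakesStep fp c p s := by
    intro p s hs h
    by_cases hp : p ∈ Z
    · simp only [hθ, hp, if_true] at hs
      exact absurd h.2 (not_lt.2 hs)
    · simp [hθ, hp] at hs
  have hlate' : ∀ q (τ : ℕ) p (s : ℕ), θ p ≤ s → (dropLast fp Z c).arrival p s q = (τ : ℕ∞) →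
      ¬ TakesStep (oneMore fp Z) (dropLast fp Z c) p s := by
    intro q τ p s hs ha h
    by_cases hp : p ∈ Z
    · simp only [hθ, hp, if_true] at hs
      have h2 := h.2
      simp only [oneMore, hp, if_true] at h2
      have h3 : fp p = (s : ℕ∞) := le_antisymm hs (Order.le_of_lt_add_one h2)
      simp only [dropLast] at ha
      rw [if_pos ⟨hp, h3⟩] at ha
      exact absurd ha.symm (ENat.natCast_ne_top τ)
    · simp [hθ, hp] at hs
  obtain ⟨h1, h2⟩ := asyncRun_agree (A := A) (Vin := Vin) (Vin' := Vin) (sd := sd) (sd' := sd)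
    θ τ (fun _ _ => rfl) (fun q τ _ h => hstep q τ h) (fun q τ _ _ _ => harr q τ)
    (fun _ _ _ _ _ p s h _ => hlate p s h) (fun q τ _ _ _ => hlate' q τ) τ le_rfl
  have hq : (τ : ℕ∞) ≤ θ q := by
    by_cases hq : q ∈ Z
    · simpa [hθ, hq] using hτ
    · simp [hθ, hq]
  unfold stepOut
  rw [h1 q rfl hq, asyncObserved_congr h2 (harr q τ)
      (fun p s hs _ => log_eq_none_of_not_takesStep (hlate p s hs))
      (fun p s hs ha => log_eq_none_of_not_takesStep (hlate' q τ p s hs ha))]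

/-- The output step that crashed processes were about to take: each crashed process `p` has crashed
at an instant `fp p ≤ T` of its own steps, at which it would have output a value. Nobody has output
anything before instant `T`. -/
structure Poised (A : Algorithm n I S) (Vin : Fin n → Option I) (sd : Fin n → S)
    (c : AsyncPattern n) (fp : FailurePattern n) (T : ℕ) : Prop where
  poised : ∀ p, ¬ Correct fp p → ∃ τ : ℕ, fp p = τ ∧ τ ≤ T ∧ τ ∈ c.steps p ∧
    ∃ v, stepOut A Vin sd fp c p τ = some v
  quiet : ∀ p (τ : ℕ) v, τ < T → ¬ OutputsAt A Vin sd fp c p τ v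

theorem single_output {Vin : Fin n → Option I} {sd : Fin n → S} {fp : FailurePattern n}
    {c : AsyncPattern n} {Vout : Fin n → Option (Fin 2)}
    (hV : IsOutputVector A Vin sd fp .async c Vout) {p : Fin n} {τ τ' : ℕ} {v v' : Fin 2}
    (h : OutputsAt A Vin sd fp c p τ v) (h' : OutputsAt A Vin sd fp c p τ' v') : v = v' := by
  have h1 := (hV p v).2 ⟨τ, h⟩
  have h2 := (hV p v').2 ⟨τ', h'⟩
  rw [h1] at h2
  exact Option.some.inj h2

theorem exists_other_of_mem {O : Set (Set (Fin 2))} (hO : O ⊆ {∅, {0, 1}}) {o : Set (Fin 2)}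
    (ho : o ∈ O) {v : Fin 2} (hv : v ∈ o) (w : Fin 2) : w ∈ o := by
  rcases hO ho with h | h
  · rw [h] at hv; exact absurd hv (by simp)
  · rw [Set.mem_singleton_iff.1 h]
    rcases (show w = 0 ∨ w = 1 by omega) with rfl | rfl <;> simp

theorem mem_FP_self (fp : FailurePattern n) : fp ∈ FP n {p | ¬ Correct fp p}.ncard := rfl

/-- The majority argument: among more than `t` poised processes, the ones poised to output the more
frequent value survive, and all the others crash. -/
theorem false_of_poised {t : ℕ} {O : Set (Set (Fin 2))} (hA : Implements A t .async O)
    (hO : O ⊆ {∅, {0, 1}}) (hnt : 2 * n ≤ 3 * t + 2) {Vin : Fin n → Option I} {sd : Fin n → S}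
    {c : AsyncPattern n} {fp : FailurePattern n} {T : ℕ} (hP : Poised A Vin sd c fp T)
    (hcard : t < {p | ¬ Correct fp p}.ncard) : False := by
  classical
  set val : Fin 2 → Finset (Fin n) := fun v => Finset.univ.filter fun p =>
    ∃ τ : ℕ, fp p = τ ∧ stepOut A Vin sd fp c p τ = some v with hval
  have hsum : t < (val 0).card + (val 1).card := by
    refine lt_of_lt_of_le hcard (le_trans ?_ (Finset.card_union_le _ _))
    rw [← Set.ncard_coe_finset]
    refine Set.ncard_le_ncard (fun p hp => ?_) (Finset.finite_toSet _)
    obtain ⟨τ, h1, _, _, v, h2⟩ := hP.poised p hp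
    rcases (show v = 0 ∨ v = 1 by omega) with rfl | rfl
    · exact Finset.mem_union_left _ (by simp [hval]; exact ⟨τ, h1, h2⟩)
    · exact Finset.mem_union_right _ (by simp [hval]; exact ⟨τ, h1, h2⟩)
  obtain ⟨x, hx⟩ : ∃ x, t + 1 ≤ 2 * (val x).card := by
    by_contra h
    push Not at h
    have h0 := h 0
    have h1 := h 1
    omega
  set Z : Set (Fin n) := {p | p ∈ val x} with hZ
  have hZspec : ∀ p ∈ Z, ∃ τ : ℕ, fp p = τ ∧ τ ≤ T ∧ τ ∈ c.steps p ∧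
      stepOut A Vin sd fp c p τ = some x := by
    intro p hp
    simp only [hZ, hval, Finset.mem_filter, Finset.mem_univ, true_and, Set.mem_ofPred_eq] at hp
    obtain ⟨τ, h1, h2⟩ := hp
    obtain ⟨τ', h3, h4, h5, v, h6⟩ := hP.poised p (by rw [Correct, h1]; exact ENat.natCast_ne_top τ)
    have : τ = τ' := by rw [h1] at h3; exact_mod_cast h3
    subst this
    exact ⟨τ, h1, h4, h5, h2⟩
  -- Everybody has crashed by instant `T`, except that the processes of `Z` make their output.
  set fp₁ : FailurePattern n := fun p => min (fp p) T with hfp₁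
  have hfp₁Z : ∀ p ∈ Z, fp₁ p = fp p := by
    intro p hp
    obtain ⟨τ, h1, h2, _⟩ := hZspec p hp
    simp only [hfp₁, h1]
    exact min_eq_left (by exact_mod_cast h2)
  have hstep₁ : ∀ q (τ : ℕ), τ < T → (TakesStep fp c q τ ↔ TakesStep fp₁ c q τ) := by
    intro q τ hτ
    refine and_congr_right fun _ => ?_
    simp only [hfp₁, lt_min_iff]
    exact ⟨fun h => ⟨h, by exact_mod_cast hτ⟩, fun h => h.1⟩
  have hout₁ : ∀ q (τ : ℕ), τ ≤ T → stepOut A Vin sd fp c q τ = stepOut A Vin sd fp₁ c q τ := by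
    intro q τ hτ
    unfold stepOut
    rw [asyncRun_congr (A := A) (Vin := Vin) (sd := sd) T hstep₁ (fun _ _ _ _ _ _ => Iff.rfl) τ hτ]
  set fp₂ := oneMore fp₁ Z with hfp₂
  set c₂ := dropLast fp₁ Z c with hc₂
  set fp₃ : FailurePattern n := fun p => if p ∈ Z then ⊤ else fp₁ p with hfp₃
  set c₃ := continuation fp₂ c₂ (T + 1) with hc₃
  have hle : ∀ q (τ : ℕ), τ < T + 1 → TakesStep fp₂ c₂ q τ → (τ : ℕ∞) < fp₃ q := by
    intro q τ _ h
    by_cases hq : q ∈ Z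
    · simp [hfp₃, hq]
    · have h2 := h.2
      simpa [hfp₂, hfp₃, oneMore, hq] using h2
  have hout : ∀ q (τ : ℕ) v, τ < T + 1 →
      (OutputsAt A Vin sd fp₂ c₂ q τ v ↔ OutputsAt A Vin sd fp₃ c₃ q τ v) := fun q τ v hτ =>
    outputsAt_congr (continuation_takesStep hle) (fun _ _ hτ h => continuation_arrival hτ h) hτ
  have hcount : {p | ¬ Correct fp₃ p}.ncard ≤ t := by
    have h1 : {p | ¬ Correct fp₃ p} ⊆ ((Finset.univ \ val x : Finset (Fin n)) : Set (Fin n)) := by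
      intro p hp
      simp only [Finset.coe_sdiff, Finset.coe_univ, Set.mem_sdiff, Set.mem_univ, true_and]
      intro h
      apply hp
      have : p ∈ Z := h
      simp [Correct, hfp₃, this]
    have h2 := Set.ncard_le_ncard h1 (Finset.finite_toSet _)
    rw [Set.ncard_coe_finset, Finset.card_univ_sdiff, Fintype.card_fin] at h2
    omega
  obtain ⟨Vout, hV, hOS⟩ := hA.safety _ hcount Vin sd fp₃ (mem_FP_self fp₃) c₃
    ((continuation_steady _ _ _).admissible _ _ _)
  have hZout : ∀ p ∈ Z, ∃ τ, OutputsAt A Vin sd fp₃ c₃ p τ x := by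
    intro p hp
    obtain ⟨τ, h1, h2, h3, h4⟩ := hZspec p hp
    refine ⟨τ, (hout p τ x (by omega)).1 ⟨⟨h3, ?_⟩, ?_⟩⟩
    · simp only [hfp₂, oneMore, hp, if_true, hfp₁Z p hp, h1]
      exact_mod_cast Nat.lt_succ_self τ
    · rw [← run_dropLast Vin sd fp₁ Z c p τ (Or.inl (by rw [hfp₁Z p hp, h1])), ← hout₁ p τ h2, h4]
  obtain ⟨p, hp⟩ : ∃ p, p ∈ Z := by
    have : 0 < (val x).card := by omega
    obtain ⟨p, hp⟩ := Finset.card_pos.1 this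
    exact ⟨p, hp⟩
  obtain ⟨τ, hτ⟩ := hZout p hp
  obtain ⟨q, hq⟩ := exists_other_of_mem hO hOS (v := x) ⟨p, (hV p x).2 ⟨τ, hτ⟩⟩ (x + 1)
  obtain ⟨τ', hτ'⟩ := (hV q (x + 1)).1 hq
  have hqZ : q ∉ Z := by
    intro hqZ
    obtain ⟨τ'', h⟩ := hZout q hqZ
    have := single_output hV h hτ'
    omega
  have hlt : (τ' : ℕ∞) < fp₁ q := by
    have h := hτ'.1.2
    simpa [hfp₃, hqZ] using h
  have hT : τ' < T := by
    have := hlt.trans_le (min_le_right _ _)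
    exact_mod_cast this
  have h1 := (hout q τ' _ (by omega)).2 hτ'
  refine hP.quiet q τ' (x + 1) hT ⟨⟨h1.1.1, hlt.trans_le (min_le_left _ _)⟩, ?_⟩
  rw [hout₁ q τ' hT.le, run_dropLast Vin sd fp₁ Z c q τ' (Or.inr hqZ)]
  exact h1.2

/-- If at least one process `p₁` and at most `t` processes are poised, then one more process gets
poised: the others have to output something, since they cannot tell whether `p₁` made its output
before it crashed. -/
theorem Poised.extend {t : ℕ} {O : Set (Set (Fin 2))} (hA : Implements A t .async O)
    (hO : O ⊆ {∅, {0, 1}}) {Vin : Fin n → Option I} {sd : Fin n → S} {c : AsyncPattern n}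
    (hc : Steady c) {fp : FailurePattern n} {T : ℕ} (hP : Poised A Vin sd c fp T) {p₁ : Fin n}
    (hp₁ : ¬ Correct fp p₁) (hcard : {p | ¬ Correct fp p}.ncard ≤ t) :
    ∃ fp' T', Poised A Vin sd c fp' T' ∧ ¬ Correct fp' p₁ ∧
      {p | ¬ Correct fp' p}.ncard = {p | ¬ Correct fp p}.ncard + 1 := by
  classical
  obtain ⟨τ₁, h1, h2, h3, v₁, h4⟩ := hP.poised p₁ hp₁
  -- If `p₁` makes its output immediately before its crash, somebody else outputs the other value.
  have hex : ∃ τ, ∃ q v, OutputsAt A Vin sd fp c q τ v := by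
    have hcor : ∀ p, Correct (oneMore fp {p₁}) p ↔ Correct fp p := by
      intro p
      by_cases hp : p = p₁
      · subst hp
        simp only [Correct, oneMore, Set.mem_singleton_iff, if_true, h1]
        exact ⟨fun h => absurd h (ENat.natCast_ne_top (τ₁ + 1)),
          fun h => absurd h (ENat.natCast_ne_top _)⟩
      · simp [Correct, oneMore, hp]
    obtain ⟨Vout, hV, hOS⟩ := hA.safety _ hcard Vin sd (oneMore fp {p₁})
      (by simp only [FP, Set.mem_ofPred_eq, hcor]) (dropLast fp {p₁} c)
      (admissible_of_arrival (c := dropLast fp {p₁} c) (fun p _ => hc.1 p) (fun p s => by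
        by_cases h : p = p₁ ∧ fp p = (s : ℕ∞)
        · refine Or.inl ⟨?_, fun q => ?_⟩
          · rw [hcor, h.1]; exact hp₁
          · have h' := h.2
            rw [h.1] at h'
            simp [dropLast, h.1, h']
        · refine Or.inr fun q _ => ?_
          obtain ⟨τ, h5, h6⟩ := hc.2 p s q
          exact ⟨τ, h5, by simp [dropLast, h, h6]⟩) Vin sd)
    have h5 : OutputsAt A Vin sd (oneMore fp {p₁}) (dropLast fp {p₁} c) p₁ τ₁ v₁ := by
      refine ⟨⟨h3, ?_⟩, ?_⟩
      · simp only [oneMore, Set.mem_singleton_iff, if_true, h1]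
        exact_mod_cast Nat.lt_succ_self τ₁
      · rw [← run_dropLast Vin sd fp {p₁} c p₁ τ₁ (Or.inl h1.ge), h4]
    obtain ⟨q, hq⟩ := exists_other_of_mem hO hOS (v := v₁) ⟨p₁, (hV p₁ v₁).2 ⟨τ₁, h5⟩⟩ (v₁ + 1)
    obtain ⟨τ, hτ⟩ := (hV q (v₁ + 1)).1 hq
    have hqp : q ≠ p₁ := by
      rintro rfl
      have := single_output hV h5 hτ
      omega
    refine ⟨τ, q, v₁ + 1, ⟨hτ.1.1, ?_⟩, ?_⟩
    · have := hτ.1.2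
      simpa [oneMore, hqp] using this
    · rw [run_dropLast Vin sd fp {p₁} c q τ (Or.inr (by simpa using hqp))]
      exact hτ.2
  obtain ⟨r, v, hr⟩ := Nat.find_spec hex
  have hmin : ∀ τ < Nat.find hex, ∀ q v, ¬ OutputsAt A Vin sd fp c q τ v := by
    intro τ hτ q v h
    exact Nat.find_min hex hτ ⟨q, v, h⟩
  set τ := Nat.find hex with hτ
  have hTτ : T ≤ τ := by
    by_contra h
    exact hP.quiet r τ v (by omega) hr
  have hrc : Correct fp r := by
    by_contra h
    obtain ⟨τ', h5, h6, _⟩ := hP.poised r h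
    have := hr.1.2
    rw [h5] at this
    have : τ < τ' := by exact_mod_cast this
    omega
  set fp' : FailurePattern n := Function.update fp r (τ : ℕ∞) with hfp'
  have hr' : fp' r = τ := by simp [hfp']
  have hne : ∀ p, p ≠ r → fp' p = fp p := fun p hp => by simp [hfp', hp]
  have hstep : ∀ q (σ : ℕ), σ < τ → (TakesStep fp c q σ ↔ TakesStep fp' c q σ) := by
    intro q σ hσ
    refine and_congr_right fun _ => ?_
    by_cases hq : q = r
    · subst hq
      rw [hr', hrc]
      exact ⟨fun _ => by exact_mod_cast hσ, fun _ => ENat.natCast_lt_top σ⟩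
    · rw [hne q hq]
  have hout : ∀ q (σ : ℕ), σ ≤ τ → stepOut A Vin sd fp c q σ = stepOut A Vin sd fp' c q σ := by
    intro q σ hσ
    unfold stepOut
    rw [asyncRun_congr (A := A) (Vin := Vin) (sd := sd) τ hstep (fun _ _ _ _ _ _ => Iff.rfl) σ hσ]
  have hset : {p | ¬ Correct fp' p} = insert r {p | ¬ Correct fp p} := by
    ext p
    by_cases hp : p = r
    · subst hp
      simp [Correct, hr']
    · simp [Correct, hne p hp, hp]
  refine ⟨fp', τ, ⟨?_, ?_⟩, ?_, ?_⟩
  · intro p hp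
    by_cases hpr : p = r
    · subst hpr
      exact ⟨τ, hr', le_rfl, hr.1.1, v, by rw [← hout p τ le_rfl]; exact hr.2⟩
    · rw [Correct, hne p hpr] at hp
      obtain ⟨σ, h5, h6, h7, w, h8⟩ := hP.poised p hp
      exact ⟨σ, by rw [hne p hpr, h5], by omega, h7, w, by rw [← hout p σ (by omega)]; exact h8⟩
  · rintro p σ w hσ ⟨h5, h6⟩
    exact hmin σ hσ p w ⟨(hstep p σ hσ).2 h5, by rw [hout p σ hσ.le]; exact h6⟩
  · have : p₁ ∈ {p | ¬ Correct fp' p} := by rw [hset]; exact Set.mem_insert_of_mem _ hp₁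
    exact this
  · rw [hset, Set.ncard_insert_of_notMem]
    intro h
    exact h hrc

/-- In the asynchronous model, if both values have to be output (or none), then at most one third
of `2 * n - 3` crashes can be tolerated. -/
theorem lt_of_implements_async_both {t : ℕ} {O : Set (Set (Fin 2))}
    (hA : Implements A t .async O) (hO : O ⊆ {∅, {0, 1}}) (h01 : {0, 1} ∈ O) :
    3 * t + 2 < 2 * n := by
  classical
  by_contra hnt
  obtain ⟨Vin, sd, fp, hfp, c, hc, Vout, hV, hOS⟩ := hA.completeness 0 (Nat.zero_le t) _ h01
  have hex : ∃ τ, ∃ q v, OutputsAt A Vin sd fp c q τ v := by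
    obtain ⟨p, hp⟩ : (0 : Fin 2) ∈ OS Vout := by rw [hOS]; simp
    obtain ⟨τ, hτ⟩ := (hV p 0).1 hp
    exact ⟨τ, p, 0, hτ⟩
  obtain ⟨p₁, v₁, hp₁⟩ := Nat.find_spec hex
  have hmin : ∀ τ < Nat.find hex, ∀ q v, ¬ OutputsAt A Vin sd fp c q τ v := by
    intro τ hτ q v h
    exact Nat.find_min hex hτ ⟨q, v, h⟩
  set T := Nat.find hex with hT
  set d := continuation fp c (T + 1) with hd
  have hfpc := correct_of_mem_FP_zero hfp
  set fp₁ : FailurePattern n := Function.update fp p₁ (T : ℕ∞) with hfp₁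
  have hp : fp₁ p₁ = T := by simp [hfp₁]
  have hne : ∀ p, p ≠ p₁ → fp₁ p = fp p := fun p hp => by simp [hfp₁, hp]
  have hstep : ∀ q (σ : ℕ), σ < T → (TakesStep fp c q σ ↔ TakesStep fp₁ d q σ) := by
    intro q σ hσ
    refine Iff.trans (continuation_takesStep (T := T + 1) (fun _ _ _ h => h.2) q σ (by omega))
      (and_congr_right fun _ => ?_)
    by_cases hq : q = p₁
    · subst hq
      rw [hp, hfpc]
      exact ⟨fun _ => by exact_mod_cast hσ, fun _ => ENat.natCast_lt_top σ⟩
    · rw [hne q hq]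
  have hout : ∀ q (σ : ℕ), σ ≤ T → TakesStep fp c q σ →
      stepOut A Vin sd fp c q σ = stepOut A Vin sd fp₁ d q σ := by
    intro q σ hσ hs
    unfold stepOut
    rw [← asyncRun_congr (A := A) (Vin := Vin) (sd := sd) T hstep
      (fun q τ hτ h p s => continuation_arrival (by omega) h p s) σ hσ]
    rw [show asyncObserved A c σ (asyncRun A Vin sd fp c σ) q =
      asyncObserved A d σ (asyncRun A Vin sd fp c σ) q from
      asyncObserved_congr (θ := fun _ => ⊤) (fun _ _ _ => rfl)
        (fun p s _ => continuation_arrival (by omega) hs p s)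
        (fun _ _ h => absurd h (by simp)) (fun _ _ h => absurd h (by simp))]
  have hset : {p | ¬ Correct fp₁ p} = {p₁} := by
    ext p
    by_cases hpp : p = p₁
    · subst hpp
      simp [Correct, hp]
    · have := hfpc p
      simp only [Set.mem_ofPred_eq, Correct, hne p hpp, Set.mem_singleton_iff, hpp, iff_false,
        not_not]
      exact this
  have hbase : Poised A Vin sd d fp₁ T := by
    constructor
    · intro p hpc
      have : p ∈ {p | ¬ Correct fp₁ p} := hpc
      rw [hset] at this
      obtain rfl : p = p₁ := this
      exact ⟨T, hp, le_rfl, Or.inr hp₁.1, v₁, by rw [← hout p T le_rfl hp₁.1]; exact hp₁.2⟩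
    · rintro p σ w hσ ⟨h5, h6⟩
      have h7 := (hstep p σ hσ).2 h5
      exact hmin σ hσ p w ⟨h7, by rw [hout p σ hσ.le h7]; exact h6⟩
  have key : ∀ k, k ≤ t → ∃ fp' T', Poised A Vin sd d fp' T' ∧ ¬ Correct fp' p₁ ∧
      {p | ¬ Correct fp' p}.ncard = k + 1 := by
    intro k
    induction k with
    | zero =>
      intro _
      refine ⟨fp₁, T, hbase, ?_, by rw [hset]; simp⟩
      simp [Correct, hp]
    | succ k ih =>
      intro hk
      obtain ⟨fp', T', h1, h2, h3⟩ := ih (by omega)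
      obtain ⟨fp'', T'', h4, h5, h6⟩ := h1.extend hA hO (continuation_steady _ _ _) h2 (by omega)
      exact ⟨fp'', T'', h4, h5, by omega⟩
  obtain ⟨fp', T', h1, _, h3⟩ := key t le_rfl
  exact false_of_poised hA hO (by omega) h1 (by omega)

end BothValues

/-! ### Elementary necessary conditions, and the synchronous output of both values -/

section Necessary

variable {n : ℕ} {I S : Type} {A : Algorithm n I S} {t : ℕ} {σ : Timing} {O : Set (Set (Fin 2))}

theorem le_of_implements (hA : Implements A t σ O) : t ≤ n := by
  obtain ⟨o, ho⟩ := hA.nonempty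
  obtain ⟨_, _, fp, hfp, _⟩ := hA.completeness t le_rfl o ho
  have h : {p | ¬ Correct fp p}.ncard = t := hfp
  have h1 := Set.ncard_le_ncard (Set.subset_univ {p | ¬ Correct fp p})
  rwa [h, Set.ncard_univ, Nat.card_fin] at h1

/-- If an output is always required, then not all processes may crash. -/
theorem lt_of_implements (hA : Implements A t σ O) (hO : ∅ ∉ O) : t < n := by
  by_contra hlt
  have hle := le_of_implements hA
  have hfp : (fun _ => 0 : FailurePattern n) ∈ FP n t := by
    have : {p | ¬ Correct (fun _ => 0 : FailurePattern n) p} = Set.univ := by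
      ext p; simp [Correct]
    simp only [FP, Set.mem_ofPred_eq]
    rw [this, Set.ncard_univ, Nat.card_fin]
    omega
  have hempty : ∀ (Vout : Fin n → Option (Fin 2)), (∀ p v, Vout p ≠ some v) → OS Vout ∉ O := by
    intro Vout h h'
    have : OS Vout = ∅ := by
      ext v
      simp only [OS, Set.mem_ofPred_eq, Set.mem_empty_iff_false, iff_false, not_exists]
      exact fun p => h p v
    rw [this] at h'
    exact hO h'
  obtain ⟨o, ho⟩ := hA.nonempty
  obtain ⟨Vin, sd, _⟩ := hA.completeness t le_rfl o ho
  cases σ with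
  | async =>
    obtain ⟨Vout, hV, hOS⟩ := hA.safety t le_rfl Vin sd _ hfp (lockStep n)
      ((lockStep_steady n).admissible _ _ _)
    refine hempty Vout (fun p v h => ?_) hOS
    obtain ⟨τ, hτ, _⟩ := (hV p v).1 h
    exact absurd hτ.2 (by simp)
  | sync =>
    obtain ⟨Vout, hV, hOS⟩ := hA.safety t le_rfl Vin sd _ hfp () (Set.mem_univ _)
    refine hempty Vout (fun p v h => ?_) hOS
    obtain ⟨R, hR, _⟩ := (hV p v).1 h
    exact absurd hR (by simp)

theorem one_le_of_implements (hA : Implements A t σ O) {o : Set (Fin 2)} (ho : o ∈ O)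
    (hne : o.Nonempty) : 1 ≤ n := by
  obtain ⟨_, _, _, _, _, _, Vout, _, hOS⟩ := hA.completeness 0 (Nat.zero_le t) o ho
  obtain ⟨v, hv⟩ := hne
  rw [← hOS] at hv
  obtain ⟨p, _⟩ := hv
  exact p.pos

theorem two_le_of_implements (hA : Implements A t σ O) (ho : {0, 1} ∈ O) : 2 ≤ n := by
  obtain ⟨_, _, _, _, _, _, Vout, _, hOS⟩ := hA.completeness 0 (Nat.zero_le t) _ ho
  have h0 : (0 : Fin 2) ∈ OS Vout := by rw [hOS]; simp
  have h1 : (1 : Fin 2) ∈ OS Vout := by rw [hOS]; simp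
  obtain ⟨p, hp⟩ := h0
  obtain ⟨q, hq⟩ := h1
  by_contra hn
  have : p = q := Fin.ext (by omega)
  rw [this, hq] at hp
  exact absurd hp (by decide)

theorem syncObserved_congr {fp fp' : FailurePattern n} {R : ℕ}
    (h : ∀ p, ((2 * R : ℕ) : ℕ∞) < fp p ↔ ((2 * R : ℕ) : ℕ∞) < fp' p) (st : Fin n → A.State) :
    syncObserved A fp R st = syncObserved A fp' R st := by
  ext m
  simp only [syncObserved, Set.mem_ofPred_eq, h]

theorem syncState_congr {Vin : Fin n → Option I} {sd : Fin n → S} {fp fp' : FailurePattern n}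
    {R : ℕ} (h : ∀ p k, k < 2 * R → ((k : ℕ∞) < fp p ↔ (k : ℕ∞) < fp' p)) :
    syncState A Vin sd fp R = syncState A Vin sd fp' R := by
  induction R with
  | zero => rfl
  | succ R ih =>
    funext p
    simp only [syncState]
    rw [ih (fun p k hk => h p k (by omega)), syncObserved_congr (fun p => h p (2 * R) (by omega))]
    simp only [h p (2 * R + 1) (by omega)]

/-- In the synchronous model, if both values have to be output (or none), then at least two
processes have to be correct: otherwise, all processes but one may crash immediately before the
computation step in which this one makes the first output. -/
theorem add_two_le_of_implements_sync_both (hA : Implements A t .sync O)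
    (hO : O ⊆ {∅, {0, 1}}) (h01 : {0, 1} ∈ O) : t + 2 ≤ n := by
  classical
  by_contra hnt
  obtain ⟨Vin, sd, fp, hfp, c, -, Vout, hV, hOS⟩ := hA.completeness 0 (Nat.zero_le t) _ h01
  have hfpc : ∀ p, fp p = ⊤ := correct_of_mem_FP_zero hfp
  have hex : ∃ R, ∃ p v, (A.compute p (syncState A Vin sd fp R p)
      (syncObserved A fp R (syncState A Vin sd fp R))).2 = some v := by
    obtain ⟨p, hp⟩ : (0 : Fin 2) ∈ OS Vout := by rw [hOS]; simp
    obtain ⟨R, _, hR⟩ := (hV p 0).1 hp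
    exact ⟨R, p, 0, hR⟩
  obtain ⟨p, v, hp⟩ := Nat.find_spec hex
  have hmin : ∀ R < Nat.find hex, ∀ p v, (A.compute p (syncState A Vin sd fp R p)
      (syncObserved A fp R (syncState A Vin sd fp R))).2 ≠ some v := by
    intro R hR p v h
    exact Nat.find_min hex hR ⟨p, v, h⟩
  set R := Nat.find hex with hR
  set fp' : FailurePattern n := fun q => if q = p then ⊤ else ((2 * R + 1 : ℕ) : ℕ∞) with hfp'
  have hsame : ∀ q k, k < 2 * R + 1 → ((k : ℕ∞) < fp q ↔ (k : ℕ∞) < fp' q) := by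
    intro q k hk
    rw [hfpc]
    simp only [hfp']
    split_ifs
    · rfl
    · exact ⟨fun _ => by exact_mod_cast hk, fun _ => ENat.natCast_lt_top k⟩
  have heq : ∀ R' ≤ R, ∀ q, A.compute q (syncState A Vin sd fp R' q)
      (syncObserved A fp R' (syncState A Vin sd fp R')) =
      A.compute q (syncState A Vin sd fp' R' q)
      (syncObserved A fp' R' (syncState A Vin sd fp' R')) := by
    intro R' hR' q
    rw [syncState_congr (fun q k hk => hsame q k (by omega)),
      syncObserved_congr (fun q => hsame q (2 * R') (by omega))]
  have hcard : {q | ¬ Correct fp' q}.ncard ≤ t := by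
    have h1 : {q | ¬ Correct fp' q} ⊆ (({p}ᶜ : Finset (Fin n)) : Set (Fin n)) := by
      intro q hq
      simp only [Finset.coe_compl, Finset.coe_singleton, Set.mem_compl_iff, Set.mem_singleton_iff]
      rintro rfl
      exact hq (by simp [Correct, hfp'])
    have h2 := Set.ncard_le_ncard h1 (Finset.finite_toSet _)
    rw [Set.ncard_coe_finset, Finset.card_compl, Fintype.card_fin, Finset.card_singleton] at h2
    omega
  obtain ⟨Vout', hV', hOS'⟩ := hA.safety _ hcard Vin sd fp' (mem_FP_self fp') () (Set.mem_univ _)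
  have hpv : Vout' p = some v :=
    (hV' p v).2 ⟨R, by simp only [hfp', if_true]; exact ENat.natCast_lt_top _, by rw [← heq R le_rfl]; exact hp⟩
  obtain ⟨q, hq⟩ := exists_other_of_mem hO hOS' (v := v) ⟨p, hpv⟩ (v + 1)
  have hqp : q ≠ p := by
    rintro rfl
    rw [hpv] at hq
    have := Option.some.inj hq
    omega
  obtain ⟨R', h1, h2⟩ := (hV' q (v + 1)).1 hq
  simp only [hfp', hqp, if_false] at h1
  have h3 : R' < R := by
    have : 2 * R' + 1 < 2 * R + 1 := by exact_mod_cast h1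
    omega
  rw [← heq R' h3.le] at h2
  exact hmin R' h3 q _ h2

end Necessary

section FailurePatterns

variable {n : ℕ}

/-- There is a failure pattern with `f ≤ n` crashes, all of them at instant `x`. -/
theorem exists_mem_FP {f : ℕ} (hf : f ≤ n) (x : ℕ) :
    ∃ fp ∈ FP n f, ∀ p, fp p = ⊤ ∨ fp p = x := by
  classical
  refine ⟨fun p => if p.val < f then (x : ℕ∞) else ⊤, ?_, fun p => ?_⟩
  · have h : {p : Fin n | ¬ Correct (fun p : Fin n => if p.val < f then (x : ℕ∞) else ⊤) p} =
        ((Finset.univ.filter fun p : Fin n => p.val < f : Finset (Fin n)) : Set (Fin n)) := by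
      ext p
      by_cases hp : p.val < f <;> simp [Correct, hp]
    simp only [FP, Set.mem_ofPred_eq]
    rw [h, Set.ncard_coe_finset, Fin.card_filter_val_lt]
    omega
  · by_cases hp : p.val < f <;> simp [hp]

/-- With at most `t` crashes, each set of more than `t` processes contains a correct one. -/
theorem exists_correct_mem {f t : ℕ} {fp : FailurePattern n} (hfp : fp ∈ FP n f) (hf : f ≤ t)
    {B : Finset (Fin n)} (hB : t < B.card) : ∃ p ∈ B, Correct fp p := by
  by_contra h
  push Not at h
  have h1 : (B : Set (Fin n)) ⊆ {p | ¬ Correct fp p} := fun p hp => h p hp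
  have h2 := Set.ncard_le_ncard h1
  rw [Set.ncard_coe_finset, show {p | ¬ Correct fp p}.ncard = f from hfp] at h2
  omega

end FailurePatterns

/-! ### Choices made by the seeds -/

/-- Seeds can encode the choice among finitely or countably many behaviours. -/
theorem exists_surjective_seed (S : Type) [Infinite S] (α : Type) [Countable α] [Nonempty α] :
    ∃ g : S → α, Function.Surjective g := by
  obtain ⟨f, hf⟩ := exists_surjective_nat α
  exact ⟨f ∘ Function.invFun (Infinite.natEmbedding S),
    hf.comp (Function.invFun_surjective (Infinite.natEmbedding S).injective)⟩

/-- An algorithm that outputs both values if a correct process has a seed satisfying `g` and nothing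
if no seed satisfies `g`, and that cannot do anything else, implements `{∅, {0, 1}}`, and `{{0, 1}}`
if every seed satisfies `g`. -/
theorem implements_both_of_seed {n : ℕ} {I S : Type} {σ : Timing} {t : ℕ} {A : Algorithm n I S} {g : S → Bool}
    (htn : t < n) (hCDP : ∀ Vin sd fp, (CDP A Vin sd fp σ).Nonempty)
    (hsafe : ∀ f ≤ t, ∀ Vin sd, ∀ fp ∈ FP n f, ∀ cdp ∈ CDP A Vin sd fp σ, ∃ Vout,
      IsOutputVector A Vin sd fp σ cdp Vout ∧ (OS Vout = ∅ ∨ OS Vout = {0, 1}) ∧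
      ((∃ p, Correct fp p ∧ g (sd p) = true) → OS Vout = {0, 1}) ∧
      ((∀ p, g (sd p) = false) → OS Vout = ∅)) :
    (Function.Surjective g → Implements A t σ {∅, {0, 1}}) ∧
    (S → (∀ s, g s = true) → Implements A t σ {{0, 1}}) := by
  constructor
  · intro hg
    refine ⟨Set.insert_nonempty _ _, ?_, ?_⟩
    · intro f hf Vin sd fp hfp cdp hcdp
      obtain ⟨Vout, h1, h2, -⟩ := hsafe f hf Vin sd fp hfp cdp hcdp
      exact ⟨Vout, h1, h2⟩
    · intro f hf o ho
      obtain ⟨fp, hfp, -⟩ := exists_mem_FP (n := n) (f := f) (by omega) 0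
      obtain ⟨p, -, hp⟩ := exists_correct_mem hfp hf (B := Finset.univ) (by simpa using htn)
      rcases ho with rfl | ho
      · obtain ⟨s, hs⟩ := hg false
        obtain ⟨cdp, hcdp⟩ := hCDP (fun _ => none) (fun _ => s) fp
        obtain ⟨Vout, h1, -, -, h4⟩ := hsafe f hf _ _ fp hfp cdp hcdp
        exact ⟨_, _, fp, hfp, cdp, hcdp, Vout, h1, h4 fun _ => hs⟩
      · obtain rfl := Set.mem_singleton_iff.1 ho
        obtain ⟨s, hs⟩ := hg true
        obtain ⟨cdp, hcdp⟩ := hCDP (fun _ => none) (fun _ => s) fp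
        obtain ⟨Vout, h1, -, h3, -⟩ := hsafe f hf _ _ fp hfp cdp hcdp
        exact ⟨_, _, fp, hfp, cdp, hcdp, Vout, h1, h3 ⟨p, hp, hs⟩⟩
  · intro s₀ hg
    have main : ∀ f ≤ t, ∀ Vin sd, ∀ fp ∈ FP n f, ∀ cdp ∈ CDP A Vin sd fp σ, ∃ Vout,
        IsOutputVector A Vin sd fp σ cdp Vout ∧ OS Vout = {0, 1} := by
      intro f hf Vin sd fp hfp cdp hcdp
      obtain ⟨p, -, hp⟩ := exists_correct_mem hfp hf (B := Finset.univ) (by simpa using htn)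
      obtain ⟨Vout, h1, -, h3, -⟩ := hsafe f hf Vin sd fp hfp cdp hcdp
      exact ⟨Vout, h1, h3 ⟨p, hp, hg _⟩⟩
    refine ⟨Set.singleton_nonempty _, main, ?_⟩
    intro f hf o ho
    obtain rfl := Set.mem_singleton_iff.1 ho
    obtain ⟨fp, hfp, -⟩ := exists_mem_FP (n := n) (f := f) (by omega) 0
    obtain ⟨cdp, hcdp⟩ := hCDP (fun _ => none) (fun _ => s₀) fp
    obtain ⟨Vout, h1, h2⟩ := main f hf _ _ fp hfp cdp hcdp
    exact ⟨_, _, fp, hfp, cdp, hcdp, Vout, h1, h2⟩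

/-! ### Synchronous algorithms -/

theorem ite_zero_one_eq {P : Prop} [Decidable P] {v : Fin 2} :
    (if P then 0 else 1) = v ↔ (v = 0 ↔ P) := by
  by_cases h : P
  · simp only [h, if_true, iff_true]
    exact eq_comm
  · simp only [h, if_false, iff_false]
    omega

theorem ite_one_zero_eq {P : Prop} [Decidable P] {v : Fin 2} :
    (if P then 1 else 0) = v ↔ (v = 1 ↔ P) := by
  by_cases h : P
  · simp only [h, if_true, iff_true]
    exact eq_comm
  · simp only [h, if_false, iff_false]
    omega

open Classical in
theorem syncState_succ {n : ℕ} {I S : Type} (A : Algorithm n I S) (Vin : Fin n → Option I)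
    (sd : Fin n → S) {fp : FailurePattern n} {R : ℕ} {p : Fin n}
    (h : ((2 * R + 1 : ℕ) : ℕ∞) < fp p) : syncState A Vin sd fp (R + 1) p =
      (A.compute p (syncState A Vin sd fp R p)
        (syncObserved A fp R (syncState A Vin sd fp R))).1 := by
  rw [syncState]
  exact if_pos h

section SyncAgreement

variable {n : ℕ} {I S : Type}

open Classical in
/-- In round 0, each process communicates the value given by its seed, and outputs the least value
that it observes. -/
noncomputable abbrev leastValue (n : ℕ) (I : Type) {S : Type} (g : S → Fin 2) : Algorithm n I S where
  State := Option (Fin 2)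
  Msg := Fin 2
  init _ _ s := some (g s)
  message _ st := st
  compute _ st M := (none, st.map fun _ => if 0 ∈ M then 0 else 1)

theorem syncOutputs_leastValue (g : S → Fin 2) (Vin : Fin n → Option I) (sd : Fin n → S)
    (fp : FailurePattern n) (p : Fin n) (v : Fin 2) :
    SyncOutputs (leastValue n I g) Vin sd fp p v ↔
      1 < fp p ∧ (v = 0 ↔ ∃ q, 0 < fp q ∧ g (sd q) = 0) := by
  classical
  have h0 : ((0 : Fin 2) ∈ syncObserved (leastValue n I g) fp 0
      (syncState (leastValue n I g) Vin sd fp 0)) ↔ ∃ q, 0 < fp q ∧ g (sd q) = 0 := by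
    simp [syncObserved, syncState, leastValue]
  constructor
  · rintro ⟨R, hR, h⟩
    cases R with
    | zero =>
      refine ⟨by simpa using hR, ?_⟩
      rw [← h0]
      exact ite_zero_one_eq.1 (Option.some.inj h)
    | succ R =>
      have h1 : ((2 * R + 1 : ℕ) : ℕ∞) < fp p := lt_of_le_of_lt (by
        exact_mod_cast (by omega : 2 * R + 1 ≤ 2 * (R + 1) + 1)) hR
      have h2 : syncState (leastValue n I g) Vin sd fp (R + 1) p = none := by
        rw [syncState_succ _ _ _ h1]
      rw [h2] at h
      cases h
  · rintro ⟨h1, h2⟩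
    refine ⟨0, by simpa using h1, ?_⟩
    rw [← h0] at h2
    exact congrArg some (ite_zero_one_eq.2 h2)

theorem implementable_sync_agreement [Infinite S] {t : ℕ} (h : t < n) :
    Implementable I S n t .sync {{0}, {1}} := by
  classical
  obtain ⟨g, hg⟩ := exists_surjective_seed S (Fin 2)
  have main : ∀ f ≤ t, ∀ (Vin : Fin n → Option I) (sd : Fin n → S), ∀ fp ∈ FP n f, ∃ Vout,
      IsOutputVector (leastValue n I g) Vin sd fp .sync () Vout ∧
      OS Vout = {if ∃ q, 0 < fp q ∧ g (sd q) = 0 then 0 else 1} := by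
    intro f hf Vin sd fp hfp
    obtain ⟨p, -, hp⟩ := exists_correct_mem hfp hf (B := Finset.univ) (by simpa using h)
    refine ⟨fun p => if 1 < fp p then some (if ∃ q, 0 < fp q ∧ g (sd q) = 0 then 0 else 1)
      else none, fun p v => ?_, ?_⟩
    · refine Iff.trans ?_ (syncOutputs_leastValue g Vin sd fp p v).symm
      by_cases h1 : 1 < fp p
      · simp only [h1, if_true, Option.some.injEq, true_and, ite_zero_one_eq]
      · simp [h1]
    · ext v
      simp only [OS, Set.mem_ofPred_eq, Set.mem_singleton_iff]
      constructor
      · rintro ⟨q, hq⟩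
        by_cases h1 : 1 < fp q
        · rw [if_pos h1] at hq
          exact (Option.some.inj hq).symm
        · rw [if_neg h1] at hq
          cases hq
      · rintro rfl
        refine ⟨p, ?_⟩
        rw [if_pos]
        rw [hp]
        exact ENat.one_lt_top
  refine ⟨leastValue n I g, Set.insert_nonempty _ _, ?_, ?_⟩
  · intro f hf Vin sd fp hfp cdp _
    obtain ⟨Vout, h1, h2⟩ := main f hf Vin sd fp hfp
    refine ⟨Vout, h1, ?_⟩
    rw [h2]
    split_ifs <;> simp
  · intro f hf o ho
    obtain ⟨fp, hfp, -⟩ := exists_mem_FP (n := n) (f := f) (by omega) 0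
    obtain ⟨p, -, hp⟩ := exists_correct_mem hfp hf (B := Finset.univ) (by simpa using h)
    obtain ⟨v, rfl⟩ : ∃ v : Fin 2, o = {v} := by
      rcases ho with h | h
      · exact ⟨0, h⟩
      · exact ⟨1, h⟩
    obtain ⟨s, hs⟩ := hg v
    obtain ⟨Vout, h1, h2⟩ := main f hf (fun _ => none) (fun _ => s) fp hfp
    refine ⟨fun _ => none, fun _ => s, fp, hfp, (), Set.mem_univ _, Vout, h1, ?_⟩
    rw [h2, hs]
    have h3 : ∃ q, 0 < fp q := ⟨p, by rw [hp]; exact ENat.top_pos⟩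
    rcases (show v = 0 ∨ v = 1 by omega) with rfl | rfl <;> simp [h3]

end SyncAgreement

section SyncBoth

variable {n : ℕ} {I S : Type}

open Classical in
/-- In round 0, each process whose seed satisfies `g` asks for an output; as all processes observe
the same, they agree on whether somebody has asked. If so, each process `p` has its turn in round
`p + 1`: it outputs 1 if it observes that somebody has output a value, and 0 otherwise. The
processes that have made their output say so in all later rounds. A state consists of the current
round and of whether somebody has asked for an output. -/
noncomputable abbrev takeTurns (n : ℕ) (I : Type) {S : Type} (g : S → Bool) : Algorithm n I S where
  State := ℕ × Bool
  Msg := Unit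
  init _ _ s := (0, g s)
  message p st := if st.2 = true ∧ (st.1 = 0 ∨ p.val + 1 < st.1) then some () else none
  compute p st M := ((st.1 + 1, if st.1 = 0 then decide M.Nonempty else st.2),
    if st.2 = true ∧ st.1 = p.val + 1 then some (if M.Nonempty then 1 else 0) else none)

open Classical in
theorem syncState_takeTurns (g : S → Bool) (Vin : Fin n → Option I) (sd : Fin n → S)
    (fp : FailurePattern n) (R : ℕ) (p : Fin n) (h : ((2 * R + 1 : ℕ) : ℕ∞) < fp p) :
    syncState (takeTurns n I g) Vin sd fp (R + 1) p =
      (R + 1, decide (∃ q, 0 < fp q ∧ g (sd q) = true)) := by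
  induction R with
  | zero =>
    rw [syncState_succ _ _ _ h]
    simp only [takeTurns, syncState, syncObserved, if_true, Prod.mk.injEq, true_and]
    congr 1
    apply propext
    constructor
    · rintro ⟨m, q, h1, h2⟩
      refine ⟨q, by simpa using h1, ?_⟩
      by_contra h3
      simp [h3] at h2
    · rintro ⟨q, h1, h2⟩
      exact ⟨(), q, by simpa using h1, by simp [h2]⟩
  | succ R ih =>
    have h1 : ((2 * R + 1 : ℕ) : ℕ∞) < fp p := lt_of_le_of_lt (by
      exact_mod_cast (by omega : 2 * R + 1 ≤ 2 * (R + 1) + 1)) h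
    rw [syncState_succ _ _ _ h, ih h1]
    simp [takeTurns]

theorem syncOutputs_takeTurns (g : S → Bool) (Vin : Fin n → Option I) (sd : Fin n → S)
    (fp : FailurePattern n) (p : Fin n) (v : Fin 2) :
    SyncOutputs (takeTurns n I g) Vin sd fp p v ↔
      (∃ q, 0 < fp q ∧ g (sd q) = true) ∧ ((2 * (p.val + 1) + 1 : ℕ) : ℕ∞) < fp p ∧
      (v = 1 ↔ ∃ q, q < p ∧ ((2 * (p.val + 1) : ℕ) : ℕ∞) < fp q) := by
  classical
  -- What is observed in a round after round 0, in terms of the failure pattern.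
  have hobs : ∀ R, (∃ q, 0 < fp q ∧ g (sd q) = true) →
      ((syncObserved (takeTurns n I g) fp (R + 1)
        (syncState (takeTurns n I g) Vin sd fp (R + 1))).Nonempty ↔
      ∃ q : Fin n, q.val < R ∧ ((2 * (R + 1) : ℕ) : ℕ∞) < fp q) := by
    intro R hG
    have hst : ∀ q, ((2 * (R + 1) : ℕ) : ℕ∞) < fp q →
        syncState (takeTurns n I g) Vin sd fp (R + 1) q = (R + 1, true) := by
      intro q hq
      rw [syncState_takeTurns g Vin sd fp R q (lt_of_le_of_lt (by
        exact_mod_cast (by omega : 2 * R + 1 ≤ 2 * (R + 1))) hq)]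
      simp [hG]
    constructor
    · rintro ⟨m, q, h1, h2⟩
      refine ⟨q, ?_, h1⟩
      rw [hst q h1] at h2
      by_contra h3
      simp [takeTurns, h3] at h2
    · rintro ⟨q, h1, h2⟩
      refine ⟨(), q, h2, ?_⟩
      rw [hst q h2]
      simp [takeTurns, h1]
  constructor
  · rintro ⟨R, hR, h⟩
    cases R with
    | zero => simp [syncState] at h
    | succ R =>
      rw [syncState_takeTurns g Vin sd fp R p (lt_of_le_of_lt (by
        exact_mod_cast (by omega : 2 * R + 1 ≤ 2 * (R + 1) + 1)) hR)] at h
      have h1 : decide (∃ q, 0 < fp q ∧ g (sd q) = true) = true ∧ R + 1 = p.val + 1 := by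
        by_contra h1
        have h2 : none = some v := by
          rw [← h]
          exact (if_neg h1).symm
        cases h2
      have h : some (if (syncObserved (takeTurns n I g) fp (R + 1)
          (syncState (takeTurns n I g) Vin sd fp (R + 1))).Nonempty then (1 : Fin 2) else 0) =
          some v := by
        rw [← h]
        exact (if_pos h1).symm
      obtain ⟨hG, h1⟩ := h1
      have hG' := of_decide_eq_true hG
      obtain rfl : R = p.val := by omega
      exact ⟨hG', hR, (ite_one_zero_eq.1 (Option.some.inj h)).trans (hobs _ hG')⟩
  · rintro ⟨hG, hR, h⟩
    refine ⟨p.val + 1, hR, ?_⟩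
    rw [syncState_takeTurns g Vin sd fp p.val p (lt_of_le_of_lt (by
        exact_mod_cast (by omega : 2 * p.val + 1 ≤ 2 * (p.val + 1) + 1)) hR)]
    refine (if_pos ⟨decide_eq_true hG, rfl⟩).trans (congrArg some (ite_one_zero_eq.2 ?_))
    exact h.trans (hobs p.val hG).symm

open Classical in
/-- The output set of `takeTurns`: both values if somebody has asked for an output. -/
theorem isOutputVector_takeTurns (g : S → Bool) {t f : ℕ} (h : t + 2 ≤ n) (hf : f ≤ t)
    (Vin : Fin n → Option I) (sd : Fin n → S) {fp : FailurePattern n} (hfp : fp ∈ FP n f) :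
    ∃ Vout, IsOutputVector (takeTurns n I g) Vin sd fp .sync () Vout ∧
      OS Vout = if ∃ q, 0 < fp q ∧ g (sd q) = true then {0, 1} else ∅ := by
  set G : Prop := ∃ q, 0 < fp q ∧ g (sd q) = true with hG
  let late : Fin n → Prop := fun p => ∃ q, q < p ∧ ((2 * (p.val + 1) : ℕ) : ℕ∞) < fp q
  refine ⟨fun p => if G ∧ ((2 * (p.val + 1) + 1 : ℕ) : ℕ∞) < fp p then
    some (if late p then 1 else 0) else none, fun p v => ?_, ?_⟩
  · beta_reduce
    refine Iff.trans ?_ (syncOutputs_takeTurns g Vin sd fp p v).symm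
    rw [← and_assoc]
    by_cases h1 : G ∧ ((2 * (p.val + 1) + 1 : ℕ) : ℕ∞) < fp p
    · rw [if_pos h1, Option.some.injEq, ite_one_zero_eq]
      exact (and_iff_right h1).symm
    · rw [if_neg h1]
      exact ⟨nofun, fun h => absurd h.1 h1⟩
  · split_ifs with hg
    · have hturn : ∀ p, Correct fp p → ((2 * (p.val + 1) + 1 : ℕ) : ℕ∞) < fp p := by
        intro p hp
        rw [hp]
        exact ENat.natCast_lt_top _
      obtain ⟨p, -, hp⟩ := exists_correct_mem hfp hf (B := Finset.univ)
        (by rw [Finset.card_univ, Fintype.card_fin]; omega)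
      obtain ⟨q, hq, hqc⟩ := exists_correct_mem hfp hf (B := Finset.univ.erase p)
        (by rw [Finset.card_erase_of_mem (Finset.mem_univ p), Finset.card_univ,
              Fintype.card_fin]; omega)
      have hpq : q ≠ p := Finset.ne_of_mem_erase hq
      -- The second of two correct processes outputs 1.
      have h1 : (1 : Fin 2) ∈ OS fun p => if G ∧ ((2 * (p.val + 1) + 1 : ℕ) : ℕ∞) < fp p then
          some (if late p then (1 : Fin 2) else 0) else none := by
        rcases lt_or_gt_of_ne hpq with hlt | hlt
        · refine ⟨p, ?_⟩
          beta_reduce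
          rw [if_pos ⟨hg, hturn p hp⟩, if_pos]
          exact ⟨q, hlt, by rw [hqc]; exact ENat.natCast_lt_top _⟩
        · refine ⟨q, ?_⟩
          beta_reduce
          rw [if_pos ⟨hg, hturn q hqc⟩, if_pos]
          exact ⟨p, hlt, by rw [hp]; exact ENat.natCast_lt_top _⟩
      -- The first process that makes an output outputs 0.
      have h0 : (0 : Fin 2) ∈ OS fun p => if G ∧ ((2 * (p.val + 1) + 1 : ℕ) : ℕ∞) < fp p then
          some (if late p then (1 : Fin 2) else 0) else none := by
        have hne : (Finset.univ.filter fun p : Fin n =>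
            ((2 * (p.val + 1) + 1 : ℕ) : ℕ∞) < fp p).Nonempty := ⟨p, by simpa using hturn p hp⟩
        have hmem := Finset.min'_mem _ hne
        set r := Finset.min' _ hne with hr
        rw [Finset.mem_filter] at hmem
        refine ⟨r, ?_⟩
        beta_reduce
        rw [if_pos ⟨hg, hmem.2⟩, if_neg]
        rintro ⟨q, hq, hq'⟩
        have hle : r ≤ q := Finset.min'_le _ q (by
          rw [Finset.mem_filter]
          refine ⟨Finset.mem_univ q, lt_of_le_of_lt ?_ hq'⟩
          have : q.val < r.val := hq
          exact_mod_cast (by omega : 2 * (q.val + 1) + 1 ≤ 2 * (r.val + 1)))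
        exact absurd hq (not_lt.2 hle)
      ext v
      rcases (show v = 0 ∨ v = 1 by omega) with rfl | rfl
      · simp only [h0, Set.mem_insert_iff, true_or]
      · simp only [h1, Set.mem_insert_iff, Set.mem_singleton_iff, or_true]
    · ext v
      have hG' : ¬ G := hg
      simp [OS, hG']

theorem implementable_sync_both [Infinite S] {t : ℕ} (h : t + 2 ≤ n) :
    Implementable I S n t .sync {∅, {0, 1}} ∧ Implementable I S n t .sync {{0, 1}} := by
  classical
  have main : ∀ g : S → Bool, _ := fun g => implements_both_of_seed (σ := .sync) (t := t)
    (A := takeTurns n I g) (g := g) (by omega) (fun _ _ _ => ⟨(), Set.mem_univ _⟩)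
    (fun f hf Vin sd fp hfp cdp _ => by
      obtain ⟨Vout, h1, h2⟩ := isOutputVector_takeTurns g h hf Vin sd hfp
      refine ⟨Vout, h1, ?_, ?_, ?_⟩
      · rw [h2]
        split_ifs <;> simp
      · rintro ⟨p, hp, hgp⟩
        rw [h2, if_pos ⟨p, by rw [hp]; exact ENat.top_pos, hgp⟩]
      · intro hg
        rw [h2, if_neg]
        rintro ⟨q, -, hq⟩
        rw [hg q] at hq
        cases hq)
  obtain ⟨g, hg⟩ := exists_surjective_seed S Bool
  obtain ⟨s₀⟩ : Nonempty S := inferInstance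
  exact ⟨⟨_, (main g).1 hg⟩, ⟨_, (main fun _ => true).2 s₀ fun _ => rfl⟩⟩

end SyncBoth

/-! ### The asynchronous algorithm that outputs both values -/

section ThreeGroups

variable {n : ℕ} {I S : Type}

open Classical in
/-- What a process that has made no output yet outputs when it observes `M`. The message `none` asks
for an output, and `some v` says that the value `v` was output. A process `p` with
`role p = some v` outputs `v` when it is asked to, and a process without such a role outputs the
opposite of a value that it knows to be output. -/
noncomputable def react (role : Fin n → Option (Fin 2)) (p : Fin n) (M : Set (Option (Fin 2))) :
    Option (Fin 2) :=
  match role p with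
  | some v => if none ∈ M then some v else none
  | none => if some 0 ∈ M then some 1 else if some 1 ∈ M then some 0 else none

/-- The algorithm in which each process makes the output determined by `react`, asks for an output
if its seed satisfies `g`, and says what it has output if it has a role. A state consists of whether
the process asks for an output and of whether it has made its output. -/
noncomputable abbrev threeGroups (I : Type) (role : Fin n → Option (Fin 2)) (g : S → Bool) :
    Algorithm n I S where
  State := Bool × Bool
  Msg := Option (Fin 2)
  init _ _ s := (g s, false)
  message p st := if st.2 = true ∧ role p ≠ none then some (role p)
    else if st.1 = true then some none else none
  compute p st M := if st.2 = true then (st, none)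
    else ((st.1, (react role p M).isSome), react role p M)

variable {role : Fin n → Option (Fin 2)} {g : S → Bool} {Vin : Fin n → Option I} {sd : Fin n → S}
  {fp : FailurePattern n} {c : AsyncPattern n}

theorem threeGroups_state (role : Fin n → Option (Fin 2)) (g : S → Bool) (Vin : Fin n → Option I)
    (sd : Fin n → S) (fp : FailurePattern n) (c : AsyncPattern n) (τ : ℕ) (p : Fin n) :
    ((asyncRun (threeGroups I role g) Vin sd fp c τ).state p).1 = g (sd p) ∧
    (((asyncRun (threeGroups I role g) Vin sd fp c τ).state p).2 = true ↔
      ∃ τ' < τ, ∃ v, OutputsAt (threeGroups I role g) Vin sd fp c p τ' v) := by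
  induction τ with
  | zero => exact ⟨rfl, fun h => absurd h (by simp [asyncRun]), by rintro ⟨τ', h, _⟩; omega⟩
  | succ τ ih =>
    have hsucc : (∃ τ' < τ + 1, ∃ v, OutputsAt (threeGroups I role g) Vin sd fp c p τ' v) ↔
        (∃ τ' < τ, ∃ v, OutputsAt (threeGroups I role g) Vin sd fp c p τ' v) ∨
        ∃ v, OutputsAt (threeGroups I role g) Vin sd fp c p τ v := by
      constructor
      · rintro ⟨τ', h, h'⟩
        rcases (show τ' < τ ∨ τ' = τ by omega) with h1 | rfl
        · exact Or.inl ⟨τ', h1, h'⟩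
        · exact Or.inr h'
      · rintro (⟨τ', h, h'⟩ | h)
        · exact ⟨τ', by omega, h'⟩
        · exact ⟨τ, by omega, h⟩
    rw [hsucc, ← ih.2]
    by_cases hs : TakesStep fp c p τ
    · rw [(state_succ Vin sd fp c τ p).1 hs]
      unfold OutputsAt stepOut
      generalize asyncObserved (threeGroups I role g) c τ
        (asyncRun (threeGroups I role g) Vin sd fp c τ) p = M
      generalize (asyncRun (threeGroups I role g) Vin sd fp c τ).state p = st at ih
      by_cases h2 : st.2 = true
      · simp only [h2, if_true]
        exact ⟨ih.1, by simp⟩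
      · simp only [h2, hs, true_and]
        refine ⟨ih.1, ?_⟩
        simp [Option.isSome_iff_exists]
    · rw [(state_succ Vin sd fp c τ p).2 hs]
      refine ⟨ih.1, ?_⟩
      simp [OutputsAt, hs]

/-- A process makes an output in a step if and only if it has made none before and reacts. -/
theorem threeGroups_outputsAt {p : Fin n} {τ : ℕ} {v : Fin 2} :
    OutputsAt (threeGroups I role g) Vin sd fp c p τ v ↔ TakesStep fp c p τ ∧
      (∀ τ' < τ, ∀ v', ¬ OutputsAt (threeGroups I role g) Vin sd fp c p τ' v') ∧
      react role p (asyncObserved (threeGroups I role g) c τ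
        (asyncRun (threeGroups I role g) Vin sd fp c τ) p) = some v := by
  have h := (threeGroups_state role g Vin sd fp c τ p).2
  have h' : (∀ τ' < τ, ∀ v', ¬ OutputsAt (threeGroups I role g) Vin sd fp c p τ' v') ↔
      ¬ ((asyncRun (threeGroups I role g) Vin sd fp c τ).state p).2 = true := by
    rw [h]
    push Not
    rfl
  rw [h']
  conv_lhs => unfold OutputsAt stepOut
  refine and_congr_right fun _ => ?_
  generalize (asyncRun (threeGroups I role g) Vin sd fp c τ).state p = st
  by_cases h2 : st.2 = true
  · simp [h2]
  · simp [h2]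

theorem threeGroups_unique {p : Fin n} {τ τ' : ℕ} {v v' : Fin 2}
    (h : OutputsAt (threeGroups I role g) Vin sd fp c p τ v)
    (h' : OutputsAt (threeGroups I role g) Vin sd fp c p τ' v') : v = v' := by
  rcases lt_trichotomy τ τ' with h1 | rfl | h1
  · exact absurd h ((threeGroups_outputsAt.1 h').2.1 τ h1 v)
  · have := h.2.symm.trans h'.2
    exact Option.some.inj this
  · exact absurd h' ((threeGroups_outputsAt.1 h).2.1 τ' h1 v')

theorem react_role {p : Fin n} {M : Set (Option (Fin 2))} {v w : Fin 2} (hp : role p = some w) :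
    react role p M = some v ↔ none ∈ M ∧ v = w := by
  unfold react
  rw [hp]
  by_cases h : none ∈ M
  · simp [h, eq_comm]
  · simp [h]

theorem react_no_role {p : Fin n} {M : Set (Option (Fin 2))} {v : Fin 2} (hp : role p = none)
    (h : react role p M = some v) : some (v + 1) ∈ M := by
  unfold react at h
  rw [hp] at h
  simp only at h
  split_ifs at h with h1 h2
  · obtain rfl := Option.some.inj h
    exact h1
  · obtain rfl := Option.some.inj h
    exact h2

theorem exists_react_no_role {p : Fin n} {M : Set (Option (Fin 2))} {v : Fin 2}
    (hp : role p = none) (h : some v ∈ M) : ∃ w, react role p M = some w := by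
  unfold react
  rw [hp]
  simp only
  by_cases h0 : some 0 ∈ M
  · exact ⟨1, by simp [h0]⟩
  · rcases (show v = 0 ∨ v = 1 by omega) with rfl | rfl
    · exact absurd h h0
    · exact ⟨0, by simp [h0, h]⟩

/-- A process that steps and reacts has made an output by then. -/
theorem threeGroups_exists_output {p : Fin n} {τ : ℕ} (hs : TakesStep fp c p τ)
    (h : ∃ v, react role p (asyncObserved (threeGroups I role g) c τ
      (asyncRun (threeGroups I role g) Vin sd fp c τ) p) = some v) :
    ∃ τ v, OutputsAt (threeGroups I role g) Vin sd fp c p τ v := by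
  by_contra hcon
  push Not at hcon
  obtain ⟨v, hv⟩ := h
  exact hcon τ v (threeGroups_outputsAt.2 ⟨hs, fun τ' _ v' => hcon τ' v', hv⟩)

theorem threeGroups_output_role {p : Fin n} {τ : ℕ} {v w : Fin 2} (hp : role p = some w)
    (h : OutputsAt (threeGroups I role g) Vin sd fp c p τ v) : v = w :=
  ((react_role hp).1 (threeGroups_outputsAt.1 h).2.2).2

theorem threeGroups_communicates_some {p : Fin n} {s : ℕ} {v : Fin 2}
    (h : Communicates (threeGroups I role g) Vin sd fp c p s (some v)) :
    role p = some v ∧ ∃ τ, OutputsAt (threeGroups I role g) Vin sd fp c p τ v := by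
  have h1 := (communicates_iff.1 h).2
  have h2 := (threeGroups_state role g Vin sd fp c (s + 1) p).2
  generalize (asyncRun (threeGroups I role g) Vin sd fp c (s + 1)).state p = st at h1 h2
  simp only at h1
  split_ifs at h1 with h3 h4
  · have hp := Option.some.inj h1
    obtain ⟨τ', _, v', h5⟩ := h2.1 h3.1
    have := threeGroups_output_role hp h5
    subst this
    exact ⟨hp, τ', h5⟩
  · cases Option.some.inj h1

theorem threeGroups_communicates_none {p : Fin n} {s : ℕ}
    (h : Communicates (threeGroups I role g) Vin sd fp c p s none) : g (sd p) = true := by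
  have h1 := (communicates_iff.1 h).2
  have h2 := (threeGroups_state role g Vin sd fp c (s + 1) p).1
  generalize (asyncRun (threeGroups I role g) Vin sd fp c (s + 1)).state p = st at h1 h2
  simp only at h1
  split_ifs at h1 with h3 h4
  · exact absurd (Option.some.inj h1) h3.2
  · rw [← h2, h4]

/-- Some process observes that an output is asked for. -/
def Asked (role : Fin n → Option (Fin 2)) (g : S → Bool) (Vin : Fin n → Option I) (sd : Fin n → S)
    (fp : FailurePattern n) (c : AsyncPattern n) : Prop :=
  ∃ r q s, Communicates (threeGroups I role g) Vin sd fp c q s none ∧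
    Observes (threeGroups I role g) Vin sd fp c r q s

theorem asked_of_role_output {p : Fin n} {τ : ℕ} {v w : Fin 2} (hp : role p = some w)
    (h : OutputsAt (threeGroups I role g) Vin sd fp c p τ v) : Asked role g Vin sd fp c := by
  obtain ⟨h1, _, h2⟩ := threeGroups_outputsAt.1 h
  obtain ⟨q, s, h3, h4⟩ := mem_asyncObserved.1 ((react_role hp).1 h2).1
  exact ⟨p, q, s, h3, ⟨_, h3⟩, τ, h4, h1⟩

theorem exists_opposite_output {p : Fin n} {τ : ℕ} {v : Fin 2} (hp : role p = none)
    (h : OutputsAt (threeGroups I role g) Vin sd fp c p τ v) :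
    ∃ q τ', role q = some (v + 1) ∧
      OutputsAt (threeGroups I role g) Vin sd fp c q τ' (v + 1) := by
  obtain ⟨h1, _, h2⟩ := threeGroups_outputsAt.1 h
  obtain ⟨q, s, h3, h4⟩ := mem_asyncObserved.1 (react_no_role hp h2)
  obtain ⟨h5, τ', h6⟩ := threeGroups_communicates_some h3
  exact ⟨q, τ', h5, h6⟩

theorem asked_of_output {p : Fin n} {τ : ℕ} {v : Fin 2}
    (h : OutputsAt (threeGroups I role g) Vin sd fp c p τ v) : Asked role g Vin sd fp c := by
  rcases hp : role p with _ | w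
  · obtain ⟨q, τ', h1, h2⟩ := exists_opposite_output hp h
    exact asked_of_role_output h1 h2
  · exact asked_of_role_output hp h

theorem exists_step_after (hc : AsyncAdmissible (threeGroups I role g) Vin sd fp c) {p : Fin n}
    (hp : Correct fp p) (N : ℕ) : ∃ τ, N < τ ∧ TakesStep fp c p τ := by
  obtain ⟨τ, h1, h2⟩ := (hc.fair p hp).exists_gt N
  exact ⟨τ, h2, h1, by rw [hp]; exact ENat.natCast_lt_top τ⟩

theorem asked_of_correct (hc : AsyncAdmissible (threeGroups I role g) Vin sd fp c) {p : Fin n}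
    (hp : Correct fp p) (hg : g (sd p) = true) : Asked role g Vin sd fp c := by
  obtain ⟨τ, -, hτ⟩ := exists_step_after hc hp 0
  have h1 := (threeGroups_state role g Vin sd fp c (τ + 1) p)
  by_cases h2 : ((asyncRun (threeGroups I role g) Vin sd fp c (τ + 1)).state p).2 = true
  · obtain ⟨τ', _, v, h3⟩ := h1.2.1 h2
    exact asked_of_output h3
  · have h3 : Communicates (threeGroups I role g) Vin sd fp c p τ none := by
      rw [communicates_iff]
      refine ⟨hτ, ?_⟩
      replace h1 := h1.1.trans hg
      generalize (asyncRun (threeGroups I role g) Vin sd fp c (τ + 1)).state p = st at h1 h2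
      simp [h1, h2]
    obtain ⟨q, _, h4⟩ := hc.localTermination p τ none hp h3
    exact ⟨q, p, τ, h3, h4⟩

theorem role_output_of_asked (hc : AsyncAdmissible (threeGroups I role g) Vin sd fp c)
    (h : Asked role g Vin sd fp c) {p : Fin n} (hp : Correct fp p) {v : Fin 2}
    (hrole : role p = some v) : ∃ τ, OutputsAt (threeGroups I role g) Vin sd fp c p τ v := by
  obtain ⟨r, q, s, h1, h2⟩ := h
  obtain ⟨_, τ, h3, h4⟩ := hc.globalTermination q s r h2 p hp
  obtain ⟨τ', w, h5⟩ := threeGroups_exists_output h4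
    ⟨v, (react_role hrole).2 ⟨mem_asyncObserved.2 ⟨q, s, h1, h3⟩, rfl⟩⟩
  rw [threeGroups_output_role hrole h5] at h5
  exact ⟨τ', h5⟩

theorem exists_output_of_correct (hc : AsyncAdmissible (threeGroups I role g) Vin sd fp c)
    {p q : Fin n} (hp : Correct fp p) (hq : Correct fp q) {v : Fin 2} (hrole : role p = some v)
    (hqrole : role q = none) {τ : ℕ}
    (h : OutputsAt (threeGroups I role g) Vin sd fp c p τ v) :
    ∃ τ' w, OutputsAt (threeGroups I role g) Vin sd fp c q τ' w := by
  obtain ⟨s, h1, h2⟩ := exists_step_after hc hp τ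
  have h3 : Communicates (threeGroups I role g) Vin sd fp c p s (some v) := by
    rw [communicates_iff]
    refine ⟨h2, ?_⟩
    have h4 := (threeGroups_state role g Vin sd fp c (s + 1) p).2.2 ⟨τ, by omega, v, h⟩
    generalize (asyncRun (threeGroups I role g) Vin sd fp c (s + 1)).state p = st at h4
    simp [h4, hrole]
  obtain ⟨r, _, h4⟩ := hc.localTermination p s _ hp h3
  obtain ⟨_, τ', h5, h6⟩ := hc.globalTermination p s r h4 q hq
  exact threeGroups_exists_output h6
    (exists_react_no_role hqrole (mem_asyncObserved.2 ⟨p, s, h3, h5⟩))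

/-- If more than `t` processes have a role, and for each value more than `t` processes do not have
the role of outputting it, then either nobody observes that an output is asked for, and there is no
output, or both values are output. -/
theorem isOutputVector_threeGroups {t f : ℕ} (hf : f ≤ t) (hfp : fp ∈ FP n f)
    (h0 : t < (Finset.univ.filter fun p => role p ≠ none).card)
    (h1 : ∀ v, t < (Finset.univ.filter fun p => role p ≠ some v).card)
    (hc : AsyncAdmissible (threeGroups I role g) Vin sd fp c) : ∃ Vout,
      IsOutputVector (threeGroups I role g) Vin sd fp .async c Vout ∧
      (Asked role g Vin sd fp c → OS Vout = {0, 1}) ∧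
      (¬ Asked role g Vin sd fp c → OS Vout = ∅) := by
  classical
  have hV : IsOutputVector (threeGroups I role g) Vin sd fp .async c (fun p =>
      if h : ∃ v τ, OutputsAt (threeGroups I role g) Vin sd fp c p τ v then some h.choose
      else none) := by
    intro p v
    change _ ↔ ∃ τ, OutputsAt (threeGroups I role g) Vin sd fp c p τ v
    constructor
    · intro h
      beta_reduce at h
      split_ifs at h with h2
      obtain rfl := Option.some.inj h
      exact h2.choose_spec
    · rintro ⟨τ, h⟩
      have h2 : ∃ v τ, OutputsAt (threeGroups I role g) Vin sd fp c p τ v := ⟨v, τ, h⟩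
      beta_reduce
      rw [dif_pos h2]
      obtain ⟨τ', h3⟩ := h2.choose_spec
      rw [threeGroups_unique h h3]
  refine ⟨_, hV, fun h => ?_, fun h => ?_⟩
  · set Vout := _
    have hmem : ∀ {p τ v}, OutputsAt (threeGroups I role g) Vin sd fp c p τ v → v ∈ OS Vout :=
      fun {p τ v} h => ⟨p, (hV p v).2 ⟨τ, h⟩⟩
    obtain ⟨p, hp, hpc⟩ := exists_correct_mem hfp hf h0
    obtain ⟨v, hv⟩ := Option.ne_none_iff_exists'.1 (Finset.mem_filter.1 hp).2
    obtain ⟨τ, hτ⟩ := role_output_of_asked hc h hpc hv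
    obtain ⟨q, hq, hqc⟩ := exists_correct_mem hfp hf (h1 v)
    have hboth : ∃ w, w ∈ OS Vout ∧ w + 1 ∈ OS Vout := by
      rcases hqr : role q with _ | w
      · obtain ⟨τ', w, h2⟩ := exists_output_of_correct hc hpc hqc hv hqr hτ
        obtain ⟨r, τ'', _, h3⟩ := exists_opposite_output hqr h2
        exact ⟨w, hmem h2, hmem h3⟩
      · obtain ⟨τ', h2⟩ := role_output_of_asked hc h hqc hqr
        have hne : w ≠ v := by
          rintro rfl
          exact (Finset.mem_filter.1 hq).2 hqr
        refine ⟨v, hmem hτ, ?_⟩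
        rw [show v + 1 = w by omega]
        exact hmem h2
    obtain ⟨w, h2, h3⟩ := hboth
    ext x
    refine ⟨fun _ => ?_, fun _ => ?_⟩
    · rcases (show x = 0 ∨ x = 1 by omega) with rfl | rfl <;> simp
    · rcases (show x = w ∨ x = w + 1 by omega) with rfl | rfl
      · exact h2
      · exact h3
  · ext x
    simp only [Set.mem_empty_iff_false, iff_false]
    rintro ⟨p, hp⟩
    obtain ⟨τ, hτ⟩ := (hV p x).1 hp
    exact h (asked_of_output hτ)

/-- Roles as required by `isOutputVector_threeGroups`: the two roles are assigned to `(t + 2) / 2`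
processes each. -/
theorem exists_role {t : ℕ} (h : 3 * t + 2 < 2 * n) : ∃ role : Fin n → Option (Fin 2),
    t < (Finset.univ.filter fun p => role p ≠ none).card ∧
    ∀ v, t < (Finset.univ.filter fun p => role p ≠ some v).card := by
  set a := (t + 2) / 2 with ha
  have hcard : ∀ b, b ≤ n → (Finset.univ.filter fun p : Fin n => p.val < b).card = b := by
    intro b hb
    rw [Fin.card_filter_val_lt]
    omega
  have hcompl : ∀ P : Fin n → Prop, ∀ [DecidablePred P],
      (Finset.univ.filter fun p => P p).card + (Finset.univ.filter fun p => ¬ P p).card = n := by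
    intro P _
    rw [Finset.card_filter_add_card_filter_not, Finset.card_univ, Fintype.card_fin]
  set role : Fin n → Option (Fin 2) := fun p =>
    if p.val < a then some 0 else if p.val < 2 * a then some 1 else none with hrole
  have hne : ∀ p : Fin n, role p ≠ none ↔ p.val < 2 * a := by
    intro p
    simp only [hrole]
    split_ifs <;> simp <;> omega
  have hne0 : ∀ p : Fin n, role p ≠ some 0 ↔ ¬ p.val < a := by
    intro p
    simp only [hrole]
    split_ifs <;> simp <;> omega
  refine ⟨role, ?_, fun v => ?_⟩
  · simp only [hne]
    rw [hcard _ (by omega)]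
    omega
  · rcases (show v = 0 ∨ v = 1 by omega) with rfl | rfl
    · simp only [hne0]
      have h1 := hcompl fun p => p.val < a
      rw [hcard _ (by omega)] at h1
      omega
    · have h1 := hcompl fun p => role p = some 1
      have h2 : (Finset.univ.filter fun p => role p = some 1) ⊆
          (Finset.univ.filter fun p : Fin n => p.val < 2 * a) \
            (Finset.univ.filter fun p : Fin n => p.val < a) := by
        intro p
        simp only [hrole, Finset.mem_filter, Finset.mem_univ, true_and, Finset.mem_sdiff]
        split_ifs <;> simp
        omega
      have h3 := Finset.card_le_card h2
      rw [Finset.card_sdiff_of_subset (fun p => by simp; omega), hcard _ (by omega),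
        hcard _ (by omega)] at h3
      simp only [ne_eq]
      omega

theorem implementable_async_both [Infinite S] {t : ℕ} (h : 3 * t + 2 < 2 * n) :
    Implementable I S n t .async {∅, {0, 1}} ∧ Implementable I S n t .async {{0, 1}} := by
  classical
  obtain ⟨role, h0, h1⟩ := exists_role h
  have main : ∀ g : S → Bool, _ := fun g => implements_both_of_seed (σ := .async) (t := t)
    (A := threeGroups I role g) (g := g) (by omega)
    (fun Vin sd fp => ⟨lockStep n, (lockStep_steady n).admissible _ _ _⟩)
    (fun f hf Vin sd fp hfp c hc => by
      obtain ⟨Vout, h2, h3, h4⟩ := isOutputVector_threeGroups hf hfp h0 h1 hc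
      refine ⟨Vout, h2, ?_, ?_, ?_⟩
      · by_cases h5 : Asked role g Vin sd fp c
        · exact Or.inr (h3 h5)
        · exact Or.inl (h4 h5)
      · rintro ⟨p, hp, hgp⟩
        exact h3 (asked_of_correct hc hp hgp)
      · intro hg
        refine h4 ?_
        rintro ⟨r, q, s, h5, _⟩
        have := threeGroups_communicates_none h5
        rw [hg q] at this
        cases this)
  obtain ⟨g, hg⟩ := exists_surjective_seed S Bool
  obtain ⟨s₀⟩ : Nonempty S := inferInstance
  exact ⟨⟨_, (main g).1 hg⟩, ⟨_, (main fun _ => true).2 s₀ fun _ => rfl⟩⟩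

end ThreeGroups

/-! ### Algorithms with at most one output per process and one causal dependency -/

section TwoPhase

variable {n : ℕ} {I S : Type}

open Classical in
/-- In the algorithm `twoPhase I late out`, each process makes its output, if any, in one step: an
early process in its first step, and a late one in its second step. An early process that has made
an output says so. The output of `p` is given by `out` in terms of its seed and of whether `p` is
late and observes in its output step that some early process has made an output. A state consists of
the seed and of the number of steps taken. -/
noncomputable abbrev twoPhase (I : Type) (late : Fin n → Bool)
    (out : Fin n → S → Bool → Option (Fin 2)) : Algorithm n I S where
  State := S × ℕ
  Msg := Unit
  init _ _ s := (s, 0)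
  message p st := if st.2 = 1 ∧ late p = false ∧ out p st.1 false ≠ none then some () else none
  compute p st M := ((st.1, st.2 + 1),
    if st.2 = (late p).toNat then out p st.1 (late p && decide M.Nonempty) else none)

variable {late : Fin n → Bool} {out : Fin n → S → Bool → Option (Fin 2)} {Vin : Fin n → Option I}
  {sd : Fin n → S} {fp : FailurePattern n}

theorem twoPhase_syncState {R : ℕ} {p : Fin n} (h : ((2 * R : ℕ) : ℕ∞) < fp p) :
    syncState (twoPhase I late out) Vin sd fp R p = (sd p, R) := by
  induction R with
  | zero => rfl
  | succ R ih =>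
    have h1 : ((2 * R + 1 : ℕ) : ℕ∞) < fp p := lt_of_le_of_lt (by
      exact_mod_cast (by omega : 2 * R + 1 ≤ 2 * (R + 1))) h
    have h2 : ((2 * R : ℕ) : ℕ∞) < fp p := lt_of_le_of_lt (by
      exact_mod_cast (by omega : 2 * R ≤ 2 * R + 1)) h1
    rw [syncState_succ _ _ _ h1, ih h2]

open Classical in
theorem twoPhase_syncOutputs {p : Fin n} {v : Fin 2} :
    SyncOutputs (twoPhase I late out) Vin sd fp p v ↔
      ((2 * (late p).toNat + 1 : ℕ) : ℕ∞) < fp p ∧ out p (sd p) (late p &&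
        decide (∃ r, 2 < fp r ∧ late r = false ∧ out r (sd r) false ≠ none)) = some v := by
  have hobs : late p = true → ((syncObserved (twoPhase I late out) fp 1
      (syncState (twoPhase I late out) Vin sd fp 1)).Nonempty ↔
      ∃ r, 2 < fp r ∧ late r = false ∧ out r (sd r) false ≠ none) := by
    intro _
    constructor
    · rintro ⟨m, r, h1, h2⟩
      rw [twoPhase_syncState h1] at h2
      refine ⟨r, by simpa using h1, ?_⟩
      by_contra h3
      simp [h3] at h2
    · rintro ⟨r, h1, h2⟩
      have h1' : ((2 * 1 : ℕ) : ℕ∞) < fp r := by simpa using h1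
      refine ⟨(), r, h1', ?_⟩
      rw [twoPhase_syncState h1']
      simp [h2]
  have hstep : ∀ R, ((2 * R + 1 : ℕ) : ℕ∞) < fp p →
      ((twoPhase I late out).compute p (syncState (twoPhase I late out) Vin sd fp R p)
        (syncObserved (twoPhase I late out) fp R
          (syncState (twoPhase I late out) Vin sd fp R))).2 =
      if R = (late p).toNat then out p (sd p) (late p &&
        decide (∃ r, 2 < fp r ∧ late r = false ∧ out r (sd r) false ≠ none)) else none := by
    intro R hR
    rw [twoPhase_syncState (lt_of_le_of_lt (by
      exact_mod_cast (by omega : 2 * R ≤ 2 * R + 1)) hR)]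
    rcases hl : late p with _ | _
    · simp only [hl, Bool.false_and]
    · have h := hobs hl
      by_cases hR1 : R = 1
      · subst hR1
        simp only [hl, Bool.true_and, Bool.toNat_true, if_true, h]
      · simp [hl, hR1]
  constructor
  · rintro ⟨R, hR, h⟩
    rw [hstep R hR] at h
    split_ifs at h with h1
    subst h1
    exact ⟨hR, h⟩
  · rintro ⟨hR, h⟩
    refine ⟨_, hR, ?_⟩
    rw [hstep _ hR, if_pos rfl]
    exact h

variable {c : AsyncPattern n}

theorem twoPhase_state_succ (τ : ℕ) (p : Fin n) :
    ((asyncRun (twoPhase I late out) Vin sd fp c τ).state p).1 = sd p ∧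
    (TakesStep fp c p τ → ((asyncRun (twoPhase I late out) Vin sd fp c (τ + 1)).state p).2 =
      ((asyncRun (twoPhase I late out) Vin sd fp c τ).state p).2 + 1) ∧
    (¬ TakesStep fp c p τ → ((asyncRun (twoPhase I late out) Vin sd fp c (τ + 1)).state p).2 =
      ((asyncRun (twoPhase I late out) Vin sd fp c τ).state p).2) := by
  refine ⟨?_, fun h => by rw [(state_succ Vin sd fp c τ p).1 h],
    fun h => by rw [(state_succ Vin sd fp c τ p).2 h]⟩
  induction τ with
  | zero => rfl
  | succ τ ih =>
    by_cases h : TakesStep fp c p τ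
    · rw [(state_succ Vin sd fp c τ p).1 h]; exact ih
    · rw [(state_succ Vin sd fp c τ p).2 h]; exact ih

theorem twoPhase_count_mono {p : Fin n} {τ τ' : ℕ} (h : τ ≤ τ') :
    ((asyncRun (twoPhase I late out) Vin sd fp c τ).state p).2 ≤
      ((asyncRun (twoPhase I late out) Vin sd fp c τ').state p).2 := by
  induction τ', h using Nat.le_induction with
  | base => exact le_rfl
  | succ τ' h ih =>
    by_cases hs : TakesStep fp c p τ'
    · rw [(twoPhase_state_succ τ' p).2.1 hs]; omega
    · rw [(twoPhase_state_succ τ' p).2.2 hs]; exact ih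

theorem twoPhase_step_unique {p : Fin n} {τ τ' : ℕ} (h : TakesStep fp c p τ)
    (h' : TakesStep fp c p τ')
    (heq : ((asyncRun (twoPhase I late out) Vin sd fp c τ).state p).2 =
      ((asyncRun (twoPhase I late out) Vin sd fp c τ').state p).2) : τ = τ' := by
  rcases lt_trichotomy τ τ' with h1 | h1 | h1
  · have h2 := twoPhase_count_mono (late := late) (out := out) (Vin := Vin) (sd := sd) (fp := fp)
      (c := c) (p := p) (Nat.succ_le_of_lt h1)
    rw [Nat.succ_eq_add_one, (twoPhase_state_succ τ p).2.1 h] at h2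
    omega
  · exact h1
  · have h2 := twoPhase_count_mono (late := late) (out := out) (Vin := Vin) (sd := sd) (fp := fp)
      (c := c) (p := p) (Nat.succ_le_of_lt h1)
    rw [Nat.succ_eq_add_one, (twoPhase_state_succ τ' p).2.1 h'] at h2
    omega

/-- A process that takes infinitely many steps takes a `k`-th one, for each `k`. -/
theorem twoPhase_exists_step {p : Fin n} (hp : Correct fp p) (hinf : (c.steps p).Infinite) (k : ℕ) :
    ∃ τ, TakesStep fp c p τ ∧
      ((asyncRun (twoPhase I late out) Vin sd fp c τ).state p).2 = k := by
  classical
  have hstep : ∀ N, ∃ τ, N ≤ τ ∧ TakesStep fp c p τ := by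
    intro N
    obtain ⟨τ, h1, h2⟩ := hinf.exists_gt N
    exact ⟨τ, h2.le, h1, by rw [hp]; exact ENat.natCast_lt_top τ⟩
  have hunb : ∀ k, ∃ τ, k ≤ ((asyncRun (twoPhase I late out) Vin sd fp c τ).state p).2 := by
    intro k
    induction k with
    | zero => exact ⟨0, Nat.zero_le _⟩
    | succ k ih =>
      obtain ⟨τ, hτ⟩ := ih
      obtain ⟨τ', h1, h2⟩ := hstep τ
      have h3 := twoPhase_count_mono (late := late) (out := out) (Vin := Vin) (sd := sd) (fp := fp)
        (c := c) (p := p) h1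
      exact ⟨τ' + 1, by rw [(twoPhase_state_succ τ' p).2.1 h2]; omega⟩
  have hspec := Nat.find_spec (hunb (k + 1))
  have hmin := fun τ => Nat.find_min (hunb (k + 1)) (m := τ)
  rcases hτ : Nat.find (hunb (k + 1)) with _ | τ
  · rw [hτ] at hspec
    simp [asyncRun] at hspec
  · rw [hτ] at hspec hmin
    have h1 := hmin τ (by omega)
    by_cases hs : TakesStep fp c p τ
    · rw [(twoPhase_state_succ τ p).2.1 hs] at hspec
      exact ⟨τ, hs, by omega⟩
    · rw [(twoPhase_state_succ τ p).2.2 hs] at hspec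
      omega

open Classical in
theorem twoPhase_asyncOutputs {p : Fin n} {v : Fin 2} :
    AsyncOutputs (twoPhase I late out) Vin sd fp c p v ↔ ∃ τ, TakesStep fp c p τ ∧
      ((asyncRun (twoPhase I late out) Vin sd fp c τ).state p).2 = (late p).toNat ∧
      out p (sd p) (late p && decide (asyncObserved (twoPhase I late out) c τ
        (asyncRun (twoPhase I late out) Vin sd fp c τ) p).Nonempty) = some v := by
  refine exists_congr fun τ => and_congr_right fun _ => ?_
  have h := (twoPhase_state_succ (I := I) (late := late) (out := out) (Vin := Vin) (sd := sd)
    (fp := fp) (c := c) τ p).1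
  generalize (asyncRun (twoPhase I late out) Vin sd fp c τ).state p = st at h
  by_cases h1 : st.2 = (late p).toNat
  · simp [h1, h]
  · simp [h1]

theorem twoPhase_communicates {p : Fin n} {s : ℕ} {m : Unit} :
    Communicates (twoPhase I late out) Vin sd fp c p s m ↔ TakesStep fp c p s ∧
      ((asyncRun (twoPhase I late out) Vin sd fp c s).state p).2 = 0 ∧
      late p = false ∧ out p (sd p) false ≠ none := by
  rw [communicates_iff]
  refine and_congr_right fun hs => ?_
  have h := (twoPhase_state_succ (I := I) (late := late) (out := out) (Vin := Vin) (sd := sd)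
    (fp := fp) (c := c) (s + 1) p).1
  have h2 := (twoPhase_state_succ (I := I) (late := late) (out := out) (Vin := Vin) (sd := sd)
    (fp := fp) (c := c) s p).2.1 hs
  generalize (asyncRun (twoPhase I late out) Vin sd fp c (s + 1)).state p = st at h h2
  generalize ((asyncRun (twoPhase I late out) Vin sd fp c s).state p).2 = k at h2
  constructor
  · intro h3
    by_contra h4
    have h5 : ¬ (st.2 = 1 ∧ late p = false ∧ out p st.1 false ≠ none) := by
      rintro ⟨h6, h7⟩
      rw [h] at h7
      exact h4 ⟨by omega, h7⟩
    simp [h5] at h3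
  · rintro ⟨h3, h4⟩
    have h5 : st.2 = 1 ∧ late p = false ∧ out p st.1 false ≠ none := ⟨by omega, by rw [h]; exact h4⟩
    simp [h5]

/-- The outputs of `twoPhase` in any execution, in terms of the set of the processes that reach
their output step and of what the late ones observe in it. -/
theorem twoPhase_outputs {σ : Timing} {cdp : DelayPattern n σ}
    (hcdp : cdp ∈ CDP (twoPhase I late out) Vin sd fp σ) :
    ∃ (ran : Fin n → Prop) (b : Fin n → Bool),
      (∀ p v, Outputs (twoPhase I late out) Vin sd fp σ cdp p v ↔
        ran p ∧ out p (sd p) (b p) = some v) ∧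
      (∀ p, Correct fp p → ran p) ∧
      ∀ p, b p = true → ∃ r, late r = false ∧ ran r ∧ b r = false ∧ out r (sd r) false ≠ none := by
  classical
  cases σ with
  | sync =>
    refine ⟨fun p => ((2 * (late p).toNat + 1 : ℕ) : ℕ∞) < fp p, fun p => late p &&
      decide (∃ r, 2 < fp r ∧ late r = false ∧ out r (sd r) false ≠ none),
      fun p v => twoPhase_syncOutputs, fun p hp => ?_, fun p hp => ?_⟩
    · beta_reduce
      rw [hp]
      exact ENat.natCast_lt_top _
    · simp only [Bool.and_eq_true, decide_eq_true_eq] at hp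
      obtain ⟨_, r, h1, h2, h3⟩ := hp
      refine ⟨r, h2, ?_, by simp [h2], h3⟩
      simp only [h2, Bool.toNat_false]
      exact lt_of_le_of_lt (by norm_num) h1
  | async =>
    refine ⟨fun p => ∃ τ, TakesStep fp cdp p τ ∧
      ((asyncRun (twoPhase I late out) Vin sd fp cdp τ).state p).2 = (late p).toNat,
      fun p => late p && decide (∃ τ, TakesStep fp cdp p τ ∧
      ((asyncRun (twoPhase I late out) Vin sd fp cdp τ).state p).2 = (late p).toNat ∧
        (asyncObserved (twoPhase I late out) cdp τ
          (asyncRun (twoPhase I late out) Vin sd fp cdp τ) p).Nonempty), fun p v => ?_,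
      fun p hp => twoPhase_exists_step hp (hcdp.fair p hp) _, fun p hp => ?_⟩
    · have huniq : ∀ τ, TakesStep fp cdp p τ →
          ((asyncRun (twoPhase I late out) Vin sd fp cdp τ).state p).2 = (late p).toNat →
          ((∃ τ, TakesStep fp cdp p τ ∧
            ((asyncRun (twoPhase I late out) Vin sd fp cdp τ).state p).2 = (late p).toNat ∧
            (asyncObserved (twoPhase I late out) cdp τ
              (asyncRun (twoPhase I late out) Vin sd fp cdp τ) p).Nonempty) ↔
          (asyncObserved (twoPhase I late out) cdp τ
              (asyncRun (twoPhase I late out) Vin sd fp cdp τ) p).Nonempty) := by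
        intro τ h1 h2
        constructor
        · rintro ⟨τ', h3, h4, h5⟩
          rwa [twoPhase_step_unique h1 h3 (h2.trans h4.symm)]
        · intro h
          exact ⟨τ, h1, h2, h⟩
      refine Iff.trans twoPhase_asyncOutputs ?_
      constructor
      · rintro ⟨τ, h1, h2, h3⟩
        refine ⟨⟨τ, h1, h2⟩, ?_⟩
        simp only [huniq τ h1 h2]
        exact h3
      · rintro ⟨⟨τ, h1, h2⟩, h3⟩
        refine ⟨τ, h1, h2, ?_⟩
        simp only [huniq τ h1 h2] at h3
        exact h3
    · simp only [Bool.and_eq_true, decide_eq_true_eq] at hp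
      obtain ⟨_, τ, h1, h2, m, hm⟩ := hp
      obtain ⟨r, s, h3, _⟩ := mem_asyncObserved.1 hm
      obtain ⟨h4, h5, h6, h7⟩ := twoPhase_communicates.1 h3
      exact ⟨r, h6, ⟨s, h4, by rw [h5, h6]; rfl⟩, by simp [h6], h7⟩

open Classical in
/-- With any number of crashes, `twoPhase` has an execution in which all processes make the outputs
that their seeds allow. -/
theorem twoPhase_exists_outputs (σ : Timing) (Vin : Fin n → Option I) (sd : Fin n → S) {f : ℕ}
    (hf : f ≤ n) : ∃ fp ∈ FP n f, ∃ cdp ∈ CDP (twoPhase I late out) Vin sd fp σ,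
      ∀ p v, Outputs (twoPhase I late out) Vin sd fp σ cdp p v ↔
        out p (sd p) (late p && decide (∃ r, late r = false ∧ out r (sd r) false ≠ none)) =
          some v := by
  obtain ⟨fp, hfp, hfp4⟩ := exists_mem_FP hf 4
  have hlt : ∀ p (k : ℕ), k < 4 → (k : ℕ∞) < fp p := by
    intro p k hk
    rcases hfp4 p with h | h
    · rw [h]; exact ENat.natCast_lt_top k
    · rw [h]; exact_mod_cast hk
  refine ⟨fp, hfp, ?_⟩
  cases σ with
  | sync =>
    refine ⟨(), Set.mem_univ _, fun p v => ?_⟩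
    refine Iff.trans twoPhase_syncOutputs ?_
    have h1 : ((2 * (late p).toNat + 1 : ℕ) : ℕ∞) < fp p :=
      hlt p _ (by have := Bool.toNat_le (late p); omega)
    have h2 : ∀ r, 2 < fp r := fun r => hlt r 2 (by omega)
    simp only [h1, h2, true_and]
  | async =>
    refine ⟨lockStep n, (lockStep_steady n).admissible _ _ _, fun p v => ?_⟩
    refine Iff.trans twoPhase_asyncOutputs ?_
    have hs : ∀ p τ, τ < 4 → TakesStep fp (lockStep n) p τ :=
      fun p τ hτ => ⟨Set.mem_univ _, hlt p τ hτ⟩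
    have hK : ∀ p τ, τ ≤ 4 →
        ((asyncRun (twoPhase I late out) Vin sd fp (lockStep n) τ).state p).2 = τ := by
      intro p τ
      induction τ with
      | zero => intro _; rfl
      | succ τ ih =>
        intro hτ
        rw [(twoPhase_state_succ τ p).2.1 (hs p τ (by omega)), ih (by omega)]
    have hL : (late p).toNat < 4 := by have := Bool.toNat_le (late p); omega
    -- The late processes observe the early ones.
    have hobs : late p = true → ((asyncObserved (twoPhase I late out) (lockStep n) 1
        (asyncRun (twoPhase I late out) Vin sd fp (lockStep n) 1) p).Nonempty ↔
        ∃ r, late r = false ∧ out r (sd r) false ≠ none) := by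
      intro _
      constructor
      · rintro ⟨m, hm⟩
        obtain ⟨r, s, h1, _⟩ := mem_asyncObserved.1 hm
        exact ⟨r, (twoPhase_communicates.1 h1).2.2⟩
      · rintro ⟨r, hr⟩
        exact ⟨(), mem_asyncObserved.2 ⟨r, 0,
          twoPhase_communicates.2 ⟨hs r 0 (by omega), rfl, hr⟩, rfl⟩⟩
    have hb : (late p && decide (asyncObserved (twoPhase I late out) (lockStep n) (late p).toNat
        (asyncRun (twoPhase I late out) Vin sd fp (lockStep n) (late p).toNat) p).Nonempty) =
        (late p && decide (∃ r, late r = false ∧ out r (sd r) false ≠ none)) := by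
      rcases hl : late p with _ | _
      · rfl
      · simp only [Bool.true_and, Bool.toNat_true, hobs hl]
    constructor
    · rintro ⟨τ, h1, h2, h3⟩
      obtain rfl : τ = (late p).toNat :=
        twoPhase_step_unique h1 (hs p _ hL) (h2.trans (hK p _ hL.le).symm)
      rwa [hb] at h3
    · intro h
      exact ⟨(late p).toNat, hs p _ hL, hK p _ hL.le, by rwa [hb]⟩

open Classical in
/-- The combinatorial conditions under which `twoPhase` implements `O`. -/
theorem implementable_of_twoPhase {t : ℕ} {σ : Timing} {O : Set (Set (Fin 2))}
    (hne : O.Nonempty) (htn : t ≤ n) (late : Fin n → Bool)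
    (out : Fin n → S → Bool → Option (Fin 2))
    (hsafe : ∀ (sd : Fin n → S) (ran : Fin n → Prop) (b : Fin n → Bool),
      {p | ¬ ran p}.ncard ≤ t →
      (∀ p, b p = true →
        ∃ r, late r = false ∧ ran r ∧ b r = false ∧ out r (sd r) false ≠ none) →
      {v | ∃ p, ran p ∧ out p (sd p) (b p) = some v} ∈ O)
    (hcomp : ∀ o ∈ O, ∃ sd : Fin n → S, {v | ∃ p, out p (sd p) (late p &&
      decide (∃ r, late r = false ∧ out r (sd r) false ≠ none)) = some v} = o) :
    Implementable I S n t σ O := by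
  refine ⟨twoPhase I late out, hne, ?_, ?_⟩
  · intro f hf Vin sd fp hfp cdp hcdp
    obtain ⟨ran, b, h1, h2, h3⟩ := twoPhase_outputs hcdp
    refine ⟨fun p => if ran p then out p (sd p) (b p) else none, fun p v => ?_, ?_⟩
    · rw [h1]
      by_cases hr : ran p <;> simp [hr]
    · have hcard : {p | ¬ ran p}.ncard ≤ t := by
        have h4 : {p | ¬ ran p} ⊆ {p | ¬ Correct fp p} := fun p hp hc => hp (h2 p hc)
        have h5 := Set.ncard_le_ncard h4
        rw [show {p | ¬ Correct fp p}.ncard = f from hfp] at h5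
        omega
      have h4 := hsafe sd ran b hcard h3
      have h5 : OS (fun p => if ran p then out p (sd p) (b p) else none) =
          {v | ∃ p, ran p ∧ out p (sd p) (b p) = some v} := by
        ext v
        simp only [OS, Set.mem_ofPred_eq]
        refine exists_congr fun p => ?_
        by_cases hr : ran p <;> simp [hr]
      rwa [h5]
  · intro f hf o ho
    obtain ⟨sd, hsd⟩ := hcomp o ho
    obtain ⟨fp, hfp, cdp, hcdp, h1⟩ := twoPhase_exists_outputs (late := late) (out := out) σ
      (fun _ => (none : Option I)) sd (hf.trans htn)
    exact ⟨fun _ => none, sd, fp, hfp, cdp, hcdp, _, fun p v => (h1 p v).symm, hsd⟩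

end TwoPhase

/-! ### The simple sets of output sets -/

section Simple

variable {n : ℕ} {I S : Type} [Infinite S] {t : ℕ} {σ : Timing}

theorem exists_of_ncard_lt {ran : Fin n → Prop} (h : {p | ¬ ran p}.ncard ≤ t) (htn : t < n) :
    ∃ p, ran p := by
  by_contra hcon
  push Not at hcon
  have h1 : {p | ¬ ran p} = Set.univ := by
    ext p
    simpa using hcon p
  rw [h1, Set.ncard_univ, Nat.card_fin] at h
  omega

theorem eq_of_mem_iff {X Y : Set (Fin 2)} (x : Fin 2) (h : x ∈ X ↔ x ∈ Y)
    (h' : x + 1 ∈ X ↔ x + 1 ∈ Y) : X = Y := by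
  ext v
  rcases (show v = x ∨ v = x + 1 by omega) with rfl | rfl
  · exact h
  · exact h'

theorem fin_two_mem_pair (v : Fin 2) : v ∈ ({0, 1} : Set (Fin 2)) := by
  rcases (show v = 0 ∨ v = 1 by omega) with rfl | rfl <;> simp

theorem add_one_notMem_singleton (x : Fin 2) : x + 1 ∉ ({x} : Set (Fin 2)) := by
  intro h
  have : x + 1 = x := h
  omega

theorem eq_empty_or_singleton_or_pair (X : Set (Fin 2)) (x : Fin 2) (h : x + 1 ∈ X → x ∈ X) :
    X = ∅ ∨ X = {x} ∨ X = {0, 1} := by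
  by_cases h1 : x ∈ X
  · by_cases h2 : x + 1 ∈ X
    · exact Or.inr (Or.inr (eq_of_mem_iff x (iff_of_true h1 (fin_two_mem_pair _))
        (iff_of_true h2 (fin_two_mem_pair _))))
    · exact Or.inr (Or.inl (eq_of_mem_iff x (by simp [h1])
        (iff_of_false h2 (add_one_notMem_singleton x))))
  · have h2 : x + 1 ∉ X := fun h2 => h1 (h h2)
    exact Or.inl (eq_of_mem_iff x (by simp [h1]) (by simp [h2]))

/-- Each process outputs the value that its seed gives, if any. -/
theorem implementable_all (htn : t ≤ n) (hn : 2 ≤ n) :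
    Implementable I S n t σ {∅, {0}, {1}, {0, 1}} := by
  classical
  obtain ⟨g, hg⟩ := exists_surjective_seed S (Option (Fin 2))
  have hall : ∀ X : Set (Fin 2), X ∈ ({∅, {0}, {1}, {0, 1}} : Set (Set (Fin 2))) := by
    intro X
    by_cases h : (1 : Fin 2) ∈ X → (0 : Fin 2) ∈ X
    · rcases eq_empty_or_singleton_or_pair X 0 h with h | h | h <;> simp [h]
    · push Not at h
      have : X = {1} := eq_of_mem_iff 0 (by simp [h.2]) (by simp [h.1])
      simp [this]
  refine implementable_of_twoPhase (Set.insert_nonempty _ _) htn (fun _ => false)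
    (fun _ s _ => g s) (fun _ _ _ _ _ => hall _) (fun o _ => ?_)
  obtain ⟨s₀, hs₀⟩ := hg (if 0 ∈ o then some 0 else none)
  obtain ⟨s₁, hs₁⟩ := hg (if 1 ∈ o then some 1 else none)
  refine ⟨fun p => if p.val = 0 then s₀ else s₁, eq_of_mem_iff 0 ?_ ?_⟩
  · constructor
    · rintro ⟨p, hp⟩
      by_cases h0 : p.val = 0 <;> simp only [h0, if_true, if_false, hs₀, hs₁] at hp <;>
        split_ifs at hp with h1
      · exact h1
      · exact absurd hp (by decide)
    · intro h
      exact ⟨⟨0, by omega⟩, by simp [hs₀, h]⟩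
  · constructor
    · rintro ⟨p, hp⟩
      by_cases h0 : p.val = 0 <;> simp only [h0, if_true, if_false, hs₀, hs₁] at hp <;>
        split_ifs at hp with h1
      · exact absurd hp (by decide)
      · exact h1
    · intro h
      replace h : (1 : Fin 2) ∈ o := h
      exact ⟨⟨1, by omega⟩, by simp [hs₁, h]⟩

/-- Each process outputs the value that its seed gives. -/
theorem implementable_all_nonempty (htn : t < n) (hn : 2 ≤ n) :
    Implementable I S n t σ {{0}, {1}, {0, 1}} := by
  classical
  obtain ⟨g, hg⟩ := exists_surjective_seed S (Fin 2)
  have hall : ∀ X : Set (Fin 2), X.Nonempty ↔ X ∈ ({{0}, {1}, {0, 1}} : Set (Set (Fin 2))) := by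
    intro X
    constructor
    · intro hX
      by_cases h : (1 : Fin 2) ∈ X → (0 : Fin 2) ∈ X
      · rcases eq_empty_or_singleton_or_pair X 0 h with h | h | h
        · rw [h] at hX
          exact absurd hX Set.not_nonempty_empty
        · simp [h]
        · simp [h]
      · push Not at h
        have : X = {1} := eq_of_mem_iff 0 (by simp [h.2]) (by simp [h.1])
        simp [this]
    · rintro (rfl | rfl | h)
      · exact Set.singleton_nonempty _
      · exact Set.singleton_nonempty _
      · rw [Set.mem_singleton_iff.1 h]
        exact ⟨0, by simp⟩
  refine implementable_of_twoPhase (Set.insert_nonempty _ _) htn.le (fun _ => false)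
    (fun _ s _ => some (g s)) (fun sd ran b hran _ => ?_) (fun o ho => ?_)
  · rw [← hall]
    obtain ⟨p, hp⟩ := exists_of_ncard_lt hran htn
    exact ⟨g (sd p), p, hp, rfl⟩
  · obtain ⟨s₀, hs₀⟩ := hg (if 0 ∈ o then 0 else 1)
    obtain ⟨s₁, hs₁⟩ := hg (if 1 ∈ o then 1 else 0)
    obtain ⟨v, hv⟩ := (hall o).2 ho
    have hor : (0 : Fin 2) ∈ o ∨ (1 : Fin 2) ∈ o := by
      rcases (show v = 0 ∨ v = 1 by omega) with rfl | rfl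
      · exact Or.inl hv
      · exact Or.inr hv
    refine ⟨fun p => if p.val = 0 then s₀ else s₁, eq_of_mem_iff 0 ?_ ?_⟩
    · constructor
      · rintro ⟨p, hp⟩
        by_contra h0
        have h1 : (1 : Fin 2) ∈ o := hor.resolve_left h0
        simp only [Option.some.injEq] at hp
        split_ifs at hp with h2
        · rw [hs₀, if_neg h0] at hp
          exact absurd hp (by decide)
        · rw [hs₁, if_pos h1] at hp
          exact absurd hp (by decide)
      · intro h
        exact ⟨⟨0, by omega⟩, by simp [hs₀, h]⟩
    · constructor
      · rintro ⟨p, hp⟩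
        by_contra h1
        replace h1 : (1 : Fin 2) ∉ o := h1
        have h0 : (0 : Fin 2) ∈ o := hor.resolve_right h1
        simp only [Option.some.injEq] at hp
        split_ifs at hp with h2
        · rw [hs₀, if_pos h0] at hp
          exact absurd hp (by decide)
        · rw [hs₁, if_neg h1] at hp
          exact absurd hp (by decide)
      · intro h
        replace h : (1 : Fin 2) ∈ o := h
        exact ⟨⟨1, by omega⟩, by simp [hs₁, h]⟩

/-- Process 0 may output `x`, and any other process may output the other value, but only if it
observes that process 0 has made its output. -/
theorem implementable_pair_or_empty (htn : t ≤ n) (hn : 2 ≤ n) (x : Fin 2) :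
    Implementable I S n t σ {∅, {x}, {0, 1}} := by
  classical
  obtain ⟨g, hg⟩ := exists_surjective_seed S Bool
  obtain ⟨sT, hsT⟩ := hg true
  obtain ⟨sF, hsF⟩ := hg false
  have hx : x ≠ x + 1 := by omega
  refine implementable_of_twoPhase (Set.insert_nonempty _ _) htn (fun p => decide (p.val ≠ 0))
    (fun p s b => if p.val = 0 then (if g s = true then some x else none)
      else if (b && g s) = true then some (x + 1) else none) (fun sd ran b _ hb => ?_) ?_
  · refine eq_empty_or_singleton_or_pair _ x ?_
    rintro ⟨p, _, hp⟩
    by_cases h0 : p.val = 0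
    · simp only [h0, if_true] at hp
      split_ifs at hp with h1
      exact absurd (Option.some.inj hp) hx
    · simp only [h0, if_false] at hp
      split_ifs at hp with h1
      rw [Bool.and_eq_true] at h1
      obtain ⟨r, h2, h3, h4, h5⟩ := hb p h1.1
      have hr : r.val = 0 := by simpa using h2
      refine ⟨r, h3, ?_⟩
      simp only [hr, if_true] at h5 ⊢
      split_ifs at h5 ⊢ with h6
      · rfl
      · exact absurd rfl h5
  · have h0 : ∀ sd : Fin n → S, (∃ r : Fin n, decide (r.val ≠ 0) = false ∧
        (if r.val = 0 then (if g (sd r) = true then some x else none)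
          else if (false && g (sd r)) = true then some (x + 1) else none) ≠ none) ↔
        g (sd ⟨0, by omega⟩) = true := by
      intro sd
      constructor
      · rintro ⟨r, h1, h2⟩
        have hr : r.val = 0 := by simpa using h1
        simp only [hr, if_true] at h2
        by_contra h3
        have h4 : r = ⟨0, by omega⟩ := Fin.ext hr
        rw [← h4] at h3
        simp [h3] at h2
      · intro h
        exact ⟨⟨0, by omega⟩, by simp, by simp [h]⟩
    rintro o (rfl | rfl | ho)
    · refine ⟨fun _ => sF, ?_⟩
      ext v
      simp [hsF]
    · refine ⟨fun p => if p.val = 0 then sT else sF, eq_of_mem_iff x ?_ ?_⟩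
      · refine iff_of_true ⟨⟨0, by omega⟩, by simp [hsT]⟩ rfl
      · refine iff_of_false ?_ (add_one_notMem_singleton x)
        rintro ⟨p, hp⟩
        by_cases hp0 : p.val = 0
        · simp [hp0, hsT, hx] at hp
        · simp [hp0, hsF] at hp
    · obtain rfl := Set.mem_singleton_iff.1 ho
      refine ⟨fun _ => sT, eq_of_mem_iff x ?_ ?_⟩
      · exact iff_of_true ⟨⟨0, by omega⟩, by simp [hsT]⟩ (fin_two_mem_pair _)
      · refine iff_of_true ⟨⟨1, by omega⟩, ?_⟩ (fin_two_mem_pair _)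
        simp only [h0]
        simp [hsT]

/-- Process 0 outputs `x`, and each other process outputs `x` or, if it observes that process 0 has
made its output, possibly the other value. -/
theorem implementable_pair (htn : t < n) (hn : 2 ≤ n) (x : Fin 2) :
    Implementable I S n t σ {{x}, {0, 1}} := by
  classical
  obtain ⟨g, hg⟩ := exists_surjective_seed S Bool
  obtain ⟨sT, hsT⟩ := hg true
  obtain ⟨sF, hsF⟩ := hg false
  have hx : x ≠ x + 1 := by omega
  refine implementable_of_twoPhase (Set.insert_nonempty _ _) htn.le (fun p => decide (p.val ≠ 0))
    (fun p s b => if p.val = 0 then some x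
      else if (b && g s) = true then some (x + 1) else some x) (fun sd ran b hran hb => ?_) ?_
  · have hmem : x ∈ {v | ∃ p, ran p ∧ (if p.val = 0 then some x
        else if (b p && g (sd p)) = true then some (x + 1) else some x) = some v} := by
      obtain ⟨p, hp⟩ := exists_of_ncard_lt hran htn
      by_cases h1 : (b p && g (sd p)) = true
      · rw [Bool.and_eq_true] at h1
        obtain ⟨r, h2, h3, _⟩ := hb p h1.1
        have hr : r.val = 0 := by simpa using h2
        exact ⟨r, h3, by simp [hr]⟩
      · refine ⟨p, hp, ?_⟩
        rw [if_neg h1, ite_self]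
    rcases eq_empty_or_singleton_or_pair _ x (fun _ => hmem) with h | h
    · rw [h] at hmem
      exact absurd hmem (Set.notMem_empty x)
    · exact h
  · have h0 : ∀ sd : Fin n → S, ∃ r : Fin n, decide (r.val ≠ 0) = false ∧
        (if r.val = 0 then some x
          else if (false && g (sd r)) = true then some (x + 1) else some x) ≠ none :=
      fun sd => ⟨⟨0, by omega⟩, by simp, by simp⟩
    rintro o (rfl | ho)
    · refine ⟨fun _ => sF, eq_of_mem_iff x ?_ ?_⟩
      · exact iff_of_true ⟨⟨0, by omega⟩, by simp⟩ rfl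
      · refine iff_of_false ?_ (add_one_notMem_singleton x)
        rintro ⟨p, hp⟩
        simp [hsF, hx] at hp
    · obtain rfl := Set.mem_singleton_iff.1 ho
      refine ⟨fun _ => sT, eq_of_mem_iff x ?_ ?_⟩
      · exact iff_of_true ⟨⟨0, by omega⟩, by simp⟩ (fin_two_mem_pair _)
      · refine iff_of_true ⟨⟨1, by omega⟩, ?_⟩ (fin_two_mem_pair _)
        simp only [h0]
        simp [hsT]

/-- Only process 0 may make an output, given by its seed. -/
theorem implementable_of_leader {α : Type} [Countable α] [Nonempty α] (h : α → Option (Fin 2))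
    {O : Set (Set (Fin 2))} (hO : ∀ o, o ∈ O ↔ ∃ a, o = {v | h a = some v}) (htn : t ≤ n)
    (hn : 1 ≤ n) (hran : t = 0 ∨ ∅ ∈ O) : Implementable I S n t σ O := by
  classical
  obtain ⟨g, hg⟩ := exists_surjective_seed S α
  obtain ⟨a₀⟩ : Nonempty α := inferInstance
  have hset : ∀ (P : Fin n → Prop) (sd : Fin n → S), {v | ∃ p : Fin n, P p ∧
      (if p.val = 0 then h (g (sd p)) else none) = some v} =
      {v | P ⟨0, by omega⟩ ∧ h (g (sd ⟨0, by omega⟩)) = some v} := by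
    intro P sd
    ext v
    constructor
    · rintro ⟨p, h1, h2⟩
      split_ifs at h2 with h3
      have h4 : p = ⟨0, by omega⟩ := Fin.ext h3
      rw [h4] at h1 h2
      exact ⟨h1, h2⟩
    · rintro ⟨h1, h2⟩
      exact ⟨⟨0, by omega⟩, h1, by simpa using h2⟩
  refine implementable_of_twoPhase ⟨_, (hO _).2 ⟨a₀, rfl⟩⟩ htn (fun _ => false)
    (fun p s _ => if p.val = 0 then h (g s) else none) (fun sd ran b hcard _ => ?_)
    (fun o ho => ?_)
  · rw [hset]
    by_cases h0 : ran ⟨0, by omega⟩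
    · rw [hO]
      exact ⟨g (sd ⟨0, by omega⟩), by simp [h0]⟩
    · rcases hran with rfl | hran
      · have h1 := (Set.ncard_eq_zero).1 (Nat.le_zero.1 hcard)
        have h2 : (⟨0, by omega⟩ : Fin n) ∈ {p | ¬ ran p} := h0
        rw [h1] at h2
        exact absurd h2 (Set.notMem_empty _)
      · simpa [h0] using hran
  · obtain ⟨a, rfl⟩ := (hO o).1 ho
    obtain ⟨s, hs⟩ := hg a
    refine ⟨fun _ => s, ?_⟩
    have h1 := hset (fun _ => True) (fun _ => s)
    simp only [true_and, hs] at h1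
    simp only [hs]
    exact h1

theorem setOf_some (x : Fin 2) : {v | some x = some v} = {x} := by
  ext v
  simp [eq_comm]

theorem setOf_none : {v : Fin 2 | none = some v} = ∅ := by
  ext v
  simp

theorem implementable_at_most_one (htn : t ≤ n) (hn : 1 ≤ n) :
    Implementable I S n t σ {∅, {0}, {1}} := by
  refine implementable_of_leader (α := Option (Fin 2)) id (fun o => ?_) htn hn (Or.inr (by simp))
  constructor
  · rintro (rfl | rfl | ho)
    · exact ⟨none, setOf_none.symm⟩
    · exact ⟨some 0, (setOf_some 0).symm⟩
    · exact ⟨some 1, ho.trans (setOf_some 1).symm⟩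
  · rintro ⟨_ | x, rfl⟩
    · exact Or.inl setOf_none
    · simp only [id, setOf_some]
      rcases (show x = 0 ∨ x = 1 by omega) with rfl | rfl <;> simp

theorem implementable_agreement_of_eq_zero (ht : t = 0) (hn : 1 ≤ n) :
    Implementable I S n t σ {{0}, {1}} := by
  refine implementable_of_leader (α := Fin 2) some (fun o => ?_) (by omega) hn (Or.inl ht)
  simp only [setOf_some]
  constructor
  · rintro (rfl | ho)
    · exact ⟨0, rfl⟩
    · exact ⟨1, ho⟩
  · rintro ⟨x, rfl⟩
    rcases (show x = 0 ∨ x = 1 by omega) with rfl | rfl <;> simp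

theorem implementable_singleton_or_empty (htn : t ≤ n) (hn : 1 ≤ n) (x : Fin 2) :
    Implementable I S n t σ {∅, {x}} := by
  refine implementable_of_leader (α := Bool) (fun a => if a then some x else none) (fun o => ?_)
    htn hn (Or.inr (by simp))
  constructor
  · rintro (rfl | ho)
    · exact ⟨false, setOf_none.symm⟩
    · exact ⟨true, ho.trans (setOf_some x).symm⟩
  · rintro ⟨_ | _, rfl⟩
    · exact Or.inl setOf_none
    · exact Or.inr (setOf_some x)

/-- Each process outputs `x`. -/
theorem implementable_singleton (htn : t < n) (x : Fin 2) :
    Implementable I S n t σ {{x}} := by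
  obtain ⟨s⟩ : Nonempty S := inferInstance
  refine implementable_of_twoPhase (Set.singleton_nonempty _) htn.le (fun _ => false)
    (fun _ _ _ => some x) (fun sd ran b hran _ => ?_) (fun o ho => ⟨fun _ => s, ?_⟩)
  · obtain ⟨p, hp⟩ := exists_of_ncard_lt hran htn
    refine Set.mem_singleton_iff.2 ?_
    rw [← setOf_some x]
    ext v
    exact ⟨fun ⟨_, _, h⟩ => h, fun h => ⟨p, hp, h⟩⟩
  · rw [Set.mem_singleton_iff.1 ho, ← setOf_some x]
    ext v
    exact ⟨fun ⟨_, h⟩ => h, fun h => ⟨⟨0, by omega⟩, h⟩⟩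

/-- No process makes an output. -/
theorem implementable_empty (htn : t ≤ n) : Implementable I S n t σ {∅} := by
  obtain ⟨s⟩ : Nonempty S := inferInstance
  refine implementable_of_twoPhase (Set.singleton_nonempty _) htn (fun _ => false)
    (fun _ _ _ => none) (fun sd ran b hran _ => ?_) (fun o ho => ⟨fun _ => s, ?_⟩)
  · simp
  · rw [Set.mem_singleton_iff.1 ho]
    simp

end Simple

end BinaryOutput

open BinaryOutput

theorem mainTheorem1 (I S : Type) [Infinite S] (n t : ℕ) :
    (∀ σ, BinaryOutput.Implementable I S n t σ {∅, {0}, {1}, {0, 1}} ↔ n ≥ t ∧ n ≥ 2) ∧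
    (∀ σ, BinaryOutput.Implementable I S n t σ {{0}, {1}, {0, 1}} ↔ n > t ∧ n ≥ 2) ∧
    (∀ σ, BinaryOutput.Implementable I S n t σ {∅, {1}, {0, 1}} ↔ n ≥ t ∧ n ≥ 2) ∧
    (∀ σ, BinaryOutput.Implementable I S n t σ {{1}, {0, 1}} ↔ n > t ∧ n ≥ 2) ∧
    (∀ σ, BinaryOutput.Implementable I S n t σ {∅, {0}, {0, 1}} ↔ n ≥ t ∧ n ≥ 2) ∧
    (∀ σ, BinaryOutput.Implementable I S n t σ {{0}, {0, 1}} ↔ n > t ∧ n ≥ 2) ∧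
    (BinaryOutput.Implementable I S n t .async {∅, {0, 1}} ↔
      (n : ℚ) > 3 / 2 * (t : ℚ) + 1 ∧ n ≥ 2) ∧
    (BinaryOutput.Implementable I S n t .sync {∅, {0, 1}} ↔ n ≥ t + 2 ∧ n ≥ 2) ∧
    (BinaryOutput.Implementable I S n t .async {{0, 1}} ↔
      (n : ℚ) > 3 / 2 * (t : ℚ) + 1 ∧ n ≥ 2) ∧
    (BinaryOutput.Implementable I S n t .sync {{0, 1}} ↔ n ≥ t + 2 ∧ n ≥ 2) ∧
    (∀ σ, BinaryOutput.Implementable I S n t σ {∅, {0}, {1}} ↔ n ≥ t ∧ n ≥ 1) ∧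
    (BinaryOutput.Implementable I S n t .async {{0}, {1}} ↔ t = 0 ∧ n ≥ 1) ∧
    (BinaryOutput.Implementable I S n t .sync {{0}, {1}} ↔ n > t ∧ n ≥ 1) ∧
    (∀ σ, BinaryOutput.Implementable I S n t σ {∅, {1}} ↔ n ≥ t ∧ n ≥ 1) ∧
    (∀ σ, BinaryOutput.Implementable I S n t σ {{1}} ↔ n > t ∧ n ≥ 1) ∧
    (∀ σ, BinaryOutput.Implementable I S n t σ {∅, {0}} ↔ n ≥ t ∧ n ≥ 1) ∧
    (∀ σ, BinaryOutput.Implementable I S n t σ {{0}} ↔ n > t ∧ n ≥ 1) ∧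
    (∀ σ, BinaryOutput.Implementable I S n t σ {∅} ↔ n ≥ t) := by
  have hempty : ∀ {O : Set (Set (Fin 2))}, (∀ o ∈ O, o.Nonempty) → ∅ ∉ O :=
    fun h h' => Set.not_nonempty_empty (h _ h')
  have h01 : ({0, 1} : Set (Fin 2)).Nonempty := ⟨0, by simp⟩
  have hq : (n : ℚ) > 3 / 2 * (t : ℚ) + 1 ↔ 3 * t + 2 < 2 * n := by
    have h : ((3 * t + 2 : ℕ) : ℚ) < ((2 * n : ℕ) : ℚ) ↔ 3 * t + 2 < 2 * n := Nat.cast_lt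
    rw [← h]
    push_cast
    constructor <;> intro h <;> linarith
  refine ⟨fun σ => ⟨fun ⟨A, hA⟩ => ⟨le_of_implements hA, two_le_of_implements hA (by simp)⟩,
    fun h => implementable_all h.1 h.2⟩, ?_⟩
  refine ⟨fun σ => ⟨fun ⟨A, hA⟩ => ⟨lt_of_implements hA (hempty (by simp [h01])),
    two_le_of_implements hA (by simp)⟩, fun h => implementable_all_nonempty h.1 h.2⟩, ?_⟩
  refine ⟨fun σ => ⟨fun ⟨A, hA⟩ => ⟨le_of_implements hA, two_le_of_implements hA (by simp)⟩,
    fun h => implementable_pair_or_empty h.1 h.2 1⟩, ?_⟩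
  refine ⟨fun σ => ⟨fun ⟨A, hA⟩ => ⟨lt_of_implements hA (hempty (by simp [h01])),
    two_le_of_implements hA (by simp)⟩, fun h => implementable_pair h.1 h.2 1⟩, ?_⟩
  refine ⟨fun σ => ⟨fun ⟨A, hA⟩ => ⟨le_of_implements hA, two_le_of_implements hA (by simp)⟩,
    fun h => implementable_pair_or_empty h.1 h.2 0⟩, ?_⟩
  refine ⟨fun σ => ⟨fun ⟨A, hA⟩ => ⟨lt_of_implements hA (hempty (by simp [h01])),
    two_le_of_implements hA (by simp)⟩, fun h => implementable_pair h.1 h.2 0⟩, ?_⟩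
  refine ⟨⟨fun ⟨A, hA⟩ => ⟨hq.2 (lt_of_implements_async_both hA subset_rfl (by simp)),
    two_le_of_implements hA (by simp)⟩, fun h => (implementable_async_both (hq.1 h.1)).1⟩, ?_⟩
  refine ⟨⟨fun ⟨A, hA⟩ => ⟨add_two_le_of_implements_sync_both hA subset_rfl (by simp),
    two_le_of_implements hA (by simp)⟩, fun h => (implementable_sync_both h.1).1⟩, ?_⟩
  refine ⟨⟨fun ⟨A, hA⟩ => ⟨hq.2 (lt_of_implements_async_both hA (by simp) (by simp)),
    two_le_of_implements hA (by simp)⟩, fun h => (implementable_async_both (hq.1 h.1)).2⟩, ?_⟩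
  refine ⟨⟨fun ⟨A, hA⟩ => ⟨add_two_le_of_implements_sync_both hA (by simp) (by simp),
    two_le_of_implements hA (by simp)⟩, fun h => (implementable_sync_both h.1).2⟩, ?_⟩
  refine ⟨fun σ => ⟨fun ⟨A, hA⟩ => ⟨le_of_implements hA,
    one_le_of_implements hA (o := {0}) (by simp) (by simp)⟩,
    fun h => implementable_at_most_one h.1 h.2⟩, ?_⟩
  refine ⟨⟨fun ⟨A, hA⟩ => ⟨?_, one_le_of_implements hA (o := {0}) (by simp) (by simp)⟩,
    fun h => implementable_agreement_of_eq_zero h.1 h.2⟩, ?_⟩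
  · by_contra ht
    exact not_implements_agreement (by omega) hA
  refine ⟨⟨fun ⟨A, hA⟩ => ⟨lt_of_implements hA (hempty (by simp)),
    one_le_of_implements hA (o := {0}) (by simp) (by simp)⟩,
    fun h => implementable_sync_agreement h.1⟩, ?_⟩
  refine ⟨fun σ => ⟨fun ⟨A, hA⟩ => ⟨le_of_implements hA,
    one_le_of_implements hA (o := {1}) (by simp) (by simp)⟩,
    fun h => implementable_singleton_or_empty h.1 h.2 1⟩, ?_⟩
  refine ⟨fun σ => ⟨fun ⟨A, hA⟩ => ⟨lt_of_implements hA (hempty (by simp)),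
    one_le_of_implements hA (o := {1}) (by simp) (by simp)⟩,
    fun h => implementable_singleton h.1 1⟩, ?_⟩
  refine ⟨fun σ => ⟨fun ⟨A, hA⟩ => ⟨le_of_implements hA,
    one_le_of_implements hA (o := {0}) (by simp) (by simp)⟩,
    fun h => implementable_singleton_or_empty h.1 h.2 0⟩, ?_⟩
  refine ⟨fun σ => ⟨fun ⟨A, hA⟩ => ⟨lt_of_implements hA (hempty (by simp)),
    one_le_of_implements hA (o := {0}) (by simp) (by simp)⟩,
    fun h => implementable_singleton h.1 0⟩, ?_⟩
  exact fun σ => ⟨fun ⟨A, hA⟩ => le_of_implements hA, fun h => implementable_empty h⟩
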